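/- Let USTCON be the following problem: given a simple undirected graph $G=(V,E)$ with $|V|=n$, maximum degree $\Delta$ and at least one edge, and two nodes $s,t\in V$, decide whether $s$ and $t$ lie in the same connected component of $G$. The model is a randomized RAM (one fixed finite program; memory cells hold natural numbers; an instruction may draw a uniformly random element of $\{0,\dots,a\}$) with read-only access to $V=\{0,\dots,n-1\}$, $s$, $t$, a parameter $p$, the degrees $\deg(v)$, and, for an arbitrary local ordering $PORT_v:\Gamma(v)\to\{0,\dots,\deg(v)-1\}$ of the neighbors of every node $v$, the values of $PORT_v$ and $PORT_v^{-1}$. Time is measured by the logarithmic cost criterion, and space is the number of bits of working memory in use (bit lengths of addresses and contents of nonzero cells). Logarithms are binary and $$n_p=\max\left\{\gamma\,\tfrac{n}{p}\log n,\ \Delta\right\},\qquad \gamma=60.$$ **Proposition.** There are a single program and absolute constants $C,k\in\mathbb N$ such that for all such $G$, all local orderings, all $s,t\in V$ and all integers $p\ge 1$: 1. (Space) on every run, at every moment, at most $C\,(\log(n+p))^k\,p$ bits of working memory are in use, i.e. $S=\tilde O(p)$; 2. (Time) every run halts after time at most $C\,(\log(n+p))^k\,n_p^2\,p$, i.e.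 $T=\tilde O(n_p^2\,p)$; 3. (Algorithm) the answer of the program has exactly the distribution of the answer of the following landmark algorithm. The landmarks are $s$, $t$ and $p$ independent uniformly random nodes of $V$. From each landmark, run $\beta\lceil\log n\rceil$ independent walks, $\beta=72$, each of length $\bar n_p^2$, where $\bar n_p=\max\{\lceil\gamma n\lceil\log n\rceil/p\rceil,\Delta\}$ is the integer version of $n_p$. The walks are Metropolis–Hastings walks with unit potential: from $v$ the next node is $u\in\Gamma(v)$ with probability $\min\{1/\deg(v),1/\deg(u)\}$, and otherwise $v$. Whenever a walk from a landmark hits another landmark, merge the classes of the two; answer "connected" iff $s$ and $t$ end up in the same class; 4. (One-sided error) if $s$ and $t$ lie in different components, the answer "connected" has probability $0$; if they lie in the same component, the answer "not connected" has probability at most $\frac1n$. -/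

import Mathlib

open scoped NNReal ENNReal

noncomputable section

/-! ## A randomized RAM with logarithmic cost and read-only graph input -/

namespace RAM

/-- What the machine can ask about its read-only input: the numbers `n`, `s`, `t`, `p`, the degree
of a node, the neighbor `PORT_v⁻¹(i)` of `v` behind port `i`, and the port `PORT_v(u)`. -/
structure Input where
  size : ℕ
  source : ℕ
  target : ℕ
  param : ℕ
  deg : ℕ → ℕ
  nbr : ℕ → ℕ → ℕ
  port : ℕ → ℕ → ℕ

/-- Instructions; `M[a]` is the content of memory cell `a`, arguments are constants of the program.
Names: `d` is a destination cell, `a`, `b` are operand cells, `c` is a number, `l` is a label. -/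
inductive Instr where
  /-- `M[d] := c` -/
  | const (d c : ℕ)
  /-- `M[d] := M[a]` -/
  | copy (d a : ℕ)
  /-- `M[d] := M[a] + M[b]` -/
  | add (d a b : ℕ)
  /-- `M[d] := max (M[a] - M[b]) 0` -/
  | sub (d a b : ℕ)
  /-- `M[d] := M[a] * M[b]` -/
  | mul (d a b : ℕ)
  /-- `M[d] := ⌊M[a] / M[b]⌋` (and `0` if `M[b] = 0`) -/
  | div (d a b : ℕ)
  /-- `M[d] := M[M[a]]` -/
  | load (d a : ℕ)
  /-- `M[M[a]] := M[b]` -/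
  | store (a b : ℕ)
  /-- go to `l` -/
  | jump (l : ℕ)
  /-- if `M[a] < M[b]` go to `l` -/
  | jumpLt (a b l : ℕ)
  /-- `M[d] := n` -/
  | getSize (d : ℕ)
  /-- `M[d] := s` -/
  | getSource (d : ℕ)
  /-- `M[d] := t` -/
  | getTarget (d : ℕ)
  /-- `M[d] := p` -/
  | getParam (d : ℕ)
  /-- `M[d] := deg(M[a])` -/
  | getDeg (d a : ℕ)
  /-- `M[d] := ` the neighbor of node `M[a]` behind port `M[b]` -/
  | getNbr (d a b : ℕ)
  /-- `M[d] := ` the port of node `M[a]` that leads to node `M[b]` -/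
  | getPort (d a b : ℕ)
  /-- `M[d] := ` a fresh uniformly random element of `{0, 1, …, M[a]}` -/
  | rand (d a : ℕ)
  /-- halt with the answer "connected" -/
  | accept
  /-- halt with the answer "not connected" -/
  | reject

/-- A program is a fixed finite list of instructions. -/
abbrev Program := List Instr

/-- A configuration: the program counter and the memory (almost all cells are `0`). -/
structure Config where
  pc : ℕ
  mem : ℕ →₀ ℕ

/-- Length of the binary representation of `x` (with value `1` at `x = 0`). -/
def bits (x : ℕ) : ℕ := Nat.log 2 x + 1

/-- The instruction that is executed next; running past the end of the program is `reject`. -/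
def fetch (P : Program) (c : Config) : Instr := P.getD c.pc Instr.reject

/-- The answer of a halted configuration; `none` while the machine is running. -/
def output (P : Program) (c : Config) : Option Bool :=
  match fetch P c with
  | .accept => some true
  | .reject => some false
  | _ => none

/-- Write `x` to cell `d` and go to the next instruction. -/
def Config.write (c : Config) (d x : ℕ) : Config := ⟨c.pc + 1, c.mem.update d x⟩

/-- One step of the machine, as a probability distribution on the next configuration. -/
def step (P : Program) (I : Input) (c : Config) : PMF Config :=
  let M := c.mem
  match fetch P c with
  | .const d x => PMF.pure (c.write d x)
  | .copy d a => PMF.pure (c.write d (M a))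
  | .add d a b => PMF.pure (c.write d (M a + M b))
  | .sub d a b => PMF.pure (c.write d (M a - M b))
  | .mul d a b => PMF.pure (c.write d (M a * M b))
  | .div d a b => PMF.pure (c.write d (M a / M b))
  | .load d a => PMF.pure (c.write d (M (M a)))
  | .store a b => PMF.pure (c.write (M a) (M b))
  | .jump l => PMF.pure ⟨l, M⟩
  | .jumpLt a b l => PMF.pure ⟨if M a < M b then l else c.pc + 1, M⟩
  | .getSize d => PMF.pure (c.write d I.size)
  | .getSource d => PMF.pure (c.write d I.source)
  | .getTarget d => PMF.pure (c.write d I.target)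
  | .getParam d => PMF.pure (c.write d I.param)
  | .getDeg d a => PMF.pure (c.write d (I.deg (M a)))
  | .getNbr d a b => PMF.pure (c.write d (I.nbr (M a) (M b)))
  | .getPort d a b => PMF.pure (c.write d (I.port (M a) (M b)))
  | .rand d a => (PMF.uniformOfFintype (Fin (M a + 1))).map fun x => c.write d x
  | .accept => PMF.pure c
  | .reject => PMF.pure c

/-- Logarithmic cost of the next instruction: one, plus the bit lengths of all addresses and
contents of cells that take part in it, and of the values obtained from the input. -/
def cost (P : Program) (I : Input) (c : Config) : ℕ :=
  let M := c.mem
  let cell := fun a => bits a + bits (M a)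
  match fetch P c with
  | .const d x => 1 + bits d + bits x
  | .copy d a => 1 + bits d + cell a
  | .add d a b => 1 + bits d + cell a + cell b
  | .sub d a b => 1 + bits d + cell a + cell b
  | .mul d a b => 1 + bits d + cell a + cell b
  | .div d a b => 1 + bits d + cell a + cell b
  | .load d a => 1 + bits d + cell a + bits (M (M a))
  | .store a b => 1 + cell a + cell b
  | .jump _ => 1
  | .jumpLt a b _ => 1 + cell a + cell b
  | .getSize d => 1 + bits d + bits I.size
  | .getSource d => 1 + bits d + bits I.source
  | .getTarget d => 1 + bits d + bits I.target
  | .getParam d => 1 + bits d + bits I.param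
  | .getDeg d a => 1 + bits d + cell a + bits (I.deg (M a))
  | .getNbr d a b => 1 + bits d + cell a + cell b + bits (I.nbr (M a) (M b))
  | .getPort d a b => 1 + bits d + cell a + cell b + bits (I.port (M a) (M b))
  | .rand d a => 1 + bits d + cell a
  | .accept => 1
  | .reject => 1

/-- Number of bits of working memory in use: bit lengths of the addresses and of the contents of
all nonzero cells. The input is read-only and is not counted. -/
def Config.space (c : Config) : ℕ := ∑ a ∈ c.mem.support, (bits a + bits (c.mem a))

/-- The initial configuration: first instruction, all cells `0`. -/
def init : Config := ⟨0, 0⟩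

/-- `Reaches P I c T`: some run of `P` on input `I`, i.e. a run for some outcomes of the random
choices, arrives at the configuration `c` after total time `T`. -/
inductive Reaches (P : Program) (I : Input) : Config → ℕ → Prop
  | start : Reaches P I init 0
  | next {c c' : Config} {T : ℕ} (h : Reaches P I c T) (hrun : output P c = none)
      (hstep : c' ∈ (step P I c).support) : Reaches P I c' (T + cost P I c)

/-- Every run of `P` on `I` halts, and takes time at most `B` (each step costs at least `1`, so a
run that does not halt would violate every bound). -/
def TimeAtMost (P : Program) (I : Input) (B : ℝ) : Prop :=
  ∀ c T, Reaches P I c T → (T : ℝ) ≤ B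

/-- On every run of `P` on `I`, at every moment, at most `B` bits of memory are in use. -/
def SpaceAtMost (P : Program) (I : Input) (B : ℝ) : Prop :=
  ∀ c T, Reaches P I c T → (c.space : ℝ) ≤ B

/-- Distribution of the configuration after `k` steps from `c` (halted configurations stay). -/
def iterate (P : Program) (I : Input) : ℕ → Config → PMF Config
  | 0, c => PMF.pure c
  | k + 1, c => (step P I c).bind (iterate P I k)

/-- The probability that `P` halts on `I` with the answer `b`. -/
def outputProb (P : Program) (I : Input) (b : Bool) : ℝ≥0∞ :=
  ⨆ k : ℕ, ((iterate P I k init).map (output P)) (some b)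

end RAM

/-- The input of the machine for an instance of USTCON: a graph on the nodes `0, …, n - 1` with a
local ordering `port v` of the neighbors of each node `v`, two nodes `s`, `t` and the parameter
`p`. Meaningless queries are answered by `0`. -/
def ustconInput {n : ℕ} (G : SimpleGraph (Fin n)) [DecidableRel G.Adj]
    (port : ∀ v : Fin n, G.neighborSet v ≃ Fin (G.degree v)) (s t : Fin n) (p : ℕ) : RAM.Input where
  size := n
  source := s
  target := t
  param := p
  deg v := if hv : v < n then G.degree ⟨v, hv⟩ else 0
  nbr v i :=
    if hv : v < n then
      if hi : i < G.degree ⟨v, hv⟩ then (((port ⟨v, hv⟩).symm ⟨i, hi⟩ : Fin n) : ℕ) else 0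
    else 0
  port v u :=
    if hv : v < n then
      if hu : u < n then
        if hvu : G.Adj ⟨v, hv⟩ ⟨u, hu⟩ then (port ⟨v, hv⟩ ⟨⟨u, hu⟩, hvu⟩ : ℕ) else 0
      else 0
    else 0

/-! ## The Metropolis–Hastings walk and the landmark algorithm -/

section Landmarks

variable {V : Type} [Fintype V] [DecidableEq V]

/-- Weight of the arc `(v, u)` of `G_f`:  `min (f v / deg v) (f u / deg u)` on edges, and on the
loop at `v` what is left of `f v` (the subtraction never truncates). -/
def mhWeight (G : SimpleGraph V) [DecidableRel G.Adj] (f : V → ℝ≥0) (v u : V) : ℝ≥0 :=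
  if u = v then f v - ∑ x ∈ G.neighborFinset v, min (f v / G.degree v) (f x / G.degree x)
  else if G.Adj v u then min (f v / G.degree v) (f u / G.degree u)
  else 0

theorem mhWeight_le (G : SimpleGraph V) [DecidableRel G.Adj] (f : V → ℝ≥0) (v : V) :
    f v ≤ ∑ u, mhWeight G f v u := by
  have h : ∑ u, mhWeight G f v u = mhWeight G f v v +
      ∑ x ∈ G.neighborFinset v, min (f v / G.degree v) (f x / G.degree x) := by
    rw [← Finset.add_sum_erase _ _ (Finset.mem_univ v)]
    congr 1
    symm
    apply Finset.sum_subset_zero_on_sdiff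
    · intro x hx
      rw [SimpleGraph.mem_neighborFinset] at hx
      exact Finset.mem_erase.2 ⟨hx.ne', Finset.mem_univ x⟩
    · intro x hx
      simp only [Finset.mem_sdiff, Finset.mem_erase, Finset.mem_univ, and_true,
        SimpleGraph.mem_neighborFinset] at hx
      simp [mhWeight, hx.1, hx.2]
    · intro x hx
      rw [SimpleGraph.mem_neighborFinset] at hx
      simp [mhWeight, hx, hx.ne']
  rw [h, mhWeight, if_pos rfl]
  exact le_tsub_add

/-- One step of the Metropolis–Hastings walk `RW(G_f)` from `v`: an arc at `v` is followed with
probability proportional to its weight. -/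
def mhStep (G : SimpleGraph V) [DecidableRel G.Adj] (f : V → ℝ≥0) (hf : ∀ v, 0 < f v) (v : V) :
    PMF V :=
  PMF.normalize (fun u => (mhWeight G f v u : ℝ≥0∞))
    (by
      rw [tsum_fintype]
      have h := (hf v).trans_le (mhWeight_le G f v)
      exact_mod_cast h.ne')
    (by
      rw [tsum_fintype]
      exact_mod_cast ENNReal.coe_ne_top)

/-- One step of the walk `RW(G_1)` with unit potential. -/
def unitStep (G : SimpleGraph V) [DecidableRel G.Adj] (v : V) : PMF V :=
  mhStep G (fun _ => 1) (fun _ => one_pos) v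

/-- The walk `RW(G_1)` of length `k` from `v`: the list of its positions after `1, …, k` steps. -/
def mhWalk (G : SimpleGraph V) [DecidableRel G.Adj] : ℕ → V → PMF (List V)
  | 0, _ => PMF.pure []
  | k + 1, v => (unitStep G v).bind fun u => (mhWalk G k u).map fun X => u :: X

/-- Run one independent walk of length `τ` from each entry of a list of starting nodes. The result
is the set of discovered pairs `(l, x)`: a walk from `l` has hit the landmark `x ∈ L`. -/
def discover (G : SimpleGraph V) [DecidableRel G.Adj] (L : List V) (τ : ℕ) :
    List V → PMF (Set (V × V))
  | [] => PMF.pure ∅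
  | l :: ls => (mhWalk G τ l).bind fun X =>
      (discover G L τ ls).map fun D => {q | q.1 = l ∧ q.2 ∈ X ∧ q.2 ∈ L} ∪ D

/-- The number `n_p = max {γ (n / p) log n, Δ}`, with `γ = 60` and binary logarithm. -/
def nP (n p Δ : ℕ) : ℝ := max (60 * (n / p) * Real.logb 2 n) Δ

/-- `n_p` as used by the algorithm: an integer, with `⌈log n⌉` in place of `log n`. -/
def nPCeil (n p Δ : ℕ) : ℕ := max ((60 * n * Nat.clog 2 n) ⌈/⌉ p) Δ

open Classical in
/-- The landmark algorithm. The landmarks are `s`, `t` and `p` independent uniformly random nodes.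
From every landmark `β ⌈log n⌉` independent walks `RW(G_1)` of length `n_p²` are run, with `β = 72`.
Landmarks are merged when a walk from one hits the other; the answer is `true` ("connected") if
`s` and `t` end up in the same class. -/
def landmarkAlgorithm (G : SimpleGraph V) [DecidableRel G.Adj] (s t : V) (p : ℕ) : PMF Bool :=
  haveI : Nonempty V := ⟨s⟩
  let n := Fintype.card V
  (PMF.uniformOfFintype (Fin p → V)).bind fun ℓ =>
    let L := s :: t :: List.ofFn ℓ
    let starts := (List.replicate (72 * Nat.clog 2 n) L).flatten
    (discover G L (nPCeil n p G.maxDegree ^ 2) starts).map fun D =>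
      decide (Relation.EqvGen (fun a b => (a, b) ∈ D) s t)

end Landmarks

end

/-! The resource bounds come from a direct implementation. The program uses 32 registers; from
address 32 on it interleaves three arrays: parent pointers and class sizes of a union-find forest,
indexed by nodes, and the list of landmarks. The addresses range over all nodes, but only cells
belonging to landmarks are ever nonzero, and space counts nonzero cells; this gives `Õ(p)` bits.
There are `72⌈log n⌉` rounds of `p + 2` walks with `n̄_p²` steps each. Union by size keeps the
forest of depth at most `⌈log n⌉`, so a step costs `O(log n)` instructions, and an instruction costs
`O(log(n + p))`. Exactness of the answer's distribution is proved with a Hoare-style calculus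
(`Tri`) that couples the final memory with an abstract random variable; `ustconProgram_spec`
collects the result.

If `s` and `t` are not connected, discovered pairs never leave a component. The content is the case
where they are connected. Since all walks use a symmetric transition matrix, the truncated Green
function `green T` is symmetric and has the energy of a potential of a unit current. Let `T` be
about half the walk length. Either a walk from `s` hits `t` with probability at least `0.01`, and
the `72⌈log n⌉` walks from `s` suffice, or the potential drops almost completely between `t` and
`s`. A geodesic in a set of `N` nodes has resistance at most `4N`, so in the second case the
component has at least about `√T / 2` nodes (`sq_le_card_sq`), and then no node is visited more than
`8.4 √T` times in expectation (`green_diag_le`).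

With these bounds, `p` random landmarks are good with high probability (`card_not_good_le`): from
every node of the component the expected number of visits to landmarks is large, by a Chernoff
bound, and a walk hits some landmark with constant probability. For good landmarks and any cut of
the landmarks of the component into `A` and `B`, follow a path from `A` to `B`. Somewhere it has an
edge where visits from `A` give way to visits from `B`; walks through that edge connect the two
sides (`crossing`). So every class is linked to another one with constant probability in each round,
the expected number of classes minus one shrinks by a constant factor (`pexp_round_le`), and
Markov's inequality after all rounds gives the error bound. -/

noncomputable section

/-! ### Executions with a step budget, and what they imply for time, space and output -/

namespace RAM

/-- Working memory of the machine. -/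
abbrev Mem := ℕ →₀ ℕ

/-- `Exec P I Inv out c B μ`: every run of `P` on `I` from `c` is in the memory invariant `Inv` for
at most `B` steps, after which it has arrived at a configuration `out x`, where the random label `x`
of the run has distribution `μ`. -/
inductive Exec (P : Program) (I : Input) (Inv : Mem → Prop) {γ : Type} (out : γ → Config) :
    Config → ℕ → PMF γ → Prop
  | done (x : γ) (B : ℕ) (h : Inv (out x).mem) : Exec P I Inv out (out x) B (PMF.pure x)
  | next (c : Config) (B : ℕ) (ν : Config → PMF γ) (h : Inv c.mem) (hrun : output P c = none)
      (hν : ∀ c' ∈ (step P I c).support, Exec P I Inv out c' B (ν c')) :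
      Exec P I Inv out c (B + 1) ((step P I c).bind ν)

variable {P : Program} {I : Input} {Inv : Mem → Prop} {γ γ' : Type} {out : γ → Config}
  {out' : γ' → Config}

theorem _root_.PMF.bind_congr_support {α β : Type*} (p : PMF α) {f g : α → PMF β}
    (h : ∀ a ∈ p.support, f a = g a) : p.bind f = p.bind g := by
  ext b
  simp only [PMF.bind_apply]
  refine tsum_congr fun a => ?_
  by_cases ha : a ∈ p.support
  · rw [h a ha]
  · rw [PMF.mem_support_iff, not_not] at ha
    simp [ha]

theorem Exec.mono {c : Config} {B B' : ℕ} {μ : PMF γ} (h : Exec P I Inv out c B μ) (hB : B ≤ B') :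
    Exec P I Inv out c B' μ := by
  induction h generalizing B' with
  | done x B h => exact .done x B' h
  | next c B ν h hrun hν ih =>
    obtain ⟨B'', rfl⟩ := Nat.exists_eq_add_of_le' (Nat.le_of_add_left_le hB)
    exact .next c B'' ν h hrun fun c' hc' => ih c' hc' (by omega)

theorem Exec.inv {c : Config} {B : ℕ} {μ : PMF γ} (h : Exec P I Inv out c B μ) : Inv c.mem := by
  cases h <;> assumption

theorem Exec.bind {c : Config} {B B' : ℕ} {μ : PMF γ} {ν : γ → PMF γ'}
    (h : Exec P I Inv out c B μ) (h' : ∀ x ∈ μ.support, Exec P I Inv out' (out x) B' (ν x)) :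
    Exec P I Inv out' c (B + B') (μ.bind ν) := by
  induction h with
  | done x B h =>
    rw [PMF.pure_bind]
    exact (h' x (by simp)).mono (by omega)
  | next c B ν' h hrun hν ih =>
    rw [PMF.bind_bind, Nat.add_right_comm]
    refine .next c _ _ h hrun fun c' hc' => ih c' hc' fun c'' hc'' => h' c'' ?_
    exact (PMF.mem_support_bind_iff _ _ _).2 ⟨c', hc', hc''⟩

theorem step_of_halted {c : Config} (h : output P c ≠ none) : step P I c = PMF.pure c := by
  unfold output at h
  unfold step
  split at h <;> simp_all

theorem iterate_of_halted {c : Config} (h : output P c ≠ none) (k : ℕ) :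
    iterate P I k c = PMF.pure c := by
  induction k with
  | zero => rfl
  | succ k ih => rw [iterate, step_of_halted h, PMF.pure_bind, ih]

theorem Exec.iterate_eq {c : Config} {B : ℕ} {μ : PMF γ} (h : Exec P I Inv out c B μ)
    (hμ : ∀ x ∈ μ.support, output P (out x) ≠ none) {k : ℕ} (hk : B ≤ k) :
    iterate P I k c = μ.map out := by
  induction h generalizing k with
  | done x B h =>
    rw [PMF.pure_map]
    exact iterate_of_halted (hμ x (by simp)) k
  | next c B ν h hrun hν ih =>
    obtain ⟨k', rfl⟩ := Nat.exists_eq_add_of_le' (Nat.le_of_add_left_le hk)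
    rw [iterate, PMF.map_bind]
    refine PMF.bind_congr_support _ fun c' hc' => ih c' hc' (fun c'' hc'' => hμ c'' ?_) (by omega)
    exact (PMF.mem_support_bind_iff _ _ _).2 ⟨c', hc', hc''⟩

/-- A run consumes the derivation of `Exec` one layer per step, so every reached configuration still
carries the rest of it, with the remaining budget `B'`. This turns one derivation into bounds on all
runs. -/
theorem Exec.of_reaches {B c₀ : ℕ} {μ : PMF γ} (h : Exec P I Inv out init B μ)
    (hμ : ∀ x ∈ μ.support, output P (out x) ≠ none) (hc₀ : ∀ c, Inv c.mem → cost P I c ≤ c₀)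
    {c : Config} {T : ℕ} (hr : Reaches P I c T) :
    ∃ (k B' : ℕ) (ν : PMF γ), k + B' ≤ B ∧ T ≤ k * c₀ ∧ Exec P I Inv out c B' ν ∧
      ∀ x ∈ ν.support, output P (out x) ≠ none := by
  induction hr with
  | start => exact ⟨0, B, μ, by simp, by simp, h, hμ⟩
  | @next c c' T hr hrun hstep ih =>
    obtain ⟨k, B', ν, hkB, hT, hex, hν⟩ := ih
    cases hex with
    | done x _ h => exact absurd hrun (hν x (by simp))
    | next _ B'' ν' hinv _ hν' =>
      refine ⟨k + 1, B'', ν' c', by omega, ?_, hν' c' hstep, fun c'' hc'' => hν c'' ?_⟩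
      · have := hc₀ c hinv
        nlinarith
      · exact (PMF.mem_support_bind_iff _ _ _).2 ⟨c', hstep, hc''⟩

theorem Exec.timeAtMost {B c₀ : ℕ} {μ : PMF γ} (h : Exec P I Inv out init B μ)
    (hμ : ∀ x ∈ μ.support, output P (out x) ≠ none) (hc₀ : ∀ c, Inv c.mem → cost P I c ≤ c₀) :
    TimeAtMost P I (B * c₀ : ℕ) := by
  intro c T hr
  obtain ⟨k, B', ν, hkB, hT, -⟩ := h.of_reaches hμ hc₀ hr
  exact_mod_cast hT.trans (Nat.mul_le_mul_right _ (by omega))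

theorem Exec.spaceAtMost {B c₀ s₀ : ℕ} {μ : PMF γ} (h : Exec P I Inv out init B μ)
    (hμ : ∀ x ∈ μ.support, output P (out x) ≠ none) (hc₀ : ∀ c, Inv c.mem → cost P I c ≤ c₀)
    (hs₀ : ∀ c : Config, Inv c.mem → c.space ≤ s₀) : SpaceAtMost P I s₀ := by
  intro c T hr
  obtain ⟨k, B', ν, -, -, hex, -⟩ := h.of_reaches hμ hc₀ hr
  exact_mod_cast hs₀ c hex.inv

theorem Exec.outputProb_eq {B : ℕ} {μ : PMF γ} (h : Exec P I Inv out init B μ)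
    (hμ : ∀ x ∈ μ.support, output P (out x) ≠ none) (b : Bool) :
    outputProb P I b = ((μ.map out).map (output P)) (some b) := by
  refine le_antisymm (iSup_le fun k => ?_) ?_
  · rw [← h.iterate_eq hμ (le_max_right k B)]
    obtain ⟨j, hj⟩ := Nat.exists_eq_add_of_le (le_max_left k B)
    rw [hj]
    -- Halted configurations stay, so the probability of an answer can only grow with the number of
    -- steps. Hence the supremum is attained at the budget `B`.
    have key : ∀ (k : ℕ) (c : Config), ((iterate P I k c).map (output P)) (some b) ≤
        ((iterate P I (k + j) c).map (output P)) (some b) := by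
      intro k
      induction k with
      | zero =>
        intro c
        by_cases hc : output P c = some b
        · rw [iterate_of_halted (by simp [hc]), iterate_of_halted (by simp [hc])]
        · rw [iterate, PMF.pure_map, PMF.pure_apply_of_ne _ _ (Ne.symm hc)]
          exact zero_le
      | succ k ih =>
        intro c
        rw [Nat.add_right_comm, iterate, iterate, PMF.map_bind, PMF.map_bind, PMF.bind_apply,
          PMF.bind_apply]
        exact ENNReal.tsum_le_tsum fun c' => mul_le_mul_right (ih c') _
    exact key k init
  · rw [← h.iterate_eq hμ le_rfl]
    exact le_iSup (fun k => ((iterate P I k init).map (output P)) (some b)) B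

/-! ### A structured language that compiles to the machine -/

/-- Structured commands: straight-line code, a random draw, sequencing, `while M[a] < M[b]` and
`if M[a] < M[b]`. -/
inductive Cmd where
  | ops (l : List Instr)
  | rnd (d a : ℕ)
  | seq (c e : Cmd)
  | loop (a b : ℕ) (c : Cmd)
  | ite (a b : ℕ) (c : Cmd)

namespace Cmd

infixr:65 " ;; " => Cmd.seq

def size : Cmd → ℕ
  | ops l => l.length
  | rnd _ _ => 1
  | seq c e => c.size + e.size
  | loop _ _ c => c.size + 3
  | ite _ _ c => c.size + 2

/-- The code of a command that starts at address `o`. -/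
def compile : Cmd → ℕ → List Instr
  | ops l, _ => l
  | rnd d a, _ => [.rand d a]
  | seq c e, o => c.compile o ++ e.compile (o + c.size)
  | loop a b c, o =>
    .jumpLt a b (o + 2) :: .jump (o + 3 + c.size) :: (c.compile (o + 2) ++ [.jump o])
  | ite a b c, o => .jumpLt a b (o + 2) :: .jump (o + 2 + c.size) :: c.compile (o + 2)

@[simp] theorem length_compile (c : Cmd) (o : ℕ) : (c.compile o).length = c.size := by
  induction c generalizing o <;> simp_all [compile, size]

end Cmd

/-- The code `l` stands at address `o` of `P`. -/
def CodeAt (P : Program) (o : ℕ) (l : List Instr) : Prop := ∃ r, P.drop o = l ++ r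

theorem CodeAt.append_left {o : ℕ} {l l' : List Instr} (h : CodeAt P o (l ++ l')) :
    CodeAt P o l := by
  obtain ⟨r, h⟩ := h
  exact ⟨l' ++ r, by simp [h]⟩

theorem CodeAt.append_right {o o' : ℕ} {l l' : List Instr} (h : CodeAt P o (l ++ l'))
    (ho : o' = o + l.length) : CodeAt P o' l' := by
  obtain ⟨r, h⟩ := h
  refine ⟨r, ?_⟩
  rw [ho, ← List.drop_drop, h, List.append_assoc, List.drop_left]

theorem CodeAt.tail {o : ℕ} {i : Instr} {l : List Instr} (h : CodeAt P o (i :: l)) :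
    CodeAt P (o + 1) l :=
  CodeAt.append_right (l := [i]) h rfl

theorem CodeAt.fetch {o : ℕ} {i : Instr} {l : List Instr} (h : CodeAt P o (i :: l)) (σ : Mem) :
    fetch P ⟨o, σ⟩ = i := by
  obtain ⟨r, h⟩ := h
  have : (P.drop o)[0]? = some i := by rw [h]; rfl
  rw [List.getElem?_drop] at this
  simp only [add_zero] at this
  simp [RAM.fetch, List.getD_eq_getElem?_getD, this]

/-- Destination and value of a deterministic instruction that writes to memory. -/
def Instr.eff (I : Input) (M : Mem) : Instr → Option (ℕ × ℕ)
  | .const d x => some (d, x)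
  | .copy d a => some (d, M a)
  | .add d a b => some (d, M a + M b)
  | .sub d a b => some (d, M a - M b)
  | .mul d a b => some (d, M a * M b)
  | .div d a b => some (d, M a / M b)
  | .load d a => some (d, M (M a))
  | .store a b => some (M a, M b)
  | .getSize d => some (d, I.size)
  | .getSource d => some (d, I.source)
  | .getTarget d => some (d, I.target)
  | .getParam d => some (d, I.param)
  | .getDeg d a => some (d, I.deg (M a))
  | .getNbr d a b => some (d, I.nbr (M a) (M b))
  | .getPort d a b => some (d, I.port (M a) (M b))
  | _ => none

theorem exec_pure {c : Config} {x : γ} (h : Inv c.mem) (ho : output P c = none)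
    (hs : step P I c = PMF.pure (out x)) (h' : Inv (out x).mem) :
    Exec P I Inv out c 1 (PMF.pure x) := by
  rw [← PMF.bind_const (PMF.pure (out x)) (PMF.pure x), ← hs]
  refine .next _ 0 _ h ho fun c' hc' => ?_
  rw [hs, PMF.mem_support_pure_iff] at hc'
  rw [hc']
  exact .done x 0 h'

theorem exec_eff {o d v : ℕ} {i : Instr} {σ : Mem} {x : γ} (hf : fetch P ⟨o, σ⟩ = i)
    (hi : i.eff I σ = some (d, v)) (h : Inv σ) (h' : Inv (σ.update d v))
    (hx : out x = ⟨o + 1, σ.update d v⟩) :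
    Exec P I Inv out ⟨o, σ⟩ 1 (PMF.pure x) := by
  refine exec_pure h ?_ ?_ (by rw [hx]; exact h')
  · unfold output
    rw [hf]
    cases i <;> simp_all [Instr.eff]
  · unfold step
    rw [hf]
    cases i <;> simp_all [Instr.eff, Config.write]

theorem exec_jump {o l : ℕ} {σ : Mem} {x : γ} (hf : fetch P ⟨o, σ⟩ = .jump l) (h : Inv σ)
    (hx : out x = ⟨l, σ⟩) : Exec P I Inv out ⟨o, σ⟩ 1 (PMF.pure x) :=
  exec_pure h (by simp [output, hf]) (by simp [step, hf, hx]) (by rw [hx]; exact h)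

theorem exec_jumpLt {o a b l : ℕ} {σ : Mem} {x : γ} (hf : fetch P ⟨o, σ⟩ = .jumpLt a b l)
    (h : Inv σ) (hx : out x = ⟨if σ a < σ b then l else o + 1, σ⟩) :
    Exec P I Inv out ⟨o, σ⟩ 1 (PMF.pure x) :=
  exec_pure h (by simp [output, hf]) (by simp [step, hf, hx]) (by rw [hx]; exact h)

/-- `Tri I Inv c σ B D R`: started in the memory `σ`, the command `c` terminates within `B` steps
through memories in `Inv`; the final memory is coupled by the relation `R` with a random variable
of distribution `D`. -/
def Tri {α : Type} (I : Input) (Inv : Mem → Prop) (c : Cmd) (σ : Mem) (B : ℕ) (D : PMF α)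
    (R : α → Mem → Prop) : Prop :=
  ∀ (P : Program) (o : ℕ), CodeAt P o (c.compile o) → ∃ κ : PMF (α × Mem),
    κ.map Prod.fst = D ∧ (∀ x ∈ κ.support, R x.1 x.2) ∧
      Exec P I Inv (fun x : α × Mem => ⟨o + c.size, x.2⟩) ⟨o, σ⟩ B κ

variable {α β : Type} {c e : Cmd} {σ : Mem} {B B' : ℕ} {D : PMF α} {R R' : α → Mem → Prop}

theorem Exec.inv_out {c : Config} {B : ℕ} {μ : PMF γ} (h : Exec P I Inv out c B μ) :
    ∀ x ∈ μ.support, Inv (out x).mem := by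
  induction h with
  | done x B h => simpa using h
  | next c B ν h hrun hν ih =>
    intro x hx
    obtain ⟨c', hc', hx⟩ := (PMF.mem_support_bind_iff _ _ _).1 hx
    exact ih c' hc' x hx

theorem Exec.relabel {c : Config} {B : ℕ} {μ : PMF γ} (h : Exec P I Inv out c B μ) (f : γ → γ')
    (hf : ∀ x ∈ μ.support, out' (f x) = out x) : Exec P I Inv out' c B (μ.map f) := by
  have := h.bind (B' := 0) (out' := out') (ν := fun x => PMF.pure (f x)) (fun x hx => by
    rw [← hf x hx]
    refine .done _ _ ?_
    rw [hf x hx]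
    exact h.inv_out x hx)
  exact this

theorem Tri.mono (h : Tri I Inv c σ B D R) (hB : B ≤ B')
    (hR : ∀ a ∈ D.support, ∀ σ', R a σ' → Inv σ' → R' a σ') : Tri I Inv c σ B' D R' := by
  intro P o hc
  obtain ⟨κ, h1, h2, h3⟩ := h P o hc
  refine ⟨κ, h1, fun x hx => hR _ ?_ _ (h2 x hx) (h3.inv_out x hx), h3.mono hB⟩
  rw [← h1]
  exact (PMF.mem_support_map_iff _ _ _).2 ⟨x, hx, rfl⟩

theorem Tri.map (f : α → β) {R' : β → Mem → Prop} (h : Tri I Inv c σ B D R)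
    (hR : ∀ a ∈ D.support, ∀ σ', R a σ' → R' (f a) σ') : Tri I Inv c σ B (D.map f) R' := by
  intro P o hc
  obtain ⟨κ, h1, h2, h3⟩ := h P o hc
  refine ⟨κ.map fun x => (f x.1, x.2), ?_, ?_, h3.relabel _ fun _ _ => rfl⟩
  · rw [PMF.map_comp, ← h1, PMF.map_comp]; rfl
  · intro y hy
    obtain ⟨x, hx, rfl⟩ := (PMF.mem_support_map_iff _ _ _).1 hy
    refine hR _ ?_ _ (h2 x hx)
    rw [← h1]
    exact (PMF.mem_support_map_iff _ _ _).2 ⟨x, hx, rfl⟩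

/-- Continue a coupled execution. -/
theorem Exec.bind_coupling {c₀ : Config} {κ : PMF (α × Mem)} {E : α → PMF β}
    {R' : β → Mem → Prop} {o q : ℕ}
    (h : Exec P I Inv (fun x : α × Mem => ⟨o, x.2⟩) c₀ B κ)
    (h' : ∀ x ∈ κ.support, ∃ κ' : PMF (β × Mem), κ'.map Prod.fst = E x.1 ∧
      (∀ y ∈ κ'.support, R' y.1 y.2) ∧
      Exec P I Inv (fun y : β × Mem => ⟨q, y.2⟩) ⟨o, x.2⟩ B' κ') :
    ∃ κ' : PMF (β × Mem), κ'.map Prod.fst = (κ.map Prod.fst).bind E ∧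
      (∀ y ∈ κ'.support, R' y.1 y.2) ∧
      Exec P I Inv (fun y : β × Mem => ⟨q, y.2⟩) c₀ (B + B') κ' := by
  classical
  have : ∀ x : α × Mem, ∃ κ' : PMF (β × Mem), x ∈ κ.support → κ'.map Prod.fst = E x.1 ∧
      (∀ y ∈ κ'.support, R' y.1 y.2) ∧
      Exec P I Inv (fun y : β × Mem => ⟨q, y.2⟩) ⟨o, x.2⟩ B' κ' := by
    intro x
    by_cases hx : x ∈ κ.support
    · obtain ⟨κ', hκ'⟩ := h' x hx
      exact ⟨κ', fun _ => hκ'⟩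
    -- Off the support any kernel will do; it is borrowed from a point of the support.
    · obtain ⟨x₀, hx₀⟩ := κ.support_nonempty
      obtain ⟨κ', -⟩ := h' x₀ hx₀
      exact ⟨κ', fun hx' => absurd hx' hx⟩
  choose F hF using this
  refine ⟨κ.bind F, ?_, ?_, h.bind fun x hx => (hF x hx).2.2⟩
  · rw [PMF.map_bind, PMF.bind_map]
    exact PMF.bind_congr_support _ fun x hx => (hF x hx).1
  · intro y hy
    obtain ⟨x, hx, hy⟩ := (PMF.mem_support_bind_iff _ _ _).1 hy
    exact (hF x hx).2.1 y hy

theorem Tri.seq {E : α → PMF β} {R' : β → Mem → Prop} (h : Tri I Inv c σ B D R)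
    (h' : ∀ a ∈ D.support, ∀ σ', R a σ' → Tri I Inv e σ' B' (E a) R') :
    Tri I Inv (c ;; e) σ (B + B') (D.bind E) R' := by
  intro P o hc
  obtain ⟨κ, h1, h2, h3⟩ := h P o hc.append_left
  rw [← h1, Cmd.size, ← add_assoc]
  refine h3.bind_coupling fun x hx => h' _ ?_ _ (h2 x hx) P _ (hc.append_right (by simp))
  rw [← h1]
  exact (PMF.mem_support_map_iff _ _ _).2 ⟨x, hx, rfl⟩

theorem Tri.seq_pure {a : α} {E : PMF β} {R' : β → Mem → Prop}
    (h : Tri I Inv c σ B (PMF.pure a) R)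
    (h' : ∀ σ', R a σ' → Tri I Inv e σ' B' E R') :
    Tri I Inv (c ;; e) σ (B + B') E R' := by
  have := h.seq (E := fun _ => E) (B' := B') (e := e) (R' := R') fun a' ha' σ' hσ' => by
    rw [PMF.mem_support_pure_iff] at ha'
    subst ha'
    exact h' σ' hσ'
  rwa [PMF.pure_bind] at this

theorem Tri.bind_pure {a : α} {f : α → β} {R' : β → Mem → Prop}
    (h : Tri I Inv c σ B (PMF.pure a) R) (hR : ∀ σ', R a σ' → R' (f a) σ') :
    Tri I Inv c σ B (PMF.pure (f a)) R' := by
  have := h.map f (R' := R') (fun a' ha' σ' hσ' => by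
    rw [PMF.mem_support_pure_iff] at ha'
    subst ha'
    exact hR σ' hσ')
  rwa [PMF.pure_map] at this

/-- Weakest precondition of straight-line code, including the invariant. -/
def wp (I : Input) (Inv : Mem → Prop) : List Instr → Mem → (Mem → Prop) → Prop
  | [], σ, Q => Q σ
  | i :: l, σ, Q => ∃ d v, i.eff I σ = some (d, v) ∧ Inv (σ.update d v) ∧
      wp I Inv l (σ.update d v) Q

theorem Tri.ops {l : List Instr} {a : α} (h : Inv σ) (hw : wp I Inv l σ (R a)) :
    Tri I Inv (.ops l) σ l.length (PMF.pure a) R := by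
  intro P o hc
  simp only [Cmd.compile, Cmd.size] at hc ⊢
  suffices H : ∃ τ, R a τ ∧ Exec P I Inv (fun x : α × Mem => ⟨o + l.length, x.2⟩) ⟨o, σ⟩ l.length
      (PMF.pure (a, τ)) by
    obtain ⟨τ, hτ, hex⟩ := H
    refine ⟨PMF.pure (a, τ), by rw [PMF.pure_map], ?_, hex⟩
    rintro x hx
    rw [PMF.mem_support_pure_iff] at hx
    rwa [hx]
  induction l generalizing o σ with
  | nil => exact ⟨σ, hw, .done (a, σ) 0 h⟩
  | cons i l ih =>
    obtain ⟨d, v, hi, hinv, hw⟩ := hw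
    obtain ⟨τ, hτ, hex⟩ := ih hinv hw (o + 1) hc.tail
    refine ⟨τ, hτ, ?_⟩
    have h1 : Exec P I Inv (fun x : Unit => ⟨o + 1, σ.update d v⟩) ⟨o, σ⟩ 1 (PMF.pure ()) :=
      exec_eff (hc.fetch σ) hi h hinv rfl
    have h2 := h1.bind (ν := fun _ => PMF.pure (a, τ)) fun _ _ => hex
    rw [PMF.pure_bind] at h2
    rw [List.length_cons]
    convert h2 using 1
    · funext x; congr 1; omega
    · omega

theorem Tri.rnd {d a : ℕ} (h : Inv σ) (h' : ∀ x : ℕ, x ≤ σ a → Inv (σ.update d x)) :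
    Tri I Inv (.rnd d a) σ 1 (PMF.uniformOfFintype (Fin (σ a + 1)))
      (fun (x : Fin (σ a + 1)) σ' => σ' = σ.update d (x : ℕ)) := by
  intro P o hc
  have hf := hc.fetch σ
  refine ⟨(PMF.uniformOfFintype (Fin (σ a + 1))).map fun x : Fin (σ a + 1) => (x, σ.update d (x : ℕ)),
    ?_, ?_, ?_⟩
  · rw [PMF.map_comp]; exact PMF.map_id _
  · intro y hy
    obtain ⟨x, -, rfl⟩ := (PMF.mem_support_map_iff _ _ _).1 hy
    rfl
  · have hs : step P I ⟨o, σ⟩ =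
        (PMF.uniformOfFintype (Fin (σ a + 1))).map
          fun x : Fin (σ a + 1) => (⟨o + 1, σ.update d x⟩ : Config) := by
      have : step P I ⟨o, σ⟩ = (PMF.bind (PMF.uniformOfFintype (Fin (σ a + 1)))
          fun x => PMF.pure (x : ℕ)).map fun x => (⟨o + 1, σ.update d x⟩ : Config) := by
        simp only [step, hf, Config.write]
        rfl
      rw [this, PMF.map_bind]
      simp only [PMF.pure_map]
      rfl
    have ho : output P ⟨o, σ⟩ = none := by simp [output, hf]
    -- `Exec.next` wants the continuation as a function of the next configuration, so the drawn
    -- number is read back from cell `d`. The `min` only supplies the bound that `Fin` needs.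
    have he : (PMF.uniformOfFintype (Fin (σ a + 1))).map
        (fun x : Fin (σ a + 1) => ((x, σ.update d x) : Fin (σ a + 1) × Mem)) = (step P I ⟨o, σ⟩).bind
          fun c' => PMF.pure ((⟨min (c'.mem d) (σ a), by omega⟩ : Fin (σ a + 1)), c'.mem) := by
      rw [hs, PMF.bind_map, PMF.map]
      congr 1
      funext x
      have : (x : ℕ) ≤ σ a := by omega
      simp [Finsupp.update_apply, this]
    rw [he]
    refine .next _ 0 _ h ho fun c' hc' => ?_
    rw [hs] at hc'
    obtain ⟨x, -, rfl⟩ := (PMF.mem_support_map_iff _ _ _).1 hc'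
    exact .done (_, σ.update d x) 0 (h' x (by omega))

theorem Tri.ite_pos {a b : ℕ} (hlt : σ a < σ b) (hinv : Inv σ) (h : Tri I Inv c σ B D R) :
    Tri I Inv (.ite a b c) σ (B + 1) D R := by
  intro P o hc
  obtain ⟨κ, h1, h2, h3⟩ := h P (o + 2) hc.tail.tail
  refine ⟨κ, h1, h2, ?_⟩
  have h0 : Exec P I Inv (fun _ : Unit => ⟨o + 2, σ⟩) ⟨o, σ⟩ 1 (PMF.pure ()) :=
    exec_jumpLt (hc.fetch σ) hinv (by simp [hlt])
  have h2 := h0.bind (ν := fun _ => κ) fun _ _ => h3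
  rw [PMF.pure_bind] at h2
  convert h2 using 1
  · funext x; simp only [Cmd.size]; congr 1; omega
  · omega

theorem Tri.ite_neg {a b : ℕ} {y : α} (hlt : ¬ σ a < σ b) (hinv : Inv σ) (h : R y σ) :
    Tri I Inv (.ite a b c) σ 2 (PMF.pure y) R := by
  intro P o hc
  refine ⟨PMF.pure (y, σ), by rw [PMF.pure_map], ?_, ?_⟩
  · rintro x hx
    rw [PMF.mem_support_pure_iff] at hx
    rwa [hx]
  have h0 : Exec P I Inv (fun _ : Unit => ⟨o + 1, σ⟩) ⟨o, σ⟩ 1 (PMF.pure ()) :=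
    exec_jumpLt (hc.fetch σ) hinv (by simp [hlt])
  have h1 : Exec P I Inv (fun x : α × Mem => ⟨o + (Cmd.ite a b c).size, x.2⟩) ⟨o + 1, σ⟩ 1
      (PMF.pure (y, σ)) :=
    exec_jump (hc.tail.fetch σ) hinv (by simp only [Cmd.size]; congr 1; omega)
  have h2 := h0.bind (ν := fun _ => PMF.pure (y, σ)) fun _ _ => h1
  rwa [PMF.pure_bind] at h2

/-- The distribution after `k` rounds of a loop, the first of which is round `i`. -/
def loopDist (E : ℕ → α → PMF α) : ℕ → ℕ → α → PMF α
  | 0, _, x => PMF.pure x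
  | k + 1, i, x => (E i x).bind (loopDist E k (i + 1))

/-- The relation carries the round number, so that it both decides the guard and is the invariant. A
round costs `B` plus the guard and the jump back; leaving costs the guard and the exit jump. -/
theorem Tri.loop {a b : ℕ} {N : ℕ} {E : ℕ → α → PMF α} {R : ℕ → α → Mem → Prop}
    (hinv : ∀ i x σ, R i x σ → Inv σ)
    (hguard : ∀ i x σ, i ≤ N → R i x σ → (σ a < σ b ↔ i < N))
    (hbody : ∀ i x σ, i < N → R i x σ → Tri I Inv c σ B (E i x) (R (i + 1)))
    (k : ℕ) {i : ℕ} {x : α} (hk : i + k = N) (hx : R i x σ) :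
    Tri I Inv (.loop a b c) σ (k * (B + 2) + 2) (loopDist E k i x) (R N) := by
  intro P o hc
  have hcond := hc.fetch
  have hexit := hc.tail.fetch
  have hbod : CodeAt P (o + 2) (c.compile (o + 2)) := hc.tail.tail.append_left
  have hback := (CodeAt.append_right hc.tail.tail rfl).fetch
  rw [Cmd.length_compile] at hback
  simp only [Cmd.size]
  induction k generalizing i x σ with
  | zero =>
    obtain rfl : i = N := by omega
    have hI := hinv _ _ _ hx
    have hng : ¬ σ a < σ b := by rw [hguard _ _ _ le_rfl hx]; omega
    refine ⟨PMF.pure (x, σ), by rw [PMF.pure_map]; rfl, ?_, ?_⟩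
    · rintro y hy
      rw [PMF.mem_support_pure_iff] at hy
      rwa [hy]
    have h0 : Exec P I Inv (fun _ : Unit => ⟨o + 1, σ⟩) ⟨o, σ⟩ 1 (PMF.pure ()) :=
      exec_jumpLt (hcond σ) hI (by simp [hng])
    have h1 : Exec P I Inv (fun x : α × Mem => ⟨o + (c.size + 3), x.2⟩) ⟨o + 1, σ⟩ 1
        (PMF.pure (x, σ)) :=
      exec_jump (hexit σ) hI (by simp only; congr 1; omega)
    have h2 := h0.bind (ν := fun _ => PMF.pure (x, σ)) fun _ _ => h1
    rw [PMF.pure_bind] at h2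
    exact h2.mono (by omega)
  | succ k ih =>
    have hI := hinv _ _ _ hx
    have hg : σ a < σ b := by rw [hguard _ _ _ (by omega) hx]; omega
    obtain ⟨κ, h1, h2, h3⟩ := hbody i x σ (by omega) hx P (o + 2) hbod
    have h0 : Exec P I Inv (fun _ : Unit => ⟨o + 2, σ⟩) ⟨o, σ⟩ 1 (PMF.pure ()) :=
      exec_jumpLt (hcond σ) hI (by simp [hg])
    have h4 := h0.bind (ν := fun _ => κ) fun _ _ => h3
    rw [PMF.pure_bind] at h4
    have h5 := h4.bind (B' := 1) (ν := fun y => PMF.pure y)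
      (out' := fun y : α × Mem => ⟨o, y.2⟩) fun y hy =>
        exec_jump (hback _) (h3.inv_out y hy) rfl
    rw [PMF.bind_pure] at h5
    obtain ⟨κ', g1, g2, g3⟩ := h5.bind_coupling (E := loopDist E k (i + 1)) (R' := R N)
      fun y hy => ih (by omega) (h2 y hy)
    refine ⟨κ', ?_, g2, g3.mono ?_⟩
    · rw [g1, h1]; rfl
    · ring_nf; omega

end RAM

namespace RAM

/-! ### The program -/

/-- Follow the parent pointer in cell `a` as often as cell `6` says. -/
def findCmd (a : ℕ) : Cmd := .ops [.const 25 0] ;; .loop 25 6 (.ops [.load a a, .add 25 25 1])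

/-- Merge the classes of the roots at the addresses in cells `23` and `24`. -/
def linkCmd : Cmd :=
  -- Subtraction truncates, so the two differences add up to the distance of the addresses, which is
  -- positive exactly when the roots differ. Cell `0` always contains `0`.
  .ops [.sub 26 23 24, .sub 27 24 23, .add 26 26 27] ;;
  .ite 0 26 (
    .ops [.add 27 23 1, .load 27 27, .add 28 24 1, .load 28 28] ;;
    -- After the swap, cell `23` holds the root of the smaller class, which is hung below the other
    -- one.
    .ite 28 27 (.ops [.copy 29 23, .copy 23 24, .copy 24 29]) ;;
    .ops [.store 23 24, .add 27 27 28, .add 28 24 1, .store 28 27])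

/-- If the node in cell `17` is a landmark, merge its class with that of the landmark in `16`. -/
def checkCmd : Cmd :=
  .ops [.add 23 17 17, .add 23 23 17, .add 23 23 10, .load 24 23] ;;
  -- Parent pointers are addresses from `32` on, so the content `0` marks a node that is not a
  -- landmark.
  .ite 0 24 (
    .ops [.add 24 16 16, .add 24 24 16, .add 24 24 10] ;;
    findCmd 23 ;; findCmd 24 ;; linkCmd)

/-- One step of the Metropolis–Hastings walk from the node in cell `17`. -/
def walkStepCmd : Cmd :=
  .ops [.getDeg 19 17, .sub 20 19 1] ;; .rnd 20 20 ;;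
  .ops [.getNbr 21 17 20, .getDeg 22 21, .sub 22 22 1] ;; .rnd 22 22 ;;
  -- Metropolis rule: a uniform number below `deg u` is less than `deg v` with probability `min(1,
  -- deg v / deg u)`. At an isolated node the default neighbor `0` is proposed and always rejected,
  -- since no number is less than the degree `0`.
  .ite 22 19 (.ops [.copy 17 21])

/-- One walk from the landmark with the number in cell `14`. -/
def walkCmd : Cmd :=
  .ops [.add 15 14 14, .add 15 15 14, .add 15 15 10, .add 15 15 1, .add 15 15 1, .load 16 15,
    .copy 17 16, .const 18 0] ;;
  .loop 18 7 (walkStepCmd ;; checkCmd ;; .ops [.add 18 18 1]) ;;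
  .ops [.add 14 14 1]

def roundsCmd : Cmd :=
  .ops [.const 13 0] ;;
  .loop 13 9 (.ops [.const 14 0] ;; .loop 14 8 walkCmd ;; .ops [.add 13 13 1])

/-- Make the node in cell `14` the landmark with the number in cell `12`. -/
def insertCmd : Cmd :=
  .ops [.add 15 14 14, .add 15 15 14, .add 15 15 10, .store 15 15, .add 16 15 1, .store 16 1,
    .add 15 12 12, .add 15 15 12, .add 15 15 10, .add 15 15 1, .add 15 15 1, .store 15 14,
    .add 12 12 1]

def landmarksCmd : Cmd :=
  .ops [.const 12 0, .copy 14 3] ;; insertCmd ;; .ops [.copy 14 4] ;; insertCmd ;;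
  .loop 12 8 (.rnd 14 11 ;; insertCmd)

/-- The loops compute `⌈log n⌉` by doubling (cell `6`) and the maximum degree (cell `13`); the
division with `p - 1` added rounds up. -/
def setupCmd : Cmd :=
  .ops [.const 1 1, .getSize 2, .getSource 3, .getTarget 4, .getParam 5, .const 10 32,
    .const 11 1] ;;
  -- Cells `6`, `12` and `13` are used as counters and maximum without initialization, since memory
  -- starts at `0`.
  .loop 11 2 (.ops [.add 11 11 11, .add 6 6 1]) ;;
  .loop 12 2 (.ops [.getDeg 14 12] ;; .ite 13 14 (.ops [.copy 13 14]) ;; .ops [.add 12 12 1]) ;;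
  .ops [.const 15 60, .mul 15 15 2, .mul 15 15 6, .add 15 15 5, .sub 15 15 1, .div 15 15 5] ;;
  .ite 15 13 (.ops [.copy 15 13]) ;;
  .ops [.mul 7 15 15, .const 8 2, .add 8 8 5, .const 9 72, .mul 9 9 6, .sub 11 2 1]

/-- Leaves in cell `26` whether the roots of `s` and `t` differ. -/
def compareCmd : Cmd :=
  .ops [.add 23 3 3, .add 23 23 3, .add 23 23 10, .add 24 4 4, .add 24 24 4, .add 24 24 10] ;;
  findCmd 23 ;; findCmd 24 ;; .ops [.sub 26 23 24, .sub 27 24 23, .add 26 26 27]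

def mainCmd : Cmd := setupCmd ;; landmarksCmd ;; roundsCmd ;; compareCmd

/-- The program for USTCON. -/
def ustconProgram : Program :=
  mainCmd.compile 0 ++ [.jumpLt 0 26 (mainCmd.size + 2), .accept, .reject]

/-! ### The memory invariant -/

/-- Cells contain at most `W`, and all nonzero cells from address `32` on are in a set of at most
`Q` cells with addresses at most `W`. -/
def MemInv (W Q : ℕ) (σ : Mem) : Prop :=
  (∀ a, σ a ≤ W) ∧ ∃ S : Finset ℕ, S.card ≤ Q ∧ (∀ a ∈ S, a ≤ W) ∧ ∀ a, 32 ≤ a → σ a ≠ 0 → a ∈ S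

variable {W Q : ℕ} {σ : Mem}

theorem MemInv.reg (h : MemInv W Q σ) {d x : ℕ} (hd : d < 32) (hx : x ≤ W) :
    MemInv W Q (σ.update d x) := by
  obtain ⟨h1, S, h2, h3, h4⟩ := h
  refine ⟨fun a => ?_, S, h2, h3, fun a ha => ?_⟩
  · rw [Finsupp.update_apply]; split_ifs <;> simp_all
  · rw [Finsupp.update_apply, if_neg (by omega)]; exact h4 a ha

/-- The cell is already counted, so `Q` stays. Linking two classes only rewrites parent pointers and
sizes of landmarks, which are nonzero. -/
theorem MemInv.overwrite (h : MemInv W Q σ) {d x : ℕ} (hd : σ d ≠ 0) (hx : x ≤ W) :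
    MemInv W Q (σ.update d x) := by
  obtain ⟨h1, S, h2, h3, h4⟩ := h
  refine ⟨fun a => ?_, S, h2, h3, fun a ha => ?_⟩
  · rw [Finsupp.update_apply]; split_ifs <;> simp_all
  · rw [Finsupp.update_apply]
    split_ifs with hda
    · intro _; rw [hda] at ha ⊢; exact h4 d ha hd
    · exact h4 a ha

theorem bits_mono {a b : ℕ} (h : a ≤ b) : bits a ≤ bits b :=
  Nat.add_le_add_right (Nat.log_mono_right h) 1

/-- What matters is the number of nonzero cells, not how far apart they lie; large addresses cost
only their bit length. -/
theorem MemInv.space_le {c : Config} (h : MemInv W Q c.mem) (hW : 32 ≤ W) :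
    c.space ≤ (32 + Q) * (2 * bits W) := by
  obtain ⟨h1, S, h2, h3, h4⟩ := h
  have hsub : c.mem.support ⊆ Finset.range 32 ∪ S := by
    intro a ha
    rw [Finsupp.mem_support_iff] at ha
    rw [Finset.mem_union, Finset.mem_range]
    by_cases h : a < 32
    · exact .inl h
    · exact .inr (h4 a (by omega) ha)
  have hcard : c.mem.support.card ≤ 32 + Q := by
    refine (Finset.card_le_card hsub).trans ((Finset.card_union_le _ _).trans ?_)
    rw [Finset.card_range]; omega
  unfold Config.space
  refine (Finset.sum_le_card_nsmul _ _ (2 * bits W) fun a ha => ?_).trans ?_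
  · have h5 : a ≤ W := by
      have := hsub ha
      rw [Finset.mem_union, Finset.mem_range] at this
      rcases this with h | h
      · omega
      · exact h3 a h
    have := bits_mono h5
    have := bits_mono (h1 a)
    omega
  · rw [smul_eq_mul]
    exact Nat.mul_le_mul_right _ hcard

/-- All constants in an instruction are at most `W`. -/
def Instr.Small (W : ℕ) : Instr → Prop
  | .const d c => d ≤ W ∧ c ≤ W
  | .copy d a | .load d a | .store d a | .getDeg d a | .rand d a => d ≤ W ∧ a ≤ W
  | .add d a b | .sub d a b | .mul d a b | .div d a b | .getNbr d a b | .getPort d a b =>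
    d ≤ W ∧ a ≤ W ∧ b ≤ W
  | .jump _ | .accept | .reject => True
  | .jumpLt a b _ => a ≤ W ∧ b ≤ W
  | .getSize d | .getSource d | .getTarget d | .getParam d => d ≤ W

/-- All numbers that the input provides are at most `W`. -/
structure Input.Bounded (I : Input) (W : ℕ) : Prop where
  size : I.size ≤ W
  source : I.source ≤ W
  target : I.target ≤ W
  param : I.param ≤ W
  deg : ∀ v, I.deg v ≤ W
  nbr : ∀ v i, I.nbr v i ≤ W
  port : ∀ v u, I.port v u ≤ W

/-- The worst case is a port query: three addresses, two contents and one value from the input. -/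
theorem cost_le {P : Program} {I : Input} (hP : ∀ i ∈ P, i.Small W) (hI : I.Bounded W)
    {c : Config} (h : MemInv W Q c.mem) : cost P I c ≤ 1 + 6 * bits W := by
  have hb : ∀ {a}, a ≤ W → bits a ≤ bits W := bits_mono
  have hm : ∀ a, bits (c.mem a) ≤ bits W := fun a => hb (h.1 a)
  have hsmall : (fetch P c).Small W := by
    unfold fetch
    rw [List.getD_eq_getElem?_getD]
    cases h : P[c.pc]? with
    | none => simp [Instr.Small]
    | some i => exact hP i (List.mem_of_getElem? h)
  have h1 : 1 ≤ bits W := Nat.le_add_left 1 _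
  unfold cost
  simp only
  generalize fetch P c = i at hsmall
  cases i with
  | const d x => have := hb hsmall.1; have := hb hsmall.2; simp only; omega
  | copy d a => have := hb hsmall.1; have := hb hsmall.2; have := hm a; simp only; omega
  | add d a b | sub d a b | mul d a b | div d a b =>
    have := hb hsmall.1; have := hb hsmall.2.1; have := hb hsmall.2.2
    have := hm a; have := hm b; simp only; omega
  | load d a =>
    have := hb hsmall.1; have := hb hsmall.2; have := hm a; have := hm (c.mem a); simp only; omega
  | store a b =>
    have := hb hsmall.1; have := hb hsmall.2; have := hm a; have := hm b; simp only; omega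
  | jump l => simp only; omega
  | jumpLt a b l =>
    have := hb hsmall.1; have := hb hsmall.2; have := hm a; have := hm b; simp only; omega
  | getSize d => have := hb hsmall; have := hb hI.size; simp only; omega
  | getSource d => have := hb hsmall; have := hb hI.source; simp only; omega
  | getTarget d => have := hb hsmall; have := hb hI.target; simp only; omega
  | getParam d => have := hb hsmall; have := hb hI.param; simp only; omega
  | getDeg d a =>
    have := hb hsmall.1; have := hb hsmall.2; have := hm a; have := hb (hI.deg (c.mem a))
    simp only; omega
  | getNbr d a b =>
    have := hb hsmall.1; have := hb hsmall.2.1; have := hb hsmall.2.2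
    have := hm a; have := hm b; have := hb (hI.nbr (c.mem a) (c.mem b)); simp only; omega
  | getPort d a b =>
    have := hb hsmall.1; have := hb hsmall.2.1; have := hb hsmall.2.2
    have := hm a; have := hm b; have := hb (hI.port (c.mem a) (c.mem b)); simp only; omega
  | rand d a => have := hb hsmall.1; have := hb hsmall.2; have := hm a; simp only; omega
  | accept => simp only; omega
  | reject => simp only; omega

/-- All constants in a command are at most `W`. -/
def Cmd.Small (W : ℕ) : Cmd → Prop
  | .ops l => ∀ i ∈ l, i.Small W
  | .rnd d a => d ≤ W ∧ a ≤ W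
  | .seq c e => c.Small W ∧ e.Small W
  | .loop a b c | .ite a b c => a ≤ W ∧ b ≤ W ∧ c.Small W

theorem Cmd.Small.compile {c : Cmd} (h : c.Small W) (o : ℕ) : ∀ i ∈ c.compile o, i.Small W := by
  induction c generalizing o with
  | ops l => exact h
  | rnd d a => simpa [Cmd.compile, Cmd.Small, Instr.Small] using h
  | seq c e hc he =>
    intro i hi
    rcases List.mem_append.1 hi with hi | hi
    · exact hc h.1 _ i hi
    · exact he h.2 _ i hi
  | loop a b c hc =>
    intro i hi
    simp only [Cmd.compile, List.mem_cons, List.mem_append, List.not_mem_nil, or_false] at hi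
    rcases hi with rfl | rfl | hi | rfl
    · exact ⟨h.1, h.2.1⟩
    · trivial
    · exact hc h.2.2 _ i hi
    · trivial
  | ite a b c hc =>
    intro i hi
    simp only [Cmd.compile, List.mem_cons] at hi
    rcases hi with rfl | rfl | hi
    · exact ⟨h.1, h.2.1⟩
    · trivial
    · exact hc h.2.2 _ i hi

theorem ustconProgram_small (hW : 72 ≤ W) : ∀ i ∈ ustconProgram, i.Small W := by
  have hmain : mainCmd.Small 72 := by
    simp [mainCmd, setupCmd, landmarksCmd, roundsCmd, compareCmd, walkCmd,
      insertCmd, walkStepCmd, checkCmd, linkCmd, findCmd, Cmd.Small, Instr.Small]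
  intro i hi
  have h : i.Small 72 := by
    rcases List.mem_append.1 hi with hi | hi
    · exact hmain.compile 0 i hi
    · simp only [List.mem_cons, List.not_mem_nil, or_false] at hi
      rcases hi with rfl | rfl | rfl <;> simp [Instr.Small]
  cases i <;> simp only [Instr.Small] at h ⊢ <;> omega

/-! ### Union–find -/

/-- Address of the parent pointer of node `v`. -/
def addr (v : ℕ) : ℕ := 32 + 3 * v

theorem loopDist_unit (k i : ℕ) :
    loopDist (fun _ (_ : Unit) => PMF.pure ()) k i () = PMF.pure () := by
  induction k generalizing i with
  | zero => rfl
  | succ k ih => rw [loopDist, PMF.pure_bind, ih]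

variable {n : ℕ} {I : Input}

/-- The pointer is followed exactly `ℓ` times with no test for a root: roots point to themselves, so
overshooting is harmless. The bounds on `a` keep it apart from the constants and from the counter in
cell `25`. -/
theorem tri_findCmd {L : List (Fin n)} {par : Fin n → Fin n} {a ℓ : ℕ} (ha : 12 ≤ a) (ha' : a < 25)
    (hℓ : σ 6 = ℓ) (hone : σ 1 = 1) (hinv : MemInv W Q σ) (hℓW : ℓ < W)
    (hpar : ∀ v ∈ L, σ (addr v) = addr (par v) ∧ par v ∈ L) {v : Fin n} (hv : v ∈ L)
    (hσ : σ a = addr v) :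
    Tri I (MemInv W Q) (findCmd a) σ (1 + (ℓ * 4 + 2)) (PMF.pure ()) fun _ σ' =>
      (∀ x, x ≠ a → x ≠ 25 → σ' x = σ x) ∧ σ' a = addr (par^[ℓ] v) ∧ MemInv W Q σ' := by
  have hmem : ∀ k, par^[k] v ∈ L := by
    intro k
    induction k with
    | zero => exact hv
    | succ k ih => rw [Function.iterate_succ_apply']; exact (hpar _ ih).2
  refine Tri.seq_pure (a := ()) (R := fun _ σ' => σ' = σ.update 25 0)
    (Tri.ops hinv ?_) ?_
  · simp [wp, Instr.eff]
    exact hinv.reg (by norm_num) (by omega)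
  rintro σ₁ rfl
  rw [← loopDist_unit ℓ 0]
  refine (Tri.loop (N := ℓ) (B := 2) (E := fun _ _ => PMF.pure ()) (R := fun k _ σ' =>
    (∀ x, x ≠ a → x ≠ 25 → σ' x = σ x) ∧ σ' a = addr (par^[k] v) ∧ σ' 25 = k ∧ MemInv W Q σ')
    (fun _ _ _ h => h.2.2.2) ?_ ?_ ℓ (i := 0) (x := ()) (by omega) ?_).mono le_rfl ?_
  · rintro i _ τ - ⟨h1, h2, h3, -⟩
    rw [h3, h1 6 (by omega) (by omega), hℓ]
  · rintro i _ τ hi ⟨h1, h2, h3, h4⟩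
    refine Tri.ops h4 ?_
    have h5 : τ (τ a) = addr (par (par^[i] v)) := by
      rw [h2, h1 _ (by unfold addr; omega) (by unfold addr; omega), (hpar _ (hmem i)).1]
    have h6 : τ 1 = 1 := by rw [h1 1 (by omega) (by omega), hone]
    have h7 := h4.1 (τ a)
    simp only [wp, Instr.eff, Option.some.injEq, Prod.mk.injEq, Finsupp.update_apply]
    refine ⟨_, _, ⟨rfl, rfl⟩, h4.reg (by omega) h7, _, _, ⟨rfl, rfl⟩, ?_, ?_⟩
    · rw [if_neg (by omega), if_neg (by omega), h3, h6]
      exact (h4.reg (by omega) h7).reg (by omega) (by omega)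
    · refine ⟨fun x hx hx' => ?_, ?_, ?_, ?_⟩
      · rw [if_neg hx', if_neg hx, h1 x hx hx']
      · rw [if_neg (by omega), if_pos rfl, h5, Function.iterate_succ_apply']
      · rw [if_pos rfl, if_neg (by omega), if_neg (by omega), h3, h6]
      · rw [if_neg (by omega), if_neg (by omega), h3, h6]
        exact (h4.reg (by omega) h7).reg (by omega) (by omega)
  · refine ⟨fun x _ hx => ?_, ?_, ?_, hinv.reg (by omega) (by omega)⟩
    · rw [Finsupp.update_apply, if_neg hx]
    · rw [Finsupp.update_apply, if_neg (by omega), hσ]; rfl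
    · rw [Finsupp.update_apply, if_pos rfl]
  · rintro _ - σ' ⟨h1, h2, h3, h4⟩ -
    exact ⟨h1, h2, h4⟩

end RAM

/-! ### Union by size -/

/-- The forest `par` with tree sizes `sz` on the entries of `L` represents the partition generated
by the pairs in `D`; roots are reached after `ℓ` steps. -/
structure UnionFind {V : Type} [DecidableEq V] (n ℓ : ℕ) (L : List V) (par : V → V) (sz : V → ℕ)
    (D : Set (V × V)) : Prop where
  par_mem : ∀ v ∈ L, par v ∈ L
  one_le : ∀ v ∈ L, 1 ≤ sz v
  le_card : ∀ v ∈ L, sz v ≤ n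
  double : ∀ v ∈ L, par v ≠ v → 2 * sz v ≤ sz (par v)
  sum_le : ∑ v ∈ L.toFinset with par v = v, sz v ≤ n
  sub : ∀ q ∈ D, q.1 ∈ L ∧ q.2 ∈ L
  iff : ∀ v ∈ L, ∀ w ∈ L, Relation.EqvGen (fun a b => (a, b) ∈ D) v w ↔ par^[ℓ] v = par^[ℓ] w

namespace UnionFind

theorem iterate_mem {V : Type} {L : List V} {par : V → V} (h : ∀ v ∈ L, par v ∈ L) {v : V} (hv : v ∈ L) (k : ℕ) :
    par^[k] v ∈ L := by
  induction k with
  | zero => exact hv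
  | succ k ih => rw [Function.iterate_succ_apply']; exact h _ ih

/-- A function that is constant on the generating pairs is constant on the classes they generate;
outside `L` the generated equivalence is equality. -/
theorem eqvGen_mem {V : Type} {L : List V} {D : Set (V × V)} (h : ∀ q ∈ D, q.1 ∈ L ∧ q.2 ∈ L) {f : V → V} (hf : ∀ q ∈ D, f q.1 = f q.2)
    {v w : V} (hvw : Relation.EqvGen (fun a b => (a, b) ∈ D) v w) :
    v = w ∨ (v ∈ L ∧ w ∈ L ∧ f v = f w) := by
  induction hvw with
  | rel v w hvw => exact .inr ⟨(h _ hvw).1, (h _ hvw).2, hf _ hvw⟩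
  | refl v => exact .inl rfl
  | symm v w _ ih => rcases ih with rfl | ⟨h1, h2, h3⟩
                     · exact .inl rfl
                     · exact .inr ⟨h2, h1, h3.symm⟩
  | trans v w x _ _ ih1 ih2 =>
    rcases ih1 with rfl | ⟨h1, h2, h3⟩
    · exact ih2
    · rcases ih2 with rfl | ⟨g1, g2, g3⟩
      · exact .inr ⟨h1, h2, h3⟩
      · exact .inr ⟨h1, g2, h3.trans g3⟩

variable {V : Type} [DecidableEq V] {n ℓ : ℕ} {L : List V} {par : V → V} {sz : V → ℕ}
  {D : Set (V × V)}

/-- Sizes at least double along each proper pointer, starting from at least `1`. A path with `ℓ + 1`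
proper pointers would end at size `2 ^ (ℓ + 1)`, more than `n`. -/
theorem root_fixed_of {par : V → V} {sz : V → ℕ} (hpar : ∀ v ∈ L, par v ∈ L)
    (h1 : ∀ v ∈ L, 1 ≤ sz v) (hn : ∀ v ∈ L, sz v ≤ n)
    (h2 : ∀ v ∈ L, par v ≠ v → 2 * sz v ≤ sz (par v)) (hℓ : n ≤ 2 ^ ℓ) {v : V} (hv : v ∈ L) :
    par (par^[ℓ] v) = par^[ℓ] v := by
  by_contra hne
  have hnot : ∀ k ≤ ℓ, par (par^[k] v) ≠ par^[k] v := by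
    intro k hk heq
    apply hne
    obtain ⟨j, rfl⟩ := Nat.exists_eq_add_of_le' hk
    rw [Function.iterate_add_apply, Function.iterate_fixed heq, heq]
  have hpow : ∀ k ≤ ℓ + 1, 2 ^ k ≤ sz (par^[k] v) := by
    intro k hk
    induction k with
    | zero => simpa using h1 v hv
    | succ k ih =>
      have h3 := ih (by omega)
      have h4 := h2 _ (iterate_mem hpar hv k) (hnot k (by omega))
      rw [Function.iterate_succ_apply', pow_succ]
      omega
  have h3 := hpow (ℓ + 1) le_rfl
  have h4 := hn _ (iterate_mem hpar hv (ℓ + 1))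
  have h5 : 1 ≤ 2 ^ ℓ := Nat.one_le_two_pow
  rw [pow_succ] at h3
  omega

theorem root_fixed (h : UnionFind n ℓ L par sz D) (hℓ : n ≤ 2 ^ ℓ) {v : V} (hv : v ∈ L) :
    par (par^[ℓ] v) = par^[ℓ] v :=
  root_fixed_of h.par_mem h.one_le h.le_card h.double hℓ hv

/-- The partition generated by `D` and one more pair, in terms of roots: `f` is constant on the
classes of `D`, separates them, except that it merges the classes of `l` and `x`. -/
theorem eqvGen_insert_iff (h : UnionFind n ℓ L par sz D) {l x : V} (hl : l ∈ L) (hx : x ∈ L)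
    {f : V → V} (hf : ∀ v ∈ L, ∀ w ∈ L, f v = f w ↔ (par^[ℓ] v = par^[ℓ] w ∨
      (par^[ℓ] v = par^[ℓ] l ∧ par^[ℓ] w = par^[ℓ] x) ∨
      (par^[ℓ] v = par^[ℓ] x ∧ par^[ℓ] w = par^[ℓ] l))) {v w : V} (hv : v ∈ L) (hw : w ∈ L) :
    Relation.EqvGen (fun a b => (a, b) ∈ D ∪ {(l, x)}) v w ↔ f v = f w := by
  have hmono : ∀ {v w}, Relation.EqvGen (fun a b => (a, b) ∈ D) v w →
      Relation.EqvGen (fun a b => (a, b) ∈ D ∪ {(l, x)}) v w :=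
    fun h => h.mono fun a b hab => .inl hab
  have hlx : Relation.EqvGen (fun a b => (a, b) ∈ D ∪ {(l, x)}) l x := .rel _ _ (.inr rfl)
  constructor
  · intro hvw
    have h1 : ∀ q ∈ D ∪ {(l, x)}, q.1 ∈ L ∧ q.2 ∈ L := by
      rintro q (hq | rfl)
      · exact h.sub q hq
      · exact ⟨hl, hx⟩
    have h2 : ∀ q ∈ D ∪ {(l, x)}, f q.1 = f q.2 := by
      rintro q (hq | rfl)
      · have hm := h.sub q hq
        exact (hf _ hm.1 _ hm.2).2 (.inl ((h.iff _ hm.1 _ hm.2).1 (.rel _ _ hq)))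
      · exact (hf _ hl _ hx).2 (.inr (.inl ⟨rfl, rfl⟩))
    rcases eqvGen_mem h1 h2 hvw with rfl | ⟨-, -, h⟩
    · rfl
    · exact h
  · intro hvw
    rcases (hf v hv w hw).1 hvw with h1 | ⟨h1, h2⟩ | ⟨h1, h2⟩
    · exact hmono ((h.iff v hv w hw).2 h1)
    · exact .trans _ _ _ (hmono ((h.iff v hv l hl).2 h1))
        (.trans _ _ _ hlx (.symm _ _ (hmono ((h.iff w hw x hx).2 h2))))
    · exact .trans _ _ _ (hmono ((h.iff v hv x hx).2 h1))
        (.trans _ _ _ (.symm _ _ hlx) (.symm _ _ (hmono ((h.iff w hw l hl).2 h2))))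

theorem insert_same (h : UnionFind n ℓ L par sz D) {l x : V} (hl : l ∈ L) (hx : x ∈ L)
    (hlx : par^[ℓ] l = par^[ℓ] x) : UnionFind n ℓ L par sz (D ∪ {(l, x)}) where
  par_mem := h.par_mem
  one_le := h.one_le
  le_card := h.le_card
  double := h.double
  sum_le := h.sum_le
  sub := by
    rintro q (hq | rfl)
    · exact h.sub q hq
    · exact ⟨hl, hx⟩
  iff v hv w hw := h.eqvGen_insert_iff hl hx (f := par^[ℓ])
    (fun v hv w hw => ⟨.inl, by rintro (h | ⟨h, h'⟩ | ⟨h, h'⟩) <;> simp [*]⟩) hv hw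

/-- Doubling at `r₁` is what `sz r₁ ≤ sz r₂` provides. The new size is at most `n` because `r₁` and
`r₂` are different roots and root sizes sum to at most `n`; the size stored at `r₁` is kept, but as
a non-root it leaves this sum. -/
theorem insert_link (h : UnionFind n ℓ L par sz D) (hℓ : n ≤ 2 ^ ℓ) {l x r₁ r₂ : V} (hl : l ∈ L)
    (hx : x ∈ L) (hr : r₁ ≠ r₂) (hsz : sz r₁ ≤ sz r₂)
    (hlx : par^[ℓ] l = r₁ ∧ par^[ℓ] x = r₂ ∨ par^[ℓ] l = r₂ ∧ par^[ℓ] x = r₁) :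
    UnionFind n ℓ L (Function.update par r₁ r₂) (Function.update sz r₂ (sz r₁ + sz r₂))
      (D ∪ {(l, x)}) := by
  have hmem : r₁ ∈ L ∧ r₂ ∈ L := by
    have h1 := iterate_mem h.par_mem hl ℓ
    have h2 := iterate_mem h.par_mem hx ℓ
    rcases hlx with ⟨rfl, rfl⟩ | ⟨rfl, rfl⟩
    · exact ⟨h1, h2⟩
    · exact ⟨h2, h1⟩
  have hfix : par r₁ = r₁ ∧ par r₂ = r₂ := by
    have h1 := h.root_fixed hℓ hl
    have h2 := h.root_fixed hℓ hx
    rcases hlx with ⟨rfl, rfl⟩ | ⟨rfl, rfl⟩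
    · exact ⟨h1, h2⟩
    · exact ⟨h2, h1⟩
  obtain ⟨hm₁, hm₂⟩ := hmem
  obtain ⟨hf₁, hf₂⟩ := hfix
  have hsum : sz r₁ + sz r₂ ≤ n := by
    refine le_trans ?_ h.sum_le
    rw [← Finset.sum_pair hr]
    refine Finset.sum_le_sum_of_subset fun v hv => ?_
    rw [Finset.mem_insert, Finset.mem_singleton] at hv
    rcases hv with rfl | rfl <;> simp [*]
  have h1 := h.one_le _ hm₁
  have h2 := h.one_le _ hm₂
  have par_mem' : ∀ v ∈ L, Function.update par r₁ r₂ v ∈ L := by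
    intro v hv
    by_cases hv1 : v = r₁
    · subst hv1; simpa using hm₂
    · simpa [hv1] using h.par_mem v hv
  have one_le' : ∀ v ∈ L, 1 ≤ Function.update sz r₂ (sz r₁ + sz r₂) v := by
    intro v hv
    by_cases hv1 : v = r₂
    · subst hv1; simp; omega
    · simpa [hv1] using h.one_le v hv
  have le_card' : ∀ v ∈ L, Function.update sz r₂ (sz r₁ + sz r₂) v ≤ n := by
    intro v hv
    by_cases hv1 : v = r₂
    · subst hv1; simpa using hsum
    · simpa [hv1] using h.le_card v hv
  have double' : ∀ v ∈ L, Function.update par r₁ r₂ v ≠ v →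
      2 * Function.update sz r₂ (sz r₁ + sz r₂) v ≤
        Function.update sz r₂ (sz r₁ + sz r₂) (Function.update par r₁ r₂ v) := by
    intro v hv hne
    by_cases hv1 : v = r₁
    · subst hv1
      simp only [Function.update_self, Function.update_of_ne hr]
      omega
    · rw [Function.update_of_ne hv1] at hne ⊢
      have hv2 : v ≠ r₂ := by rintro rfl; exact hne hf₂
      rw [Function.update_of_ne hv2]
      have := h.double v hv hne
      by_cases hv3 : par v = r₂
      · rw [hv3] at this ⊢
        simp only [Function.update_self]
        omega
      · rwa [Function.update_of_ne hv3]
  refine ⟨par_mem', one_le', le_card', double', ?_, ?_, ?_⟩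
  · have hset : (L.toFinset.filter fun v => Function.update par r₁ r₂ v = v) =
        (L.toFinset.filter fun v => par v = v).erase r₁ := by
      ext v
      simp only [Finset.mem_filter, Finset.mem_erase, List.mem_toFinset]
      by_cases hv1 : v = r₁
      · subst hv1; simp [hr.symm]
      · simp [hv1]
    have hr1 : r₁ ∈ L.toFinset.filter fun v => par v = v := by simp [*]
    have hr2 : r₂ ∈ (L.toFinset.filter fun v => par v = v).erase r₁ := by simp [*, hr.symm]
    have h3 := h.sum_le
    rw [← Finset.add_sum_erase _ _ hr1, ← Finset.add_sum_erase _ _ hr2] at h3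
    rw [hset, ← Finset.add_sum_erase _ _ hr2, Function.update_self]
    rw [Finset.sum_congr rfl (g := fun v => sz v) fun v hv => Function.update_of_ne (Finset.ne_of_mem_erase hv) _ _]
    omega
  · rintro q (hq | rfl)
    · exact h.sub q hq
    · exact ⟨hl, hx⟩
  -- The expected new root `f` is invariant along the new pointers and agrees with the identity at
  -- new roots. Since the new forest also reaches its roots within `ℓ` steps, its `ℓ`-th iterate is
  -- `f`.
  · have hroot : ∀ v ∈ L, (Function.update par r₁ r₂)^[ℓ] v =
        if par^[ℓ] v = r₁ then r₂ else par^[ℓ] v := by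
      set f : V → V := fun v => if par^[ℓ] v = r₁ then r₂ else par^[ℓ] v with hf
      have hfp : ∀ v ∈ L, f (Function.update par r₁ r₂ v) = f v := by
        intro v hv
        by_cases hv1 : v = r₁
        · subst hv1
          simp only [hf, Function.update_self, Function.iterate_fixed hf₁,
            Function.iterate_fixed hf₂, if_neg hr.symm, if_pos]
        · have : par^[ℓ] (par v) = par^[ℓ] v := by
            rw [← Function.iterate_succ_apply, Function.iterate_succ_apply', h.root_fixed hℓ hv]
          simp only [hf, Function.update_of_ne hv1, this]
      intro v hv
      have h3 : ∀ k, f ((Function.update par r₁ r₂)^[k] v) = f v := by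
        intro k
        induction k with
        | zero => rfl
        | succ k ih =>
          rw [Function.iterate_succ_apply', hfp _ (iterate_mem par_mem' hv k), ih]
      have h4 := root_fixed_of par_mem' one_le' le_card' double' hℓ hv
      set y := (Function.update par r₁ r₂)^[ℓ] v with hy
      have hy1 : y ≠ r₁ := by
        intro hy1
        rw [hy1, Function.update_self] at h4
        exact hr h4.symm
      rw [Function.update_of_ne hy1] at h4
      have h5 := h3 ℓ
      rw [← hy] at h5
      change y = f v
      rw [← h5]
      simp only [hf, Function.iterate_fixed h4, if_neg hy1]
    intro v hv w hw
    refine h.eqvGen_insert_iff hl hx (f := (Function.update par r₁ r₂)^[ℓ]) ?_ hv hw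
    intro v hv w hw
    rw [hroot v hv, hroot w hw]
    rcases hlx with ⟨h3, h4⟩ | ⟨h3, h4⟩ <;> rw [h3, h4] <;> split_ifs with h5 h6 <;> grind

end UnionFind

/-! ### The representation of the forest in memory, and linking two classes -/

namespace RAM

/-- The cells `0, …, 11` after the setup. -/
structure Consts {n : ℕ} (p ℓ τ : ℕ) (s t : Fin n) (σ : Mem) : Prop where
  c0 : σ 0 = 0
  c1 : σ 1 = 1
  c2 : σ 2 = n
  c3 : σ 3 = s
  c4 : σ 4 = t
  c5 : σ 5 = p
  c6 : σ 6 = ℓ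
  c7 : σ 7 = τ
  c8 : σ 8 = p + 2
  c9 : σ 9 = 72 * ℓ
  c10 : σ 10 = 32
  c11 : σ 11 = n - 1

/-- The arrays in the cells from `32` on hold the list `L` of landmarks and the forest `par`. -/
structure Arrays {n : ℕ} (L : List (Fin n)) (par : Fin n → Fin n) (sz : Fin n → ℕ) (σ : Mem) :
    Prop where
  list : ∀ i (h : i < L.length), σ (addr i + 2) = L[i]
  par : ∀ v ∈ L, σ (addr v) = addr (par v)
  zero : ∀ v : Fin n, v ∉ L → σ (addr v) = 0
  size : ∀ v ∈ L, σ (addr v + 1) = sz v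

/-- The memory represents the set `D` of discovered pairs. -/
def Repr {n : ℕ} (ℓ : ℕ) (L : List (Fin n)) (D : Set (Fin n × Fin n)) (σ : Mem) : Prop :=
  ∃ par sz, Arrays L par sz σ ∧ UnionFind n ℓ L par sz D

variable {n p ℓ τ W Q : ℕ} {s t : Fin n} {L : List (Fin n)} {par : Fin n → Fin n}
  {sz : Fin n → ℕ} {D : Set (Fin n × Fin n)} {σ σ' : Mem} {I : Input}

theorem Consts.of_agree (h : Consts p ℓ τ s t σ) (hσ : ∀ x < 12, σ' x = σ x) :
    Consts p ℓ τ s t σ' := by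
  obtain ⟨h0, h1, h2, h3, h4, h5, h6, h7, h8, h9, h10, h11⟩ := h
  constructor <;> rw [hσ _ (by norm_num)] <;> assumption

theorem Arrays.of_agree (h : Arrays L par sz σ) (hσ : ∀ x, 32 ≤ x → σ' x = σ x) :
    Arrays L par sz σ' where
  list i hi := by rw [hσ _ (by unfold addr; omega), h.list i hi]
  par v hv := by rw [hσ _ (by unfold addr; omega), h.par v hv]
  zero v hv := by rw [hσ _ (by unfold addr; omega), h.zero v hv]
  size v hv := by rw [hσ _ (by unfold addr; omega), h.size v hv]

theorem Repr.of_agree (h : Repr ℓ L D σ) (hσ : ∀ x, 32 ≤ x → σ' x = σ x) : Repr ℓ L D σ' := by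
  obtain ⟨par, sz, h1, h2⟩ := h
  exact ⟨par, sz, h1.of_agree hσ, h2⟩

theorem tri_linkCmd (hℓ : n ≤ 2 ^ ℓ) (hW : ∀ v : Fin n, addr v + 2 ≤ W) (hnW : n ≤ W)
    (hone : σ 1 = 1) (hzero : σ 0 = 0) (hinv : MemInv W Q σ) (ha : Arrays L par sz σ)
    (hu : UnionFind n ℓ L par sz D) {l x : Fin n} (hl : l ∈ L) (hx : x ∈ L)
    (h23 : σ 23 = addr (par^[ℓ] x)) (h24 : σ 24 = addr (par^[ℓ] l)) :
    Tri I (MemInv W Q) linkCmd σ 17 (PMF.pure ()) fun _ σ' =>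
      (∀ y < 23, σ' y = σ y) ∧ Repr ℓ L (D ∪ {(l, x)}) σ' ∧ MemInv W Q σ' := by
  have hWx := hW (par^[ℓ] x)
  have hWl := hW (par^[ℓ] l)
  have hinj : ∀ v w : Fin n, addr v = addr w ↔ v = w := by
    intro v w; unfold addr; rw [Fin.ext_iff]; omega
  have hxm := UnionFind.iterate_mem hu.par_mem hx ℓ
  have hlm := UnionFind.iterate_mem hu.par_mem hl ℓ
  have hxf := hu.root_fixed hℓ hx
  have hlf := hu.root_fixed hℓ hl
  refine (Tri.seq_pure (a := ()) (B' := 14) (R := fun _ σ' => (∀ y, y ≠ 26 → y ≠ 27 → σ' y = σ y) ∧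
    (0 < σ' 26 ↔ par^[ℓ] x ≠ par^[ℓ] l) ∧ MemInv W Q σ') (Tri.ops hinv ?_) ?_).mono (by simp)
    fun _ _ _ h _ => h
  · simp [wp, Instr.eff, Finsupp.update_apply]
    have i1 := hinv.reg (d := 26) (x := σ 23 - σ 24) (by omega) (by omega)
    have i2 := i1.reg (d := 27) (x := σ 24 - σ 23) (by omega) (by omega)
    have i3 := i2.reg (d := 26) (x := σ 23 - σ 24 + (σ 24 - σ 23)) (by omega) (by omega)
    refine ⟨i1, i2, i3, ?_, ?_, i3⟩
    · intro y h1 h2; simp [h1, h2]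
    · have := hinj (par^[ℓ] x) (par^[ℓ] l)
      rw [← this, h23, h24]; omega
  rintro σ₁ ⟨hs₁, hd₁, hi₁⟩
  by_cases heq : par^[ℓ] x = par^[ℓ] l
  · refine (Tri.ite_neg (y := ()) ?_ hi₁ ?_).mono (by omega) fun _ _ _ h _ => h
    · rw [hs₁ 0 (by omega) (by omega), hzero, hd₁]; simpa using heq
    · refine ⟨fun y hy => hs₁ y (by omega) (by omega), ?_, hi₁⟩
      exact ⟨par, sz, ha.of_agree fun y hy => hs₁ y (by omega) (by omega),
        hu.insert_same hl hx heq.symm⟩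
  refine (Tri.ite_pos (B := 13) ?_ hi₁ ?_)
  · rw [hs₁ 0 (by omega) (by omega), hzero]; exact hd₁.2 heq
  have ha₁ := ha.of_agree (σ' := σ₁) fun y hy => hs₁ y (by omega) (by omega)
  have e23 := hs₁ 23 (by omega) (by omega)
  have e24 := hs₁ 24 (by omega) (by omega)
  have e1 := hs₁ 1 (by omega) (by omega)
  rw [h23] at e23
  rw [h24] at e24
  rw [hone] at e1
  have lx := hu.le_card _ hxm
  have ll := hu.le_card _ hlm
  have gx := ha₁.size _ hxm
  have gl := ha₁.size _ hlm
  refine (Tri.seq_pure (a := ()) (B := 4) (B' := 9) (R := fun _ σ' =>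
    (∀ y, y ≠ 27 → y ≠ 28 → σ' y = σ₁ y) ∧
    σ' 27 = sz (par^[ℓ] x) ∧ σ' 28 = sz (par^[ℓ] l) ∧ MemInv W Q σ') (Tri.ops hi₁ ?_) ?_)
  · have n1 : addr (par^[ℓ] x) ≠ 26 := by unfold addr; omega
    have n3 : addr (par^[ℓ] l) + 1 ≠ 27 := by unfold addr; omega
    have n4 : addr (par^[ℓ] l) + 1 ≠ 28 := by unfold addr; omega
    simp [wp, Instr.eff, Finsupp.update_apply, e23, e1, e24, gx, n1, n3, n4, gl]
    have i1 := hi₁.reg (d := 27) (x := addr (par^[ℓ] x) + 1) (by omega) (by omega)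
    have i2 := hi₁.reg (d := 27) (x := sz (par^[ℓ] x)) (by omega) (by omega)
    have i3 := i2.reg (d := 28) (x := addr (par^[ℓ] l) + 1) (by omega) (by omega)
    have i4 := i2.reg (d := 28) (x := sz (par^[ℓ] l)) (by omega) (by omega)
    refine ⟨i1, i2, i3, i4, ?_, i4⟩
    intro y h1 h2; simp [h1, h2]
  rintro σ₂ ⟨hs₂, h27, h28, hi₂⟩
  -- From here on `a` is the root of the smaller class and `b` that of the larger; which of them
  -- belongs to `l` no longer matters.
  refine (Tri.seq_pure (a := ()) (B := 4) (B' := 4) (R := fun _ σ' =>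
    (∀ y, y ≠ 23 → y ≠ 24 → y ≠ 29 → σ' y = σ₂ y) ∧ MemInv W Q σ' ∧ ∃ a b, a ∈ L ∧ b ∈ L ∧
    (par^[ℓ] l = a ∧ par^[ℓ] x = b ∨ par^[ℓ] l = b ∧ par^[ℓ] x = a) ∧ sz a ≤ sz b ∧
    σ' 23 = addr a ∧ σ' 24 = addr b ∧ σ' 27 + σ' 28 = sz a + sz b) ?_ ?_).mono (by omega)
    fun _ _ _ h _ => h
  · have f23 := hs₂ 23 (by omega) (by omega)
    have f24 := hs₂ 24 (by omega) (by omega)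
    rw [e23] at f23
    rw [e24] at f24
    by_cases hlt : σ₂ 28 < σ₂ 27
    · refine Tri.ite_pos (B := 3) hlt hi₂ (Tri.ops hi₂ ?_)
      simp [wp, Instr.eff, Finsupp.update_apply]
      have i1 := hi₂.reg (d := 29) (x := σ₂ 23) (by omega) (by omega)
      have i2 := i1.reg (d := 23) (x := σ₂ 24) (by omega) (by omega)
      have i3 := i2.reg (d := 24) (x := σ₂ 23) (by omega) (by omega)
      refine ⟨i1, i2, i3, ?_, i3, par^[ℓ] l, hlm, par^[ℓ] x, hxm, .inl ⟨rfl, rfl⟩, by omega,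
        f24, f23, by omega⟩
      intro y h1 h2 h3; simp [h1, h2, h3]
    · refine (Tri.ite_neg (y := ()) hlt hi₂ ?_).mono (by omega) fun _ _ _ h _ => h
      exact ⟨fun _ _ _ _ => rfl, hi₂, par^[ℓ] x, par^[ℓ] l, hxm, hlm, .inr ⟨rfl, rfl⟩, by omega,
        f23, f24, by omega⟩
  rintro σ₃ ⟨hs₃, hi₃, a, b, hal, hbl, hab, hle, g23, g24, gsum⟩
  have hne : a ≠ b := by rintro rfl; exact heq (by grind)
  have haf : par a = a := by grind
  have hbf : par b = b := by grind
  have hu' := hu.insert_link hℓ hl hx hne hle hab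
  have hcard := hu'.le_card b hbl
  rw [Function.update_self] at hcard
  have hWa := hW a
  have hWb := hW b
  have a3 : Arrays L par sz σ₃ := ha₁.of_agree fun y hy => by
    rw [hs₃ y (by omega) (by omega) (by omega), hs₂ y (by omega) (by omega)]
  have k1 : σ₃ 1 = 1 := by
    rw [hs₃ 1 (by omega) (by omega) (by omega), hs₂ 1 (by omega) (by omega), e1]
  refine Tri.ops hi₃ ?_
  have hna : (a : ℕ) ≠ b := fun h => hne (Fin.ext h)
  have ne1 : ∀ k, k < 32 → k ≠ addr a := by intro k hk; unfold addr; omega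
  have ne2 : ∀ k, k < 32 → k ≠ addr b + 1 := by intro k hk; unfold addr; omega
  have ne3 : addr b + 1 ≠ addr a := by unfold addr; omega
  have j1 : MemInv W Q (σ₃.update (addr a) (addr b)) :=
    hi₃.overwrite (by rw [a3.par a hal]; unfold addr; omega) (by omega)
  have j2 := j1.reg (d := 27) (x := sz a + sz b) (by omega) (by omega)
  have j3 := j2.reg (d := 28) (x := addr b + 1) (by omega) (by omega)
  have j4 : MemInv W Q ((((σ₃.update (addr a) (addr b)).update 27 (sz a + sz b)).update 28
      (addr b + 1)).update (addr b + 1) (sz a + sz b)) := by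
    refine j3.overwrite ?_ (by omega)
    simp only [Finsupp.update_apply]
    rw [if_neg (by unfold addr; omega), if_neg (by unfold addr; omega), if_neg ne3,
      a3.size b hbl]
    have := hu.one_le b hbl
    omega
  simp [wp, Instr.eff, Finsupp.update_apply, g23, g24, k1, ne1, gsum,
    -Set.union_singleton]
  refine ⟨j1, j2, j3, j4, ?_, ⟨_, _, ?_, hu'⟩, j4⟩
  · intro y hy
    simp only [ne1 y (by omega), ne2 y (by omega), if_false]
    rw [if_neg (by omega), if_neg (by omega), hs₃ y (by omega) (by omega) (by omega),
      hs₂ y (by omega) (by omega), hs₁ y (by omega) (by omega)]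
  · constructor
    · intro i hi
      simp only [Finsupp.update_apply]
      rw [if_neg (by unfold addr; omega), if_neg (by unfold addr; omega),
        if_neg (by unfold addr; omega), if_neg (by unfold addr; omega), a3.list i hi]
    · intro v hv
      simp only [Finsupp.update_apply, hinj]
      rw [if_neg (by unfold addr; omega), if_neg (by unfold addr; omega),
        if_neg (by unfold addr; omega), a3.par v hv, Function.update_apply]
      split_ifs <;> rfl
    · intro v hv
      simp only [Finsupp.update_apply, hinj]
      rw [if_neg (by unfold addr; omega), if_neg (by unfold addr; omega),
        if_neg (by unfold addr; omega), if_neg (by rintro rfl; exact hv hal), a3.zero v hv]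
    · intro v hv
      simp only [Finsupp.update_apply, add_left_inj, hinj, Function.update_apply]
      rw [if_neg (show ¬ addr v + 1 = 28 by unfold addr; omega),
        if_neg (show ¬ addr v + 1 = 27 by unfold addr; omega),
        if_neg (show ¬ addr v + 1 = addr a by unfold addr; omega), a3.size v hv]

end RAM

/-- The mass at one point is determined by the others, so the probability that the walk stays put
never has to be computed. -/
theorem PMF.ext_of_ne {α : Type*} [Fintype α] [DecidableEq α] {p q : PMF α} (v : α)
    (h : ∀ w, w ≠ v → p w = q w) : p = q := by
  ext w
  by_cases hw : w = v
  · subst hw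
    have h1 : ∑ x, p x = 1 := by rw [← p.tsum_coe, tsum_fintype]
    have h2 : ∑ x, q x = 1 := by rw [← q.tsum_coe, tsum_fintype]
    rw [← Finset.add_sum_erase _ _ (Finset.mem_univ w)] at h1 h2
    rw [Finset.sum_congr rfl fun x hx => h x (Finset.ne_of_mem_erase hx)] at h1
    have h3 : ∑ x ∈ Finset.univ.erase w, q x ≠ ⊤ := by
      refine ne_top_of_le_ne_top ENNReal.one_ne_top ?_
      rw [← h2]; exact le_add_self
    exact (ENNReal.add_left_inj h3).1 (h1.trans h2.symm)
  · exact h w hw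

/-! ### Transition probabilities of the walk with unit potential -/

section UnitStep

variable {V : Type} [Fintype V] [DecidableEq V] (G : SimpleGraph V) [DecidableRel G.Adj]

/-- Each of the `deg v` neighbors takes at most `1 / deg v`, so the subtraction on the loop does not
truncate and the weights are already normalized. -/
theorem sum_mhWeight_one (v : V) : ∑ u, mhWeight G (fun _ => 1) v u = 1 := by
  refine le_antisymm ?_ (mhWeight_le G (fun _ => 1) v)
  rw [← Finset.add_sum_erase _ _ (Finset.mem_univ v), mhWeight, if_pos rfl]
  have h1 : ∑ x ∈ G.neighborFinset v, min ((1 : ℝ≥0) / G.degree v) (1 / G.degree x) ≤ 1 := by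
    refine (Finset.sum_le_card_nsmul _ _ (1 / G.degree v : ℝ≥0) fun x _ => min_le_left _ _).trans ?_
    rw [SimpleGraph.card_neighborFinset_eq_degree, nsmul_eq_mul, mul_one_div]
    exact div_self_le_one _
  have h2 : ∑ u ∈ Finset.univ.erase v, mhWeight G (fun _ => 1) v u =
      ∑ x ∈ G.neighborFinset v, min ((1 : ℝ≥0) / G.degree v) (1 / G.degree x) := by
    symm
    apply Finset.sum_subset_zero_on_sdiff
    · intro x hx
      rw [SimpleGraph.mem_neighborFinset] at hx
      exact Finset.mem_erase.2 ⟨hx.ne', Finset.mem_univ x⟩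
    · intro x hx
      simp only [Finset.mem_sdiff, Finset.mem_erase, Finset.mem_univ, and_true,
        SimpleGraph.mem_neighborFinset] at hx
      simp [mhWeight, hx.1, hx.2]
    · intro x hx
      rw [SimpleGraph.mem_neighborFinset] at hx
      simp [mhWeight, hx, hx.ne']
  rw [h2, tsub_add_cancel_of_le h1]

theorem unitStep_apply (v u : V) : unitStep G v u = mhWeight G (fun _ => 1) v u := by
  rw [unitStep, mhStep, PMF.normalize_apply, tsum_fintype]
  have : ∑ u, (mhWeight G (fun _ => 1) v u : ℝ≥0∞) = 1 := by
    exact_mod_cast sum_mhWeight_one G v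
  rw [this, inv_one, mul_one]

theorem unitStep_apply_adj {v u : V} (h : G.Adj v u) :
    unitStep G v u = (min (1 / G.degree v) (1 / G.degree u) : ℝ≥0) := by
  rw [unitStep_apply, mhWeight, if_neg h.ne', if_pos h]

theorem unitStep_apply_of_not_adj {v u : V} (h : ¬ G.Adj v u) (hne : u ≠ v) :
    unitStep G v u = 0 := by
  rw [unitStep_apply, mhWeight, if_neg hne, if_neg h, ENNReal.coe_zero]

end UnitStep

/-! ### The landmark check and one walk step of the program -/

namespace RAM

variable {n p ℓ τ W Q : ℕ} {s t : Fin n} {L : List (Fin n)} {D : Set (Fin n × Fin n)} {σ σ' : Mem}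

theorem tri_checkCmd {I : Input} (hℓ : n ≤ 2 ^ ℓ) (hℓW : ℓ < W)
    (hW : ∀ v : Fin n, addr v + 2 ≤ W) (hnW : n ≤ W)
    (hc : Consts p ℓ τ s t σ) (hinv : MemInv W Q σ) (hr : Repr ℓ L D σ) {l u : Fin n} (hl : l ∈ L)
    (h16 : σ 16 = l) (h17 : σ 17 = u) :
    Tri I (MemInv W Q) checkCmd σ (8 * ℓ + 31) (PMF.pure ()) fun _ σ' =>
      (∀ y < 23, σ' y = σ y) ∧ Repr ℓ L (D ∪ {q | q.1 = l ∧ q.2 = u ∧ q.2 ∈ L}) σ' ∧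
        MemInv W Q σ' := by
  obtain ⟨par, sz, ha, hu⟩ := hr
  have hWu := hW u
  have hWl := hW l
  have haddr : ∀ v : ℕ, addr v = v + v + v + 32 := by intro v; unfold addr; omega
  have nu : addr u ≠ 24 ∧ addr u ≠ 23 := by unfold addr; omega
  refine (Tri.seq_pure (a := ()) (B := 4) (B' := 8 * ℓ + 27) (R := fun _ σ' =>
    (∀ y, y ≠ 23 → y ≠ 24 → σ' y = σ y) ∧ σ' 23 = addr u ∧ σ' 24 = σ (addr u) ∧ MemInv W Q σ')
    (Tri.ops hinv ?_) ?_).mono (by omega) fun _ _ _ h _ => h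
  · have i1 := hinv.reg (d := 23) (x := u + u) (by omega) (by unfold addr at hWu; omega)
    have i2 := hinv.reg (d := 23) (x := u + u + u) (by omega) (by unfold addr at hWu; omega)
    have i3 := hinv.reg (d := 23) (x := addr u) (by omega) (by omega)
    have i4 := i3.reg (d := 24) (x := σ (addr u)) (by omega) (hinv.1 _)
    simp [wp, Instr.eff, Finsupp.update_apply, h17, hc.c10, ← haddr, nu]
    exact ⟨i1, i2, i3, i4, fun y h1 h2 => by simp [h1, h2], i4⟩
  rintro σ₁ ⟨hs₁, g23, g24, hi₁⟩
  have k0 : σ₁ 0 = 0 := by rw [hs₁ 0 (by omega) (by omega), hc.c0]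
  by_cases huL : u ∈ L
  swap
  · refine (Tri.ite_neg (y := ()) ?_ hi₁ ?_).mono (by omega) fun _ _ _ h _ => h
    · rw [g24, ha.zero u huL]; omega
    · refine ⟨fun y hy => hs₁ y (by omega) (by omega), ⟨par, sz, ha.of_agree fun y hy =>
        hs₁ y (by omega) (by omega), ?_⟩, hi₁⟩
      have : {q : Fin n × Fin n | q.1 = l ∧ q.2 = u ∧ q.2 ∈ L} = ∅ := by
        ext q; simp only [Set.mem_ofPred_eq, Set.mem_empty_iff_false, iff_false]
        rintro ⟨-, h1, h2⟩; exact huL (h1 ▸ h2)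
      rwa [this, Set.union_empty]
  have hset : {q : Fin n × Fin n | q.1 = l ∧ q.2 = u ∧ q.2 ∈ L} = {(l, u)} := by
    ext ⟨a, b⟩; simp only [Set.mem_ofPred_eq, Set.mem_singleton_iff, Prod.mk.injEq]
    constructor
    · rintro ⟨h1, h2, -⟩; exact ⟨h1, h2⟩
    · rintro ⟨h1, h2⟩; exact ⟨h1, h2, h2 ▸ huL⟩
  rw [hset]
  refine Tri.ite_pos (B := 8 * ℓ + 26) ?_ hi₁ ?_
  · rw [k0, g24, ha.par u huL]; unfold addr; omega
  refine (Tri.seq_pure (a := ()) (B := 3) (B' := 8 * ℓ + 23) (R := fun _ σ' =>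
    (∀ y, y ≠ 24 → σ' y = σ₁ y) ∧ σ' 24 = addr l ∧ MemInv W Q σ')
    (Tri.ops hi₁ ?_) ?_).mono (by omega) fun _ _ _ h _ => h
  · have i1 := hi₁.reg (d := 24) (x := l + l) (by omega) (by unfold addr at hWl; omega)
    have i2 := hi₁.reg (d := 24) (x := l + l + l) (by omega) (by unfold addr at hWl; omega)
    have i3 := hi₁.reg (d := 24) (x := addr l) (by omega) (by omega)
    have f16 : σ₁ 16 = l := by rw [hs₁ 16 (by omega) (by omega), h16]
    have f10 : σ₁ 10 = 32 := by rw [hs₁ 10 (by omega) (by omega), hc.c10]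
    simp [wp, Instr.eff, Finsupp.update_apply, f16, f10, ← haddr]
    exact ⟨i1, i2, i3, fun y h1 => by simp [h1], i3⟩
  rintro σ₂ ⟨hs₂, f24, hi₂⟩
  have f23 : σ₂ 23 = addr u := by rw [hs₂ 23 (by omega), g23]
  have frame₂ : ∀ y, y ≠ 23 → y ≠ 24 → σ₂ y = σ y := fun y h1 h2 => by
    rw [hs₂ y h2, hs₁ y h1 h2]
  have ha₂ := ha.of_agree (σ' := σ₂) fun y hy => frame₂ y (by omega) (by omega)
  have hp₂ : ∀ v ∈ L, σ₂ (addr v) = addr (par v) ∧ par v ∈ L :=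
    fun v hv => ⟨ha₂.par v hv, hu.par_mem v hv⟩
  refine (Tri.seq_pure (a := ()) (B' := 4 * ℓ + 20) (tri_findCmd (by omega) (by omega)
    (by rw [frame₂ 6 (by omega) (by omega), hc.c6]) (by rw [frame₂ 1 (by omega) (by omega), hc.c1])
    hi₂ hℓW hp₂ huL f23) ?_).mono (by omega) fun _ _ _ h _ => h
  rintro σ₃ ⟨hs₃, e23, hi₃⟩
  have frame₃ : ∀ y, y ≠ 23 → y ≠ 24 → y ≠ 25 → σ₃ y = σ y := fun y h1 h2 h3 => by
    rw [hs₃ y h1 h3, frame₂ y h1 h2]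
  have ha₃ := ha.of_agree (σ' := σ₃) fun y hy => frame₃ y (by omega) (by omega) (by omega)
  have hp₃ : ∀ v ∈ L, σ₃ (addr v) = addr (par v) ∧ par v ∈ L :=
    fun v hv => ⟨ha₃.par v hv, hu.par_mem v hv⟩
  refine (Tri.seq_pure (a := ()) (B' := 17) (tri_findCmd (by omega) (by omega)
    (by rw [frame₃ 6 (by omega) (by omega) (by omega), hc.c6])
    (by rw [frame₃ 1 (by omega) (by omega) (by omega), hc.c1])
    hi₃ hℓW hp₃ hl (by rw [hs₃ 24 (by omega) (by omega), f24])) ?_).mono (by omega)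
    fun _ _ _ h _ => h
  rintro σ₄ ⟨hs₄, e24, hi₄⟩
  have frame₄ : ∀ y, y ≠ 23 → y ≠ 24 → y ≠ 25 → σ₄ y = σ y := fun y h1 h2 h3 => by
    rw [hs₄ y h2 h3, frame₃ y h1 h2 h3]
  have ha₄ := ha.of_agree (σ' := σ₄) fun y hy => frame₄ y (by omega) (by omega) (by omega)
  refine (tri_linkCmd hℓ hW hnW (by rw [frame₄ 1 (by omega) (by omega) (by omega), hc.c1])
    (by rw [frame₄ 0 (by omega) (by omega) (by omega), hc.c0]) hi₄ ha₄ hu hl huL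
    (by rw [hs₄ 23 (by omega) (by omega), e23]) e24).mono le_rfl ?_
  rintro _ - σ₅ ⟨h1, h2, h3⟩ -
  exact ⟨fun y hy => by rw [h1 y hy, frame₄ y (by omega) (by omega) (by omega)], h2, h3⟩

variable (G : SimpleGraph (Fin n)) [DecidableRel G.Adj]
  (port : ∀ v : Fin n, G.neighborSet v ≃ Fin (G.degree v))

/-- The neighbor of `v` behind port `i`, and node `0` if there is none. -/
def nbrOr (v : Fin n) (i : ℕ) : Fin n :=
  if hi : i < G.degree v then (port v).symm ⟨i, hi⟩ else ⟨0, v.pos⟩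

/-- The uniform distribution on `0, …, m`. -/
def unif (m : ℕ) : PMF ℕ := (PMF.uniformOfFintype (Fin (m + 1))).map fun i : Fin (m + 1) => (i : ℕ)

theorem mem_support_unif {m x : ℕ} (h : x ∈ (unif m).support) : x ≤ m := by
  obtain ⟨i, -, rfl⟩ := (PMF.mem_support_map_iff _ _ _).1 h
  omega

theorem tri_rnd {I : Input} {Inv : Mem → Prop} {d a : ℕ} (h : Inv σ)
    (h' : ∀ x : ℕ, x ≤ σ a → Inv (σ.update d x)) :
    Tri I Inv (.rnd d a) σ 1 (unif (σ a)) (fun x σ' => σ' = σ.update d x) :=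
  (Tri.rnd h h').map _ fun _ _ _ h => h

/-- One step of the walk as the program draws it. -/
def stepDist (v : Fin n) : PMF (Fin n) :=
  (unif (G.degree v - 1)).bind fun i => (unif (G.degree (nbrOr G port v i) - 1)).bind fun j =>
    PMF.pure (if j < G.degree v then nbrOr G port v i else v)

/-- A neighbor `w` is proposed through exactly one port, with probability `1 / deg v`, and accepted
with probability `min(deg v, deg w) / deg w`; the product is `min(1 / deg v, 1 / deg w)`. -/
theorem stepDist_eq (v : Fin n) : stepDist G port v = unitStep G v := by
  refine PMF.ext_of_ne v fun w hw => ?_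
  have hinner : ∀ i : ℕ, ((unif (G.degree (nbrOr G port v i) - 1)).bind fun j =>
        PMF.pure (if j < G.degree v then nbrOr G port v i else v)) w =
      if nbrOr G port v i = w ∧ 0 < G.degree v then
        (min (G.degree v) (G.degree w - 1 + 1) : ℕ) * ((G.degree w - 1 + 1 : ℕ) : ℝ≥0∞)⁻¹ else 0 := by
    intro i
    rw [unif, PMF.bind_map, PMF.bind_apply, tsum_fintype]
    simp only [PMF.uniformOfFintype_apply, Fintype.card_fin, Function.comp_apply, PMF.pure_apply,
      mul_ite, mul_one, mul_zero]
    split_ifs with h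
    · obtain ⟨h, -⟩ := h
      have h1 : ∀ j : Fin (G.degree (nbrOr G port v i) - 1 + 1),
          (w = if (j : ℕ) < G.degree v then nbrOr G port v i else v) ↔ (j : ℕ) < G.degree v := by
        intro j; split_ifs with hj <;> simp [hj, h, hw]
      simp only [h1]
      rw [← Finset.sum_filter, Finset.sum_const, nsmul_eq_mul, h]
      congr 2
      generalize G.degree w - 1 + 1 = m
      rw [Fin.card_filter_val_lt]
      exact min_comm _ _
    · refine Finset.sum_eq_zero fun j _ => if_neg ?_
      split_ifs with hj
      · rintro rfl; exact h ⟨rfl, by omega⟩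
      · exact hw
  rw [stepDist, unif, PMF.bind_map, PMF.bind_apply, tsum_fintype]
  simp only [Function.comp_apply, hinner, PMF.uniformOfFintype_apply, Fintype.card_fin]
  by_cases hadj : G.Adj v w
  · have hdv : 0 < G.degree v := (G.degree_pos_iff_exists_adj v).2 ⟨w, hadj⟩
    have hdw : 0 < G.degree w := (G.degree_pos_iff_exists_adj w).2 ⟨v, hadj.symm⟩
    obtain ⟨i₀, hi₀⟩ : ∃ i₀, i₀ = port v ⟨w, hadj⟩ := ⟨_, rfl⟩
    have h1 : ∀ i : Fin (G.degree v - 1 + 1), nbrOr G port v i = w ↔ i = ⟨i₀, by omega⟩ := by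
      intro i
      have hi : (i : ℕ) < G.degree v := by omega
      rw [nbrOr, dif_pos hi]
      constructor
      · intro h
        have : port v ((port v).symm ⟨i, hi⟩) = i₀ := by
          rw [hi₀]; congr 1; exact Subtype.ext h
        rw [Equiv.apply_symm_apply] at this
        have h2 := congrArg Fin.val this
        exact Fin.ext h2
      · rintro rfl
        have : (port v).symm i₀ = ⟨w, hadj⟩ := by rw [hi₀, Equiv.symm_apply_apply]
        exact congrArg Subtype.val this
    rw [Finset.sum_eq_single ⟨i₀, by omega⟩]
    · rw [if_pos ⟨(h1 _).2 rfl, hdv⟩, unitStep_apply_adj G hadj]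
      rw [Nat.sub_add_cancel hdv, Nat.sub_add_cancel hdw]
      have hv0 : (G.degree v : ℝ≥0) ≠ 0 := by positivity
      have hw0 : (G.degree w : ℝ≥0) ≠ 0 := by positivity
      have : ((G.degree v : ℝ≥0∞))⁻¹ * ((min (G.degree v) (G.degree w) : ℕ) * (G.degree w : ℝ≥0∞)⁻¹) =
          (((G.degree v : ℝ≥0)⁻¹ * ((min (G.degree v) (G.degree w) : ℕ) * (G.degree w : ℝ≥0)⁻¹) : ℝ≥0) : ℝ≥0∞) := by
        rw [ENNReal.coe_mul, ENNReal.coe_mul, ENNReal.coe_inv hv0, ENNReal.coe_inv hw0]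
        simp only [ENNReal.coe_natCast]
      rw [this]
      congr 1
      rcases le_total (G.degree v) (G.degree w) with hle | hle
      · have hle' : (G.degree v : ℝ≥0) ≤ G.degree w := by exact_mod_cast hle
        rw [min_eq_left hle, min_eq_right (by gcongr)]
        field_simp
      · have hle' : (G.degree w : ℝ≥0) ≤ G.degree v := by exact_mod_cast hle
        rw [min_eq_right hle, min_eq_left (by gcongr)]
        field_simp
    · intro i _ hi
      rw [if_neg (fun h => hi ((h1 i).1 h.1)), mul_zero]
    · intro h; exact absurd (Finset.mem_univ _) h
  · rw [unitStep_apply_of_not_adj G hadj hw]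
    refine Finset.sum_eq_zero fun i _ => ?_
    rw [if_neg, mul_zero]
    rintro ⟨h, hdv⟩
    have hi : (i : ℕ) < G.degree v := by omega
    rw [nbrOr, dif_pos hi] at h
    have := ((port v).symm ⟨i, hi⟩).2
    rw [h] at this
    exact hadj this

theorem tri_walkStepCmd (hW : n ≤ W)
    (hone : σ 1 = 1) (hinv : MemInv W Q σ) {v : Fin n} (h17 : σ 17 = v) :
    Tri (ustconInput G port s t p) (MemInv W Q) walkStepCmd σ 9 (unitStep G v) fun u σ' =>
      σ' 17 = (u : ℕ) ∧ (∀ x, x < 17 ∨ x = 18 ∨ 32 ≤ x → σ' x = σ x) ∧ MemInv W Q σ' := by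
  have hdeg : ∀ v : Fin n, G.degree v ≤ W := fun v => by
    have := G.degree_lt_card_verts v
    rw [Fintype.card_fin] at this; omega
  have hIdeg : ∀ v : Fin n, (ustconInput G port s t p).deg v = G.degree v := by
    intro v; simp [ustconInput]
  have hInbr : ∀ (v : Fin n) (i : ℕ), (ustconInput G port s t p).nbr v i = nbrOr G port v i := by
    intro v i
    simp only [ustconInput, nbrOr, v.2, dif_pos, Fin.eta]
    split_ifs <;> rfl
  rw [← stepDist_eq G port, stepDist]
  refine (Tri.seq_pure (a := ()) (B := 2) (B' := 7) (R := fun _ σ' =>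
    (∀ y, y ≠ 19 → y ≠ 20 → σ' y = σ y) ∧ σ' 19 = G.degree v ∧ σ' 20 = G.degree v - 1 ∧
      MemInv W Q σ') (Tri.ops hinv ?_) ?_)
  · have hd := hdeg v
    have i1 := hinv.reg (d := 19) (x := G.degree v) (by omega) hd
    have i2 := i1.reg (d := 20) (x := G.degree v - 1) (by omega) (by omega)
    simp [wp, Instr.eff, Finsupp.update_apply, h17, hIdeg, hone]
    exact ⟨i1, i2, fun y h1 h2 => by simp [h1, h2], i2⟩
  rintro σ₁ ⟨hs₁, g19, g20, hi₁⟩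
  have hd := hdeg v
  rw [← g20]
  refine (Tri.seq (B := 1) (B' := 6) (tri_rnd hi₁ fun x hx => hi₁.reg (by omega) (by omega)) ?_)
  rintro i hi σ₂ rfl
  replace hi := mem_support_unif hi
  have hi₂ : MemInv W Q (σ₁.update 20 i) := hi₁.reg (by omega) (by omega)
  have hdu := hdeg (nbrOr G port v i)
  refine (Tri.seq_pure (a := ()) (B := 3) (B' := 3) (R := fun _ σ' =>
    (∀ y, y < 17 ∨ y = 18 ∨ 32 ≤ y → σ' y = σ y) ∧ σ' 17 = v ∧ σ' 19 = G.degree v ∧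
      σ' 21 = nbrOr G port v i ∧ σ' 22 = G.degree (nbrOr G port v i) - 1 ∧
      MemInv W Q σ') (Tri.ops hi₂ ?_) ?_)
  · have i1 := hi₂.reg (d := 21) (x := nbrOr G port v i) (by omega) (by omega)
    have i2 := i1.reg (d := 22) (x := G.degree (nbrOr G port v i)) (by omega) (by omega)
    have i3 := i1.reg (d := 22) (x := G.degree (nbrOr G port v i) - 1) (by omega) (by omega)
    have f17 : σ₁ 17 = v := by rw [hs₁ 17 (by omega) (by omega), h17]
    have f1 : σ₁ 1 = 1 := by rw [hs₁ 1 (by omega) (by omega), hone]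
    simp [wp, Instr.eff, Finsupp.update_apply, f17, hInbr, hIdeg, f1, g19]
    refine ⟨i1, i2, i3, fun y hy => ?_, i3⟩
    rw [if_neg (by omega), if_neg (by omega), if_neg (by omega), if_neg (by omega),
      hs₁ y (by omega) (by omega)]
  rintro σ₃ ⟨hs₃, e17, e19, e21, e22, hi₃⟩
  rw [← e22]
  refine (Tri.seq (B := 1) (B' := 2) (tri_rnd hi₃ fun x hx => hi₃.reg (by omega) (by omega)) ?_)
  rintro j hjm σ₄ rfl
  replace hjm := mem_support_unif hjm
  have hi₄ : MemInv W Q (σ₃.update 22 j) := hi₃.reg (by omega) (by omega)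
  by_cases hj : (j : ℕ) < G.degree v
  · refine Tri.ite_pos (B := 1) (by simp [Finsupp.update_apply, e19, hj]) hi₄ (Tri.ops hi₄ ?_)
    have i1 := hi₄.reg (d := 17) (x := nbrOr G port v i) (by omega) (by omega)
    simp [wp, Instr.eff, Finsupp.update_apply, e21, hj]
    refine ⟨i1, fun y hy => ?_, i1⟩
    rw [if_neg (by omega), if_neg (by omega), hs₃ y hy]
  · refine Tri.ite_neg (by simp [Finsupp.update_apply, e19, hj]) hi₄ ?_
    simp [Finsupp.update_apply, e17, hj]
    refine ⟨fun y hy => ?_, hi₄⟩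
    rw [if_neg (by omega), hs₃ y hy]

end RAM

/-! ### Walks and rounds -/

section Discover

variable {V : Type} [Fintype V] [DecidableEq V] (G : SimpleGraph V) [DecidableRel G.Adj]

theorem discover_append (L : List V) (τ : ℕ) (a b : List V) :
    discover G L τ (a ++ b) =
      (discover G L τ a).bind fun D => (discover G L τ b).map fun D' => D ∪ D' := by
  induction a with
  | nil => simp only [List.nil_append, discover, PMF.pure_bind, Set.empty_union]; exact (PMF.map_id _).symm
  | cons l a ih =>
    rw [List.cons_append, discover, ih, discover, PMF.bind_bind]
    congr 1
    funext X
    rw [PMF.map_bind, PMF.bind_map]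
    congr 1
    funext D
    rw [PMF.map_comp]
    simp only [Function.comp_def, Set.union_assoc]

end Discover

namespace RAM

variable {n p ℓ τ W Q : ℕ} {s t : Fin n} {L : List (Fin n)} {D : Set (Fin n × Fin n)} {σ σ' : Mem}

variable (G : SimpleGraph (Fin n)) [DecidableRel G.Adj]
  (port : ∀ v : Fin n, G.neighborSet v ≃ Fin (G.degree v))

/-- One step of a walk from the landmark `l`, with the bookkeeping of discovered pairs. -/
def walkBody (L : List (Fin n)) (l : Fin n) (x : Fin n × Set (Fin n × Fin n)) :
    PMF (Fin n × Set (Fin n × Fin n)) :=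
  (unitStep G x.1).bind fun u => PMF.pure (u, x.2 ∪ {q | q.1 = l ∧ q.2 = u ∧ q.2 ∈ L})

/-- The program merges while it walks, whereas `mhWalk` first produces the whole path; both give the
same set of pairs. -/
theorem loopDist_walkBody (L : List (Fin n)) (l : Fin n) (k i : ℕ)
    (x : Fin n × Set (Fin n × Fin n)) :
    (loopDist (fun _ => walkBody G L l) k i x).map Prod.snd =
      (mhWalk G k x.1).map fun X => x.2 ∪ {q | q.1 = l ∧ q.2 ∈ X ∧ q.2 ∈ L} := by
  induction k generalizing i x with
  | zero =>
    simp only [loopDist, mhWalk, PMF.pure_map, List.not_mem_nil, false_and, and_false]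
    congr 1
    ext q; simp
  | succ k ih =>
    rw [loopDist, mhWalk, walkBody, PMF.bind_bind, PMF.map_bind, PMF.map_bind]
    congr 1
    funext u
    rw [PMF.pure_bind, ih, PMF.map_comp]
    congr 1
    funext X
    ext q
    simp only [Function.comp_apply, Set.mem_union, Set.mem_ofPred_eq, List.mem_cons]
    tauto

/-- The memory between two walks: the constants, a landmark counter and the discovered pairs. -/
structure Between {n : ℕ} (p ℓ τ W Q : ℕ) (s t : Fin n) (L : List (Fin n))
    (D : Set (Fin n × Fin n)) (σ : Mem) : Prop where
  consts : Consts p ℓ τ s t σ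
  repr : Repr ℓ L D σ
  inv : MemInv W Q σ

theorem tri_walkCmd (hℓ : n ≤ 2 ^ ℓ) (hℓW : ℓ < W) (hτW : τ < W) (hpW : addr (p + 2) + 2 ≤ W)
    (hW : ∀ v : Fin n, addr v + 2 ≤ W) (hnW : n ≤ W) (h : Between p ℓ τ W Q s t L D σ)
    {i : ℕ} (h14 : σ 14 = i) (hi : i < L.length) (hLp : L.length ≤ p + 2) :
    Tri (ustconInput G port s t p) (MemInv W Q) walkCmd σ (τ * (8 * ℓ + 43) + 11)
      ((mhWalk G τ L[i]).map fun X => D ∪ {q | q.1 = L[i] ∧ q.2 ∈ X ∧ q.2 ∈ L}) fun D' σ' =>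
        (∀ y < 14, σ' y = σ y) ∧ σ' 14 = i + 1 ∧ Between p ℓ τ W Q s t L D' σ' := by
  obtain ⟨hc, hr, hinv⟩ := h
  set l := L[i] with hl
  have hlL : l ∈ L := List.getElem_mem hi
  have haddr : ∀ v : ℕ, addr v = v + v + v + 32 := by intro v; unfold addr; omega
  have hiW : addr i + 2 ≤ W := by unfold addr at hpW ⊢; omega
  have hlist : σ (addr i + 2) = l := by
    obtain ⟨par, sz, ha, -⟩ := hr
    exact ha.list i hi
  refine (Tri.seq_pure (a := ()) (B := 8) (B' := τ * (8 * ℓ + 43) + 3) (R := fun _ σ' =>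
    (∀ y, y < 15 ∨ 32 ≤ y → σ' y = σ y) ∧ σ' 16 = l ∧ σ' 17 = l ∧ σ' 18 = 0 ∧ MemInv W Q σ')
    (Tri.ops hinv ?_) ?_).mono (by omega) fun _ _ _ h _ => h
  · have hlW : (l : ℕ) ≤ W := by omega
    have i1 := hinv.reg (d := 15) (x := i + i) (by omega) (by unfold addr at hiW; omega)
    have i2 := hinv.reg (d := 15) (x := i + i + i) (by omega) (by unfold addr at hiW; omega)
    have i3 := hinv.reg (d := 15) (x := addr i) (by omega) (by omega)
    have i4 := hinv.reg (d := 15) (x := addr i + 1) (by omega) (by omega)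
    have i5 := hinv.reg (d := 15) (x := addr i + 2) (by omega) (by omega)
    have i6 := i5.reg (d := 16) (x := l) (by omega) hlW
    have i7 := i6.reg (d := 17) (x := l) (by omega) hlW
    have i8 := i7.reg (d := 18) (x := 0) (by omega) (by omega)
    have ne : addr i ≠ 13 := by unfold addr; omega
    simp [wp, Instr.eff, Finsupp.update_apply, h14, hc.c10, hc.c1, ← haddr, hlist, ne]
    refine ⟨i1, i2, i3, i4, i5, i6, i7, i8, fun y hy => ?_, i8⟩
    split_ifs <;> omega
  rintro σ₁ ⟨hs₁, g16, g17, g18, hi₁⟩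
  rw [← loopDist_walkBody G L l τ 0 (l, D)]
  have hloop : Tri (ustconInput G port s t p) (MemInv W Q)
      (.loop 18 7 (walkStepCmd ;; checkCmd ;; .ops [.add 18 18 1])) σ₁
      (τ * ((8 * ℓ + 41) + 2) + 2) (loopDist (fun _ => walkBody G L l) τ 0 (l, D))
      (fun x σ' => (∀ y < 15, σ' y = σ y) ∧ σ' 16 = l ∧ σ' 17 = (x.1 : ℕ) ∧ σ' 18 = τ ∧
        Repr ℓ L x.2 σ' ∧ MemInv W Q σ') := by
    refine Tri.loop (N := τ) (R := fun k x σ' => (∀ y < 15, σ' y = σ y) ∧ σ' 16 = l ∧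
      σ' 17 = (x.1 : ℕ) ∧ σ' 18 = k ∧ Repr ℓ L x.2 σ' ∧ MemInv W Q σ')
      (fun _ _ _ h => h.2.2.2.2.2) ?_ ?_ τ (i := 0) (x := (l, D)) (by omega) ?_
    · rintro k x τ' - ⟨h1, -, -, h2, -⟩
      rw [h2, h1 7 (by omega), hc.c7]
    · rintro k ⟨u, D'⟩ σ₂ hk ⟨h1, h2, h3, h4, h5, h6⟩
      have hc₂ : Consts p ℓ τ s t σ₂ := hc.of_agree fun y hy => h1 y (by omega)
      refine (Tri.seq (B := 9) (B' := 8 * ℓ + 32) (tri_walkStepCmd G port hnW hc₂.c1 h6 h3)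
        ?_).mono (by omega) fun _ _ _ h _ => h
      rintro w - σ₃ ⟨e17, hs₃, hi₃⟩
      have hc₃ : Consts p ℓ τ s t σ₃ := hc₂.of_agree fun y hy => hs₃ y (by omega)
      refine (Tri.seq_pure (a := ()) (B' := 1) (tri_checkCmd hℓ hℓW hW hnW hc₃ hi₃
        (h5.of_agree fun y hy => hs₃ y (by omega)) hlL
        (by rw [hs₃ 16 (by omega), h2]) e17) ?_)
      rintro σ₄ ⟨hs₄, hr₄, hi₄⟩
      refine Tri.ops hi₄ ?_
      have k1 : σ₄ 1 = 1 := by rw [hs₄ 1 (by omega), hc₃.c1]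
      have k18 : σ₄ 18 = k := by rw [hs₄ 18 (by omega), hs₃ 18 (by omega), h4]
      have k16 : σ₄ 16 = l := by rw [hs₄ 16 (by omega), hs₃ 16 (by omega), h2]
      have k17 : σ₄ 17 = w := by rw [hs₄ 17 (by omega), e17]
      have i1 := hi₄.reg (d := 18) (x := k + 1) (by omega) (by omega)
      simp [wp, Instr.eff, Finsupp.update_apply, k1, k18, k16, k17]
      refine ⟨i1, fun y hy => ?_, hr₄.of_agree fun y hy => ?_, i1⟩
      · rw [if_neg (by omega), hs₄ y (by omega), hs₃ y (by omega), h1 y hy]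
      · rw [Finsupp.update_apply, if_neg (by omega)]
    · exact ⟨fun y hy => hs₁ y (by omega), g16, g17, g18, hr.of_agree fun y hy => hs₁ y (by omega),
        hi₁⟩
  rw [show ∀ q : PMF (Fin n × Set (Fin n × Fin n)), q.map Prod.snd =
    q.bind fun x => PMF.pure x.2 from fun q => rfl]
  refine (Tri.seq (B' := 1) hloop ?_).mono (by ring_nf; omega) fun _ _ _ h _ => h
  rintro ⟨u, D'⟩ - σ₂ ⟨h1, -, -, -, h5, h6⟩
  refine Tri.ops h6 ?_
  have k1 : σ₂ 1 = 1 := by rw [h1 1 (by omega), hc.c1]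
  have k14 : σ₂ 14 = i := by rw [h1 14 (by omega), h14]
  have i1 := h6.reg (d := 14) (x := i + 1) (by omega) (by unfold addr at hpW; omega)
  simp [wp, Instr.eff, Finsupp.update_apply, k1, k14]
  refine ⟨i1, fun y hy => ?_, hc.of_agree fun y hy => ?_, h5.of_agree fun y hy => ?_, i1⟩
  · rw [if_neg (by omega), h1 y (by omega)]
  · rw [Finsupp.update_apply, if_neg (by omega), h1 y (by omega)]
  · rw [Finsupp.update_apply, if_neg (by omega)]

/-- One walk from the `i`-th landmark. -/
def landmarkWalk (τ : ℕ) (L : List (Fin n)) (i : ℕ) (D : Set (Fin n × Fin n)) :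
    PMF (Set (Fin n × Fin n)) :=
  if hi : i < L.length then
    (mhWalk G τ L[i]).map fun X => D ∪ {q | q.1 = L[i] ∧ q.2 ∈ X ∧ q.2 ∈ L}
  else PMF.pure D

theorem loopDist_landmarkWalk (τ : ℕ) (L : List (Fin n)) (k i : ℕ) (h : i + k = L.length)
    (D : Set (Fin n × Fin n)) :
    loopDist (landmarkWalk G τ L) k i D =
      (discover G L τ (L.drop i)).map fun D' => D ∪ D' := by
  induction k generalizing i D with
  | zero =>
    rw [List.drop_of_length_le (by omega), discover, PMF.pure_map, Set.union_empty, loopDist]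
  | succ k ih =>
    rw [loopDist, landmarkWalk, dif_pos (by omega), List.drop_eq_getElem_cons (by omega), discover,
      PMF.map_bind, PMF.bind_map]
    congr 1
    funext X
    rw [Function.comp_apply, ih (i + 1) (by omega), PMF.map_comp]
    simp only [Function.comp_def, Set.union_assoc]

theorem loopDist_rounds (τ : ℕ) (L : List (Fin n)) (k i : ℕ) (D : Set (Fin n × Fin n)) :
    loopDist (fun _ D => (discover G L τ L).map fun D' => D ∪ D') k i D =
      (discover G L τ (List.replicate k L).flatten).map fun D' => D ∪ D' := by
  induction k generalizing i D with
  | zero =>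
    rw [List.replicate_zero, List.flatten_nil, discover, PMF.pure_map, Set.union_empty, loopDist]
  | succ k ih =>
    rw [loopDist, List.replicate_succ, List.flatten_cons, discover_append, PMF.map_bind,
      PMF.bind_map]
    congr 1
    funext D'
    rw [Function.comp_apply, ih, PMF.map_comp]
    simp only [Function.comp_def, Set.union_assoc]

theorem tri_roundsCmd (hℓ : n ≤ 2 ^ ℓ) (hℓW : 72 * ℓ < W) (hτW : τ < W) (hpW : addr (p + 2) + 2 ≤ W)
    (hW : ∀ v : Fin n, addr v + 2 ≤ W) (hnW : n ≤ W) (h : Between p ℓ τ W Q s t L ∅ σ)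
    (hLp : L.length = p + 2) :
    Tri (ustconInput G port s t p) (MemInv W Q) roundsCmd σ
      (72 * ℓ * ((p + 2) * (τ * (8 * ℓ + 43) + 13) + 6) + 3)
      (discover G L τ (List.replicate (72 * ℓ) L).flatten) fun D' σ' =>
        Between p ℓ τ W Q s t L D' σ' := by
  refine (Tri.seq_pure (a := ()) (B := 1)
    (B' := 72 * ℓ * (((p + 2) * ((τ * (8 * ℓ + 43) + 11) + 2) + 4) + 2) + 2) (R := fun _ σ' =>
    Between p ℓ τ W Q s t L ∅ σ' ∧ σ' 13 = 0) (Tri.ops h.inv ?_) ?_).mono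
    (by ring_nf; omega) fun _ _ _ h _ => h
  · have i1 := h.inv.reg (d := 13) (x := 0) (by omega) (by omega)
    simp [wp, Instr.eff, Finsupp.update_apply]
    refine ⟨i1, h.consts.of_agree fun y hy => ?_, h.repr.of_agree fun y hy => ?_, i1⟩ <;>
      rw [Finsupp.update_apply, if_neg (by omega)]
  rintro σ₁ ⟨h₁, g13⟩
  have heq : discover G L τ (List.replicate (72 * ℓ) L).flatten =
      loopDist (fun _ D => (discover G L τ L).map fun D' => D ∪ D') (72 * ℓ) 0 ∅ := by
    rw [loopDist_rounds]
    simp only [Set.empty_union]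
    exact (PMF.map_id _).symm
  rw [heq]
  refine (Tri.loop (N := 72 * ℓ) (R := fun r D σ' => Between p ℓ τ W Q s t L D σ' ∧ σ' 13 = r)
    (fun _ _ _ h => h.1.inv) ?_ ?_ (72 * ℓ) (by omega) ⟨h₁, g13⟩).mono le_rfl
    fun _ _ _ h _ => h.1
  · rintro r D σ₂ - ⟨h1, h2⟩
    rw [h2, h1.consts.c9]
  rintro r D σ₂ hr ⟨h₂, e13⟩
  refine (Tri.seq_pure (a := ()) (B := 1) (B' := (p + 2) * ((τ * (8 * ℓ + 43) + 11) + 2) + 3)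
    (R := fun _ σ' => Between p ℓ τ W Q s t L D σ' ∧ σ' 13 = r ∧ σ' 14 = 0)
    (Tri.ops h₂.inv ?_) ?_).mono (by omega) fun _ _ _ h _ => h
  · have i1 := h₂.inv.reg (d := 14) (x := 0) (by omega) (by omega)
    simp [wp, Instr.eff, Finsupp.update_apply, e13]
    refine ⟨i1, h₂.consts.of_agree fun y hy => ?_, h₂.repr.of_agree fun y hy => ?_, i1⟩ <;>
      rw [Finsupp.update_apply, if_neg (by omega)]
  rintro σ₃ ⟨h₃, f13, f14⟩
  have heq : (discover G L τ L).map (fun D' => D ∪ D') =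
      loopDist (landmarkWalk G τ L) (p + 2) 0 D := by
    rw [loopDist_landmarkWalk G τ L _ _ (by omega), List.drop_zero]
  rw [heq, ← PMF.bind_pure (loopDist (landmarkWalk G τ L) (p + 2) 0 D)]
  refine (Tri.seq (B := (p + 2) * ((τ * (8 * ℓ + 43) + 11) + 2) + 2) (B' := 1)
    (Tri.loop (N := p + 2) (R := fun i D σ' =>
    Between p ℓ τ W Q s t L D σ' ∧ σ' 13 = r ∧ σ' 14 = i)
    (fun _ _ _ h => h.1.inv) ?_ ?_ (p + 2) (by omega) ⟨h₃, f13, f14⟩) ?_).mono (by omega)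
    fun _ _ _ h _ => h
  · rintro i D σ₂ - ⟨h1, -, h2⟩
    rw [h2, h1.consts.c8]
  · rintro i D σ₂ hi ⟨h1, h2, h3⟩
    rw [landmarkWalk, dif_pos (by omega)]
    refine (tri_walkCmd G port hℓ (by omega) hτW hpW hW hnW h1 h3 (by omega) (by omega)).mono le_rfl ?_
    rintro D' - σ₄ ⟨k1, k2, k3⟩ -
    exact ⟨k3, by rw [k1 13 (by omega), h2], k2⟩
  · rintro D' - σ₄ ⟨h₄, k13, -⟩
    refine Tri.ops h₄.inv ?_
    have i1 := h₄.inv.reg (d := 13) (x := r + 1) (by omega) (by omega)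
    simp [wp, Instr.eff, Finsupp.update_apply, k13, h₄.consts.c1]
    refine ⟨i1, h₄.consts.of_agree fun y hy => ?_, h₄.repr.of_agree fun y hy => ?_, i1⟩ <;>
      rw [Finsupp.update_apply, if_neg (by omega)]

end RAM

/-! ### Landmarks -/

namespace RAM

section Uniform

variable {V : Type} [Fintype V] [Nonempty V]

/-- Append a uniformly random node. -/
def appendUniform (xs : List V) : PMF (List V) :=
  (PMF.uniformOfFintype V).map fun v => xs ++ [v]

theorem uniformOfFintype_succ (k : ℕ) :
    (PMF.uniformOfFintype (Fin (k + 1) → V)) = (PMF.uniformOfFintype V).bind fun v =>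
      (PMF.uniformOfFintype (Fin k → V)).map fun g => Fin.cons v g := by
  classical
  ext f
  rw [PMF.bind_apply, tsum_fintype, Finset.sum_eq_single (f 0)]
  · rw [PMF.map_apply, tsum_fintype, Finset.sum_eq_single (Fin.tail f)]
    · rw [Fin.cons_self_tail, if_pos rfl]
      simp only [PMF.uniformOfFintype_apply, Fintype.card_pi, Finset.prod_const, Finset.card_univ,
        Fintype.card_fin, Nat.cast_pow]
      rw [pow_succ', ENNReal.mul_inv (.inr (by finiteness)) (.inl (by finiteness))]
    · intro g _ hg
      rw [if_neg]
      intro hf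
      exact hg (by rw [hf, Fin.tail_cons])
    · simp
  · intro v _ hv
    rw [PMF.map_apply, mul_eq_zero]
    right
    rw [ENNReal.tsum_eq_zero]
    intro g
    rw [if_neg]
    rintro rfl
    exact hv (by simp)
  · simp

/-- Drawing the landmarks one after the other is a uniform choice of the whole function. -/
theorem loopDist_appendUniform (k i : ℕ) (xs : List V) :
    loopDist (fun _ => appendUniform) k i xs =
      (PMF.uniformOfFintype (Fin k → V)).map fun g => xs ++ List.ofFn g := by
  induction k generalizing i xs with
  | zero =>
    simp only [loopDist, List.ofFn_zero, List.append_nil]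
    exact (PMF.map_const _ _).symm
  | succ k ih =>
    rw [loopDist, appendUniform, PMF.bind_map, uniformOfFintype_succ, PMF.map_bind]
    congr 1
    funext v
    rw [Function.comp_apply, ih, PMF.map_comp]
    congr 1
    funext g
    simp [List.ofFn_succ]

end Uniform

variable {n p ℓ τ W Q : ℕ} {s t : Fin n} {L xs : List (Fin n)} {D : Set (Fin n × Fin n)}
  {σ σ' : Mem}

theorem MemInv.mono {Q' : ℕ} (h : MemInv W Q σ) (hQ : Q ≤ Q') : MemInv W Q' σ := by
  obtain ⟨h1, S, h2, h3⟩ := h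
  exact ⟨h1, S, h2.trans hQ, h3⟩

theorem MemInv.grow (h : MemInv W Q σ) {d x : ℕ} (hd : d ≤ W) (hx : x ≤ W) :
    MemInv W (Q + 1) (σ.update d x) := by
  obtain ⟨h1, S, h2, h3, h4⟩ := h
  refine ⟨fun a => ?_, insert d S, (Finset.card_insert_le _ _).trans (by omega), ?_, fun a ha => ?_⟩
  · rw [Finsupp.update_apply]; split_ifs <;> simp_all
  · intro a ha
    rcases Finset.mem_insert.1 ha with rfl | ha
    · exact hd
    · exact h3 a ha
  · rw [Finsupp.update_apply, Finset.mem_insert]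
    split_ifs with hda
    · exact fun _ => .inl hda
    · exact fun h => .inr (h4 a ha h)

/-- The memory while the list `xs` of landmarks is being made. -/
structure Gen {n : ℕ} (p ℓ τ W : ℕ) (s t : Fin n) (xs : List (Fin n)) (σ : Mem) : Prop where
  consts : Consts p ℓ τ s t σ
  len : σ 12 = xs.length
  arrays : Arrays xs id (fun _ => 1) σ
  inv : MemInv W (3 * xs.length) σ

/-- Landmarks may repeat. A repeated node gets the same pointer and size again, and only its slot in
the list is new. Each insertion writes three array cells, which explains `3 * xs.length` in `Gen`.
-/
theorem tri_insertCmd {I : Input} (hpW : addr (p + 2) + 2 ≤ W) (hW : ∀ v : Fin n, addr v + 2 ≤ W)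
    (h : Gen p ℓ τ W s t xs σ) (hlen : xs.length < p + 2) {v : Fin n} (h14 : σ 14 = v) :
    Tri I (MemInv W (3 * (p + 2))) insertCmd σ 13 (PMF.pure ()) fun _ σ' =>
      Gen p ℓ τ W s t (xs ++ [v]) σ' := by
  obtain ⟨hc, h12, ha, hinv⟩ := h
  have hWv := hW v
  have hxW : addr xs.length + 2 ≤ W := by unfold addr at hpW ⊢; omega
  have haddr : ∀ v : ℕ, addr v = v + v + v + 32 := by intro v; unfold addr; omega
  have hvd := haddr v
  have hld := haddr xs.length
  refine Tri.ops (hinv.mono (by omega)) ?_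
  have i1 := hinv.reg (d := 15) (x := v + v) (by omega) (by omega)
  have i2 := hinv.reg (d := 15) (x := v + v + v) (by omega) (by omega)
  have i3 := hinv.reg (d := 15) (x := addr v) (by omega) (by omega)
  have i4 := i3.grow (d := addr v) (x := addr v) (by omega) (by omega)
  have i5 := i4.reg (d := 16) (x := addr v + 1) (by omega) (by omega)
  have i6 := i5.grow (d := addr v + 1) (x := 1) (by omega) (by omega)
  have i7 := i6.reg (d := 15) (x := xs.length + xs.length) (by omega) (by omega)
  have i8 := i6.reg (d := 15) (x := xs.length + xs.length + xs.length) (by omega) (by omega)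
  have i9 := i6.reg (d := 15) (x := addr xs.length) (by omega) (by omega)
  have i10 := i6.reg (d := 15) (x := addr xs.length + 1) (by omega) (by omega)
  have i11 := i6.reg (d := 15) (x := addr xs.length + 2) (by omega) (by omega)
  have i12 := i11.grow (d := addr xs.length + 2) (x := v) (by omega) (by omega)
  have i13 := i12.reg (d := 12) (x := xs.length + 1) (by omega) (by omega)
  set τ1 := (((((σ.update 15 (addr v)).update (addr v) (addr v)).update 16 (addr v + 1)).update
    (addr v + 1) 1).update 15 (addr xs.length + 2)).update (addr xs.length + 2) v with hτ1
  have hcode : wp I (MemInv W (3 * (p + 2))) [.add 15 14 14, .add 15 15 14, .add 15 15 10,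
      .store 15 15, .add 16 15 1, .store 16 1,
      .add 15 12 12, .add 15 15 12, .add 15 15 10, .add 15 15 1, .add 15 15 1, .store 15 14,
      .add 12 12 1] σ fun σ' => σ' = τ1.update 12 (xs.length + 1) := by
    have m3 : ∀ k < 30, addr xs.length ≠ k := by intro k hk; omega
    have m4 : ∀ k < 32, k ≠ addr v := by intro k hk; omega
    have m5 : ∀ k < 32, k ≠ addr v + 1 := by intro k hk; omega
    have m6 : ∀ k < 32, k ≠ addr xs.length + 2 := by intro k hk; omega
    simp [wp, Instr.eff, Finsupp.update_apply, h14, hc.c10, hc.c1, ← haddr, h12, m3, m4,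
      m5, m6]
    exact ⟨i1.mono (by omega), i2.mono (by omega), i3.mono (by omega), i4.mono (by omega),
      i5.mono (by omega), i6.mono (by omega), i7.mono (by omega), i8.mono (by omega),
      i9.mono (by omega), i10.mono (by omega), i11.mono (by omega), i12.mono (by omega),
      i13.mono (by omega), rfl⟩
  have hwp : ∀ (l : List Instr) (σ : Mem) (Q Q' : Mem → Prop), (∀ σ, Q σ → Q' σ) →
      wp I (MemInv W (3 * (p + 2))) l σ Q → wp I (MemInv W (3 * (p + 2))) l σ Q' := by
    intro l
    induction l with
    | nil => intro σ Q Q' h hw; exact h _ hw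
    | cons i l ih =>
      rintro σ Q Q' h ⟨d, x, h1, h2, h3⟩
      exact ⟨d, x, h1, h2, ih _ _ _ h h3⟩
  refine hwp _ _ _ _ ?_ hcode
  rintro _ rfl
  have hval : ∀ y, (τ1.update 12 (xs.length + 1)) y = if y = 12 then xs.length + 1 else
      if y = addr xs.length + 2 then (v : ℕ) else if y = 15 then addr xs.length + 2 else
      if y = addr v + 1 then 1 else if y = 16 then addr v + 1 else if y = addr v then addr v else
      if y = 15 then addr v else σ y := by
    intro y
    rw [hτ1]
    simp only [Finsupp.update_apply]
  constructor
  · refine hc.of_agree fun y hy => ?_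
    rw [hval, if_neg (by omega), if_neg (by omega), if_neg (by omega), if_neg (by omega),
      if_neg (by omega), if_neg (by omega), if_neg (by omega)]
  · rw [hval, if_pos rfl, List.length_append, List.length_singleton]
  · constructor
    · intro i hi
      rw [List.length_append, List.length_singleton] at hi
      rw [hval, if_neg (by unfold addr; omega)]
      by_cases hil : i = xs.length
      · subst hil; simp
      · have hia := haddr i
        rw [if_neg (by omega), if_neg (by omega), if_neg (by omega), if_neg (by omega),
          if_neg (by omega), if_neg (by omega), ha.list i (by omega),
          List.getElem_append_left (by omega)]
    · intro w hw
      have hwa := haddr w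
      rw [hval, if_neg (by omega), if_neg (by omega), if_neg (by omega), if_neg (by omega),
        if_neg (by omega)]
      by_cases hwv : w = v
      · subst hwv; simp
      · have : (w : ℕ) ≠ v := fun h => hwv (Fin.ext h)
        rw [if_neg (by omega), if_neg (by omega), ha.par w (by simpa [hwv] using hw)]
    · intro w hw
      rw [List.mem_append, not_or, List.mem_singleton] at hw
      have hwa := haddr w
      have : (w : ℕ) ≠ v := fun h => hw.2 (Fin.ext h)
      rw [hval, if_neg (by omega), if_neg (by omega), if_neg (by omega), if_neg (by omega),
        if_neg (by omega), if_neg (by omega), if_neg (by omega), ha.zero w hw.1]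
    · intro w hw
      have hwa := haddr w
      rw [hval, if_neg (by omega), if_neg (by omega), if_neg (by omega)]
      by_cases hwv : w = v
      · subst hwv; simp
      · have : (w : ℕ) ≠ v := fun h => hwv (Fin.ext h)
        rw [if_neg (by omega), if_neg (by omega), if_neg (by omega), if_neg (by omega),
          ha.size w (by simpa [hwv] using hw)]
  · refine i13.mono ?_
    rw [List.length_append, List.length_singleton]; omega

theorem Gen.reg_update (h : Gen p ℓ τ W s t xs σ) {d x : ℕ} (hd : d < 32) (hd' : 12 < d)
    (hx : x ≤ W) : Gen p ℓ τ W s t xs (σ.update d x) where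
  consts := h.consts.of_agree fun y hy => by rw [Finsupp.update_apply, if_neg (by omega)]
  len := by rw [Finsupp.update_apply, if_neg (by omega), h.len]
  arrays := h.arrays.of_agree fun y hy => by rw [Finsupp.update_apply, if_neg (by omega)]
  inv := h.inv.reg hd hx

theorem Gen.between (h : Gen p ℓ τ W s t L σ) (hL : L.length = p + 2) :
    Between p ℓ τ W (3 * (p + 2)) s t L ∅ σ where
  consts := h.consts
  inv := hL ▸ h.inv
  repr := by
    refine ⟨_, _, h.arrays, ?_⟩
    have hn : 1 ≤ n := s.pos
    have hid : ∀ v : Fin n, id^[ℓ] v = v := fun v => by rw [Function.iterate_id]; rfl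
    refine ⟨fun v hv => hv, fun _ _ => le_rfl, fun _ _ => hn, fun v _ h => absurd rfl h, ?_,
      fun q hq => absurd hq (Set.notMem_empty q), fun v _ w _ => ?_⟩
    -- The sum runs over distinct landmarks, so it is bounded by `n` even if `p` is much larger.
    · rw [Finset.sum_const, smul_eq_mul, mul_one]
      exact (Finset.card_le_univ _).trans (by simp)
    · rw [hid, hid]
      constructor
      · intro hvw
        rcases UnionFind.eqvGen_mem (L := L) (f := id) (D := ∅)
          (fun q hq => absurd hq (Set.notMem_empty q)) (fun q hq => absurd hq (Set.notMem_empty q))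
          hvw with h | ⟨-, -, h⟩ <;> exact h
      · rintro rfl
        exact .refl _

theorem unif_eq_append [NeZero n] (xs : List (Fin n)) :
    ((unif (n - 1)).bind fun x => PMF.pure (xs ++ [Fin.ofNat n x])) = appendUniform xs := by
  obtain ⟨m, rfl⟩ : ∃ m, n = m + 1 := ⟨n - 1, by have := NeZero.ne n; omega⟩
  rw [unif, PMF.bind_map, appendUniform, PMF.map]
  congr 1
  funext x
  simp [Function.comp_apply]

theorem tri_landmarksCmd {I : Input} [NeZero n] (hpW : addr (p + 2) + 2 ≤ W)
    (hW : ∀ v : Fin n, addr v + 2 ≤ W) (hnW : n ≤ W) (hc : Consts p ℓ τ s t σ)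
    (hzero : ∀ y, 32 ≤ y → σ y = 0) (hinv : MemInv W 0 σ) :
    Tri I (MemInv W (3 * (p + 2))) landmarksCmd σ (p * 16 + 31)
      ((PMF.uniformOfFintype (Fin p → Fin n)).map fun g => s :: t :: List.ofFn g)
      fun L σ' => L.length = p + 2 ∧ Between p ℓ τ W (3 * (p + 2)) s t L ∅ σ' := by
  have hsW : (s : ℕ) ≤ W := by omega
  have htW : (t : ℕ) ≤ W := by omega
  refine (Tri.seq_pure (a := ()) (B := 2) (B' := p * 16 + 29) (R := fun _ σ' =>
    Gen p ℓ τ W s t [] σ' ∧ σ' 14 = s) (Tri.ops (hinv.mono (by omega)) ?_) ?_).mono (by omega)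
    fun _ _ _ h _ => h
  · have i1 := hinv.reg (d := 12) (x := 0) (by omega) (by omega)
    have i2 := i1.reg (d := 14) (x := s) (by omega) hsW
    simp [wp, Instr.eff, Finsupp.update_apply, hc.c3]
    refine ⟨i1.mono (by omega), i2.mono (by omega), ?_⟩
    constructor
    · refine hc.of_agree fun y hy => ?_
      rw [Finsupp.update_apply, if_neg (by omega), Finsupp.update_apply, if_neg (by omega)]
    · simp [Finsupp.update_apply]
    · constructor
      · intro i hi; simp at hi
      · intro v hv; simp at hv
      · intro v hv
        rw [Finsupp.update_apply, if_neg (by unfold addr; omega), Finsupp.update_apply,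
          if_neg (by unfold addr; omega), hzero _ (by unfold addr; omega)]
      · intro v hv; simp at hv
    · exact i2
  rintro σ₁ ⟨h₁, e14⟩
  refine (Tri.seq_pure (a := ()) (B := 13) (B' := p * 16 + 16)
    (tri_insertCmd hpW hW h₁ (by simp) e14) ?_).mono (by omega) fun _ _ _ h _ => h
  intro σ₂ h₂
  refine (Tri.seq_pure (a := ()) (B := 1) (B' := p * 16 + 15) (R := fun _ σ' =>
    Gen p ℓ τ W s t [s] σ' ∧ σ' 14 = t) (Tri.ops (h₂.inv.mono (by simp)) ?_) ?_).mono (by omega)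
    fun _ _ _ h _ => h
  · have h := h₂.reg_update (d := 14) (x := t) (by omega) (by omega) htW
    simp [wp, Instr.eff, Finsupp.update_apply, h₂.consts.c4]
    exact ⟨h.inv.mono (by simp), h⟩
  rintro σ₃ ⟨h₃, f14⟩
  refine (Tri.seq_pure (a := ()) (B := 13) (B' := p * 16 + 2)
    (tri_insertCmd hpW hW h₃ (by simp) f14) ?_).mono (by omega) fun _ _ _ h _ => h
  intro σ₄ h₄
  have heq : ((PMF.uniformOfFintype (Fin p → Fin n)).map fun g => s :: t :: List.ofFn g) =
      loopDist (fun _ => appendUniform) p 2 ([s] ++ [t]) := by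
    rw [loopDist_appendUniform]; rfl
  rw [heq]
  refine (Tri.loop (N := p + 2) (B := 14) (R := fun i L σ' => L.length = i ∧ i ≤ p + 2 ∧ 
    Gen p ℓ τ W s t L σ') ?_ ?_ ?_ p (by omega) ⟨rfl, by omega, h₄⟩).mono (by omega)
    fun L _ σ' h _ => ⟨h.1, h.2.2.between h.1⟩
  · rintro i L σ' ⟨h1, h2, h3⟩
    exact h3.inv.mono (by omega)
  · rintro i L σ' - ⟨h1, -, h3⟩
    rw [h3.len, h3.consts.c8, h1]
  · rintro i L σ' hi ⟨h1, h2, h3⟩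
    rw [← unif_eq_append, ← h3.consts.c11]
    refine Tri.seq (B := 1) (B' := 13) (tri_rnd (h3.inv.mono (by omega)) fun x hx => ?_) ?_
    · rw [h3.consts.c11] at hx
      exact (h3.inv.reg (by omega) (by omega)).mono (by omega)
    · rintro x hx _ rfl
      replace hx := mem_support_unif hx
      rw [h3.consts.c11] at hx
      have hn : n ≠ 0 := NeZero.ne n
      refine (Tri.bind_pure (f := fun _ => L ++ [Fin.ofNat n x]) (tri_insertCmd (v := Fin.ofNat n x) hpW hW
        (h3.reg_update (d := 14) (x := x) (by omega) (by omega) (by omega)) (by omega) ?_) ?_)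
      · simp [Finsupp.update_apply, Nat.mod_eq_of_lt (show x < n by omega)]
      · intro σ' h
        refine ⟨by simp [h1], by omega, h⟩

end RAM

/-! ### Setup, comparison, and the whole program -/

namespace RAM

variable {n p ℓ τ W Q : ℕ} {s t : Fin n} {L xs : List (Fin n)} {D : Set (Fin n × Fin n)}
  {σ σ' : Mem}

/-- The part of the constants that is known from the start of the setup. -/
structure Base {n : ℕ} (p W : ℕ) (s t : Fin n) (σ : Mem) : Prop where
  c0 : σ 0 = 0
  c1 : σ 1 = 1
  c2 : σ 2 = n
  c3 : σ 3 = s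
  c4 : σ 4 = t
  c5 : σ 5 = p
  c10 : σ 10 = 32
  inv : MemInv W 0 σ

theorem Base.reg_update (h : Base p W s t σ) {d x : ℕ} (hd : d < 32) (hd' : 6 ≤ d) (hd10 : d ≠ 10)
    (hx : x ≤ W) : Base p W s t (σ.update d x) := by
  obtain ⟨h0, h1, h2, h3, h4, h5, h10, hinv⟩ := h
  constructor
  on_goal 8 => exact hinv.reg hd hx
  all_goals rw [Finsupp.update_apply, if_neg (by omega)]; assumption

theorem MemInv.eq_zero (h : MemInv W 0 σ) {y : ℕ} (hy : 32 ≤ y) : σ y = 0 := by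
  obtain ⟨-, S, h2, -, h4⟩ := h
  by_contra hne
  have := h4 y hy hne
  rw [Finset.card_eq_zero.1 (Nat.le_zero.1 h2)] at this
  simp at this

variable (G : SimpleGraph (Fin n)) [DecidableRel G.Adj]
  (port : ∀ v : Fin n, G.neighborSet v ≃ Fin (G.degree v))

theorem tri_setupCmd (hp : 1 ≤ p) (hW1 : 60 * n * Nat.clog 2 n + p ≤ W) (hW2 : 2 * n + 72 ≤ W)
    (hW3 : 72 * Nat.clog 2 n ≤ W) (hW4 : p + 2 ≤ W) (hW5 : nPCeil n p G.maxDegree ^ 2 ≤ W) :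
    Tri (ustconInput G port s t p) (MemInv W Q) setupCmd 0 (4 * Nat.clog 2 n + 6 * n + 25)
      (PMF.pure ()) fun _ σ' =>
        Consts p (Nat.clog 2 n) (nPCeil n p G.maxDegree ^ 2) s t σ' ∧ MemInv W 0 σ' := by
  have hn : 1 ≤ n := s.pos
  have hdeg : ∀ v : Fin n, G.degree v ≤ W := fun v => by
    have := G.degree_lt_card_verts v
    rw [Fintype.card_fin] at this; omega
  set ℓ := Nat.clog 2 n with hℓ
  have hinv0 : MemInv W 0 (0 : Mem) := ⟨fun a => by simp, ∅, by simp, by simp, by simp⟩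
  have up : ∀ {σ : Mem}, MemInv W 0 σ → MemInv W Q σ := fun h => h.mono (Nat.zero_le _)
  refine (Tri.seq_pure (a := ()) (B := 7) (B' := 4 * ℓ + 6 * n + 18) (R := fun _ σ' =>
    Base p W s t σ' ∧ σ' 6 = 0 ∧ σ' 11 = 1 ∧ σ' 12 = 0 ∧ σ' 13 = 0) (Tri.ops (up hinv0) ?_)
    ?_).mono (by omega) fun _ _ _ h _ => h
  · have i1 := hinv0.reg (d := 1) (x := 1) (by omega) (by omega)
    have i2 := i1.reg (d := 2) (x := n) (by omega) (by omega)
    have i3 := i2.reg (d := 3) (x := s) (by omega) (by omega)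
    have i4 := i3.reg (d := 4) (x := t) (by omega) (by omega)
    have i5 := i4.reg (d := 5) (x := p) (by omega) (by omega)
    have i6 := i5.reg (d := 10) (x := 32) (by omega) (by omega)
    have i7 := i6.reg (d := 11) (x := 1) (by omega) (by omega)
    simp [wp, Instr.eff, Finsupp.update_apply, ustconInput]
    refine ⟨up i1, up i2, up i3, up i4, up i5, up i6, up i7, ?_⟩
    constructor
    on_goal 8 => exact i7
    all_goals simp [Finsupp.update_apply]
  rintro σ₁ ⟨h₁, a6, a11, a12, a13⟩
  have hloop1 : Tri (ustconInput G port s t p) (MemInv W Q) (.loop 11 2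
      (.ops [.add 11 11 11, .add 6 6 1])) σ₁ (ℓ * 4 + 2) (PMF.pure ()) fun _ σ' =>
        Base p W s t σ' ∧ σ' 6 = ℓ ∧ σ' 12 = 0 ∧ σ' 13 = 0 := by
    rw [← loopDist_unit ℓ 0]
    refine (Tri.loop (N := ℓ) (B := 2) (E := fun _ _ => PMF.pure ()) (R := fun k _ σ' =>
      Base p W s t σ' ∧ σ' 6 = k ∧ σ' 11 = 2 ^ k ∧ σ' 12 = 0 ∧ σ' 13 = 0)
      (fun _ _ _ h => up h.1.inv) ?_ ?_ ℓ (i := 0) (x := ()) (by omega)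
      ⟨h₁, a6, by simpa using a11, a12, a13⟩).mono le_rfl fun _ _ _ h _ => ⟨h.1, h.2.1, h.2.2.2⟩
    · rintro k _ σ' - ⟨h, -, h11, -⟩
      rw [h11, h.c2, hℓ, Nat.lt_clog_iff_pow_lt one_lt_two]
    · rintro k _ σ' hk ⟨h, h6, h11, h12, h13⟩
      have hkn : 2 ^ k < n := Nat.pow_lt_of_lt_clog hk
      have hkℓ : k + 1 ≤ ℓ := hk
      have j1 := h.reg_update (d := 11) (x := 2 ^ k + 2 ^ k) (by omega) (by omega) (by omega)
        (by omega)
      have j2 := j1.reg_update (d := 6) (x := k + 1) (by omega) (by omega) (by omega) (by omega)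
      refine Tri.ops (up h.inv) ?_
      simp [wp, Instr.eff, Finsupp.update_apply, h6, h11, h12, h13, h.c1]
      exact ⟨up j1.inv, up j2.inv, j2, by rw [pow_succ]; ring⟩
  refine (Tri.seq_pure (a := ()) (B := ℓ * 4 + 2) (B' := 6 * n + 16) hloop1 ?_).mono (by omega)
    fun _ _ _ h _ => h
  rintro σ₂ ⟨h₂, b6, b12, b13⟩
  have hloop2 : Tri (ustconInput G port s t p) (MemInv W Q) (.loop 12 2
      (.ops [.getDeg 14 12] ;; .ite 13 14 (.ops [.copy 13 14]) ;; .ops [.add 12 12 1])) σ₂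
      (n * (4 + 2) + 2) (PMF.pure ()) fun _ σ' =>
        Base p W s t σ' ∧ σ' 6 = ℓ ∧ σ' 13 = G.maxDegree := by
    rw [← loopDist_unit n 0]
    refine (Tri.loop (N := n) (B := 4) (E := fun _ _ => PMF.pure ()) (R := fun k _ σ' =>
      Base p W s t σ' ∧ σ' 6 = ℓ ∧ σ' 12 = k ∧ σ' 13 ≤ G.maxDegree ∧
        ∀ v : Fin n, (v : ℕ) < k → G.degree v ≤ σ' 13)
      (fun _ _ _ h => up h.1.inv) ?_ ?_ n (i := 0) (x := ()) (by omega)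
      ⟨h₂, b6, b12, by omega, fun v hv => absurd hv (by omega)⟩).mono le_rfl
      fun _ _ _ h _ => ⟨h.1, h.2.1, ?_⟩
    · rintro k _ σ' - ⟨h, -, h12, -⟩
      rw [h12, h.c2]
    · rintro k _ σ' hk ⟨h, h6, h12, h13, hv⟩
      have hd : (ustconInput G port s t p).deg k = G.degree ⟨k, hk⟩ := by simp [ustconInput, hk]
      have hdk := hdeg ⟨k, hk⟩
      have hmd := G.degree_le_maxDegree ⟨k, hk⟩
      refine (Tri.seq_pure (a := ()) (B := 1) (B' := 3) (R := fun _ σ' => Base p W s t σ' ∧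
        σ' 6 = ℓ ∧ σ' 12 = k ∧ σ' 13 ≤ G.maxDegree ∧ σ' 14 = G.degree ⟨k, hk⟩ ∧
        ∀ v : Fin n, (v : ℕ) < k → G.degree v ≤ σ' 13) (Tri.ops (up h.inv) ?_) ?_)
      · have j1 := h.reg_update (d := 14) (x := G.degree ⟨k, hk⟩) (by omega) (by omega) (by omega)
          hdk
        simp [wp, Instr.eff, Finsupp.update_apply, h6, h12, hd]
        exact ⟨up j1.inv, j1, h13, hv⟩
      rintro σ₃ ⟨g, g6, g12, g13, g14, gv⟩
      refine (Tri.seq_pure (a := ()) (B := 2) (B' := 1) (R := fun _ σ' => Base p W s t σ' ∧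
        σ' 6 = ℓ ∧ σ' 12 = k ∧ σ' 13 ≤ G.maxDegree ∧
        ∀ v : Fin n, (v : ℕ) < k + 1 → G.degree v ≤ σ' 13) ?_ ?_)
      · by_cases hlt : σ₃ 13 < σ₃ 14
        · refine Tri.ite_pos (B := 1) hlt (up g.inv) (Tri.ops (up g.inv) ?_)
          have j1 := g.reg_update (d := 13) (x := G.degree ⟨k, hk⟩) (by omega) (by omega)
            (by omega) hdk
          simp [wp, Instr.eff, Finsupp.update_apply, g6, g12, g14]
          refine ⟨up j1.inv, j1, hmd, fun v hvk => ?_⟩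
          rcases Nat.lt_or_eq_of_le hvk with hvk | hvk
          · have := gv v hvk; omega
          · have : v = ⟨k, hk⟩ := Fin.ext hvk
            rw [this]
        · refine Tri.ite_neg hlt (up g.inv) ⟨g, g6, g12, g13, fun v hvk => ?_⟩
          rcases Nat.lt_succ_iff_lt_or_eq.1 hvk with hvk | hvk
          · exact gv v hvk
          · have : v = ⟨k, hk⟩ := Fin.ext hvk
            rw [this]; omega
      rintro σ₄ ⟨e, e6, e12, e13, ev⟩
      have j1 := e.reg_update (d := 12) (x := k + 1) (by omega) (by omega) (by omega) (by omega)
      refine Tri.ops (up e.inv) ?_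
      simp [wp, Instr.eff, Finsupp.update_apply, e6, e12, e.c1]
      exact ⟨up j1.inv, j1, e13, fun v hv => ev v (by omega)⟩
    · exact le_antisymm h.2.2.2.1 (G.maxDegree_le_of_forall_degree_le _ fun v => h.2.2.2.2 v v.2)
  refine (Tri.seq_pure (a := ()) (B := n * (4 + 2) + 2) (B' := 14) hloop2 ?_).mono (by omega)
    fun _ _ _ h _ => h
  rintro σ₃ ⟨h₃, c6, c13⟩
  have hceil : (60 * n * ℓ) ⌈/⌉ p = (60 * n * ℓ + p - 1) / p := Nat.ceilDiv_eq_add_pred_div _ _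
  have hdiv : (60 * n * ℓ + p - 1) / p ≤ 60 * n * ℓ + p := (Nat.div_le_self _ _).trans (by omega)
  -- The intermediate product `60 * n` is below the final one unless `⌈log n⌉ = 0`; but then `n ≤ 1`
  -- and the additive constant in `hW2` covers it.
  have h60 : 60 * n ≤ W := by
    rcases Nat.eq_zero_or_pos ℓ with h0 | h0
    · have : n ≤ 1 := by
        by_contra hcon
        have := Nat.clog_pos (b := 2) (n := n) (by omega) (by omega)
        omega
      omega
    · nlinarith
  refine (Tri.seq_pure (a := ()) (B := 6) (B' := 8) (R := fun _ σ' =>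
    Base p W s t σ' ∧ σ' 6 = ℓ ∧ σ' 13 = G.maxDegree ∧ σ' 15 = (60 * n * ℓ) ⌈/⌉ p)
    (Tri.ops (up h₃.inv) ?_) ?_)
  · have j1 := h₃.reg_update (d := 15) (x := 60) (by omega) (by omega) (by omega) (by omega)
    have j2 := h₃.reg_update (d := 15) (x := 60 * n) (by omega) (by omega) (by omega) (by omega)
    have j3 := h₃.reg_update (d := 15) (x := 60 * n * ℓ) (by omega) (by omega) (by omega) (by omega)
    have j4 := h₃.reg_update (d := 15) (x := 60 * n * ℓ + p) (by omega) (by omega) (by omega)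
      (by omega)
    have j5 := h₃.reg_update (d := 15) (x := 60 * n * ℓ + p - 1) (by omega) (by omega) (by omega)
      (by omega)
    have j6 := h₃.reg_update (d := 15) (x := (60 * n * ℓ + p - 1) / p) (by omega) (by omega)
      (by omega) (by omega)
    simp [wp, Instr.eff, Finsupp.update_apply, c6, c13, h₃.c2, h₃.c5, h₃.c1]
    exact ⟨up j1.inv, up j2.inv, up j3.inv, up j4.inv, up j5.inv, up j6.inv, j6, hceil.symm⟩
  rintro σ₄ ⟨h₄, d6, d13, d15⟩
  refine (Tri.seq_pure (a := ()) (B := 2) (B' := 6) (R := fun _ σ' =>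
    Base p W s t σ' ∧ σ' 6 = ℓ ∧ σ' 15 = nPCeil n p G.maxDegree) ?_ ?_)
  · by_cases hlt : σ₄ 15 < σ₄ 13
    · refine Tri.ite_pos (B := 1) hlt (up h₄.inv) (Tri.ops (up h₄.inv) ?_)
      have := h₄.inv.1 13
      have j1 := h₄.reg_update (d := 15) (x := G.maxDegree) (by omega) (by omega) (by omega)
        (by omega)
      simp [wp, Instr.eff, Finsupp.update_apply, d6, d13]
      refine ⟨up j1.inv, j1, ?_⟩
      rw [nPCeil, max_eq_right]
      rw [← hℓ]
      omega
    · refine Tri.ite_neg hlt (up h₄.inv) ⟨h₄, d6, ?_⟩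
      rw [nPCeil, max_eq_left, d15]
      rw [← hℓ]
      omega
  rintro σ₅ ⟨h₅, e6, e15⟩
  have j1 := h₅.reg_update (d := 7) (x := nPCeil n p G.maxDegree ^ 2) (by omega) (by omega)
    (by omega) hW5
  have j2 := j1.reg_update (d := 8) (x := 2) (by omega) (by omega) (by omega) (by omega)
  have j3 := j1.reg_update (d := 8) (x := p + 2) (by omega) (by omega) (by omega) (by omega)
  have j4 := j3.reg_update (d := 9) (x := 72) (by omega) (by omega) (by omega) (by omega)
  have j5 := j3.reg_update (d := 9) (x := 72 * ℓ) (by omega) (by omega) (by omega) (by omega)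
  have j6 := j5.reg_update (d := 11) (x := n - 1) (by omega) (by omega) (by omega) (by omega)
  refine Tri.ops (up h₅.inv) ?_
  simp [wp, Instr.eff, Finsupp.update_apply, e6, e15, h₅.c1, h₅.c2, h₅.c5, ← pow_two, add_comm 2 p]
  refine ⟨up j1.inv, up j2.inv, up j3.inv, up j4.inv, up j5.inv, up j6.inv, ?_, j6.inv⟩
  obtain ⟨k0, k1, k2, k3, k4, k5, k10, -⟩ := j6
  constructor
  all_goals first | assumption | simp [Finsupp.update_apply, e6]

theorem tri_compareCmd {I : Input} (hℓW : ℓ < W) (hW : ∀ v : Fin n, addr v + 2 ≤ W)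
    (h : Between p ℓ τ W Q s t L D σ) (hs : s ∈ L) (ht : t ∈ L) :
    Tri I (MemInv W Q) compareCmd σ (8 * ℓ + 15) (PMF.pure ()) fun _ σ' =>
      (σ' 0 < σ' 26 ↔ ¬ Relation.EqvGen (fun a b => (a, b) ∈ D) s t) := by
  obtain ⟨hc, ⟨par, sz, ha, hu⟩, hinv⟩ := h
  have haddr : ∀ v : ℕ, addr v = v + v + v + 32 := by intro v; unfold addr; omega
  have hWs := hW s
  have hWt := hW t
  have hsa := haddr s
  have hta := haddr t
  refine (Tri.seq_pure (a := ()) (B := 6) (B' := 8 * ℓ + 9) (R := fun _ σ' =>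
    (∀ y, y < 23 ∨ 32 ≤ y → σ' y = σ y) ∧ σ' 23 = addr s ∧ σ' 24 = addr t ∧ MemInv W Q σ')
    (Tri.ops hinv ?_) ?_).mono (by omega) fun _ _ _ h _ => h
  · have i1 := hinv.reg (d := 23) (x := s + s) (by omega) (by omega)
    have i2 := hinv.reg (d := 23) (x := s + s + s) (by omega) (by omega)
    have i3 := hinv.reg (d := 23) (x := addr s) (by omega) (by omega)
    have i4 := i3.reg (d := 24) (x := t + t) (by omega) (by omega)
    have i5 := i3.reg (d := 24) (x := t + t + t) (by omega) (by omega)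
    have i6 := i3.reg (d := 24) (x := addr t) (by omega) (by omega)
    simp [wp, Instr.eff, Finsupp.update_apply, hc.c3, hc.c4, hc.c10, ← haddr]
    refine ⟨i1, i2, i3, i4, i5, i6, fun y hy => ?_, i6⟩
    split_ifs <;> omega
  rintro σ₁ ⟨hs₁, g23, g24, hi₁⟩
  have hc₁ : Consts p ℓ τ s t σ₁ := hc.of_agree fun y hy => hs₁ y (by omega)
  have ha₁ : Arrays L par sz σ₁ := ha.of_agree fun y hy => hs₁ y (by omega)
  refine (Tri.seq_pure (a := ()) (B := 1 + (ℓ * 4 + 2)) (B' := 4 * ℓ + 6) (tri_findCmd (by omega)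
    (by omega) hc₁.c6 hc₁.c1 hi₁ hℓW (fun v hv => ⟨ha₁.par v hv, hu.par_mem v hv⟩) hs g23) ?_).mono
    (by omega) fun _ _ _ h _ => h
  rintro σ₂ ⟨hs₂, f23, hi₂⟩
  have hc₂ : Consts p ℓ τ s t σ₂ := hc₁.of_agree fun y hy => hs₂ y (by omega) (by omega)
  have ha₂ : Arrays L par sz σ₂ := ha₁.of_agree fun y hy => hs₂ y (by omega) (by omega)
  refine (Tri.seq_pure (a := ()) (B := 1 + (ℓ * 4 + 2)) (B' := 3) (tri_findCmd (by omega)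
    (by omega) hc₂.c6 hc₂.c1 hi₂ hℓW (fun v hv => ⟨ha₂.par v hv, hu.par_mem v hv⟩) ht
    (by rw [hs₂ 24 (by omega) (by omega), g24])) ?_).mono (by omega) fun _ _ _ h _ => h
  rintro σ₃ ⟨hs₃, f24, hi₃⟩
  have e23 : σ₃ 23 = addr (par^[ℓ] s) := by rw [hs₃ 23 (by omega) (by omega), f23]
  have e0 : σ₃ 0 = 0 := by rw [hs₃ 0 (by omega) (by omega), hc₂.c0]
  have hA := hW (par^[ℓ] s)
  have hB := hW (par^[ℓ] t)
  have i1 := hi₃.reg (d := 26) (x := addr (par^[ℓ] s) - addr (par^[ℓ] t)) (by omega) (by omega)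
  have i2 := i1.reg (d := 27) (x := addr (par^[ℓ] t) - addr (par^[ℓ] s)) (by omega) (by omega)
  have i3 := i2.reg (d := 26) (x := addr (par^[ℓ] s) - addr (par^[ℓ] t) +
    (addr (par^[ℓ] t) - addr (par^[ℓ] s))) (by omega) (by omega)
  refine Tri.ops hi₃ ?_
  simp only [wp, Instr.eff, Option.some.injEq, Prod.mk.injEq]
  refine ⟨_, _, ⟨rfl, rfl⟩, by rw [e23, f24]; exact i1, _, _, ⟨rfl, rfl⟩, ?_, _, _, ⟨rfl, rfl⟩,
    ?_, ?_⟩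
  · simp [Finsupp.update_apply, e23, f24]; exact i2
  · simp [Finsupp.update_apply, e23, f24]; exact i3
  · simp only [Finsupp.update_apply, e23, f24, e0]
    rw [hu.iff s hs t ht, Fin.ext_iff]
    simp
    unfold addr
    omega

/-- What the memory bound `W` has to exceed. -/
structure Fits (n p τ W : ℕ) : Prop where
  one_le : 1 ≤ p
  mul_le : 60 * n * Nat.clog 2 n + p ≤ W
  size_le : 3 * n + 72 ≤ W
  clog_lt : 72 * Nat.clog 2 n < W
  param_le : 3 * p + 40 ≤ W
  lt : τ < W

/-- Bound on the number of steps. -/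
def stepBound (n p ℓ τ : ℕ) : ℕ :=
  4 * ℓ + 6 * n + 25 + (p * 16 + 31 +
    (72 * ℓ * ((p + 2) * (τ * (8 * ℓ + 43) + 13) + 6) + 3 + (8 * ℓ + 15)))

/-- The set of discovered pairs of the landmark algorithm. -/
def landmarkPairs [NeZero n] (s t : Fin n) (p : ℕ) : PMF (Set (Fin n × Fin n)) :=
  ((PMF.uniformOfFintype (Fin p → Fin n)).map fun g => s :: t :: List.ofFn g).bind fun L =>
    discover G L (nPCeil n p G.maxDegree ^ 2) (List.replicate (72 * Nat.clog 2 n) L).flatten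

theorem tri_mainCmd [NeZero n] (hF : Fits n p (nPCeil n p G.maxDegree ^ 2) W) :
    Tri (ustconInput G port s t p) (MemInv W (3 * (p + 2))) mainCmd 0
      (stepBound n p (Nat.clog 2 n) (nPCeil n p G.maxDegree ^ 2)) (landmarkPairs G s t p)
      fun D σ' => (σ' 0 < σ' 26 ↔ ¬ Relation.EqvGen (fun a b => (a, b) ∈ D) s t) := by
  obtain ⟨h1, h2, h3, h4, h5, h6⟩ := hF
  have hW : ∀ v : Fin n, addr v + 2 ≤ W := by intro v; unfold addr; omega
  have hpW : addr (p + 2) + 2 ≤ W := by unfold addr; omega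
  have hℓ := Nat.le_pow_clog one_lt_two n
  refine Tri.seq_pure (a := ()) (tri_setupCmd G port h1 h2 (by omega) (by omega) (by omega)
    (by omega)) ?_
  rintro σ₁ ⟨hc, hi⟩
  refine Tri.seq (tri_landmarksCmd hpW hW (by omega) hc (fun y hy => hi.eq_zero hy) hi) ?_
  rintro L hL σ₂ ⟨hlen, hb⟩
  obtain ⟨g, -, rfl⟩ := (PMF.mem_support_map_iff _ _ _).1 hL
  rw [← PMF.bind_pure (discover G _ _ _)]
  have hd := tri_roundsCmd G port hℓ h4 h6 hpW hW (by omega) hb hlen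
  have := Tri.seq (E := fun D => (PMF.pure ()).map fun _ => D) hd (e := compareCmd)
    (B' := 8 * Nat.clog 2 n + 15)
    (R' := fun D σ' => (σ' 0 < σ' 26 ↔ ¬ Relation.EqvGen (fun a b => (a, b) ∈ D) s t))
    fun D _ σ₃ h₃ => Tri.map (fun _ => D) (tri_compareCmd (by omega) hW h₃ (by simp) (by simp))
      fun _ _ _ h => h
  simpa only [PMF.pure_map] using this

theorem ustconInput_bounded (hn : n ≤ W) (hp : p ≤ W) : (ustconInput G port s t p).Bounded W := by
  have hdeg : ∀ v : Fin n, G.degree v ≤ W := fun v => by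
    have := G.degree_lt_card_verts v
    rw [Fintype.card_fin] at this; omega
  constructor
  · exact hn
  · exact s.2.le.trans hn
  · exact t.2.le.trans hn
  · exact hp
  · intro v
    simp only [ustconInput]
    split_ifs
    · exact hdeg _
    · exact Nat.zero_le _
  · intro v i
    simp only [ustconInput]
    split_ifs
    · exact (Fin.is_lt _).le.trans hn
    all_goals exact Nat.zero_le _
  · intro v u
    simp only [ustconInput]
    split_ifs
    · exact (Fin.is_lt _).le.trans (hdeg _)
    all_goals exact Nat.zero_le _

open Classical in
theorem map_landmarkPairs [NeZero n] (s t : Fin n) (p : ℕ) :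
    ((landmarkPairs G s t p).map fun D =>
      decide (Relation.EqvGen (fun a b => (a, b) ∈ D) s t)) = landmarkAlgorithm G s t p := by
  rw [landmarkPairs, PMF.map_bind, PMF.bind_map, landmarkAlgorithm]
  simp only [Fintype.card_fin]
  rfl

open Classical in
theorem ustconProgram_spec (hF : Fits n p (nPCeil n p G.maxDegree ^ 2) W) :
    TimeAtMost ustconProgram (ustconInput G port s t p)
      ((stepBound n p (Nat.clog 2 n) (nPCeil n p G.maxDegree ^ 2) + 1) * (1 + 6 * bits W) : ℕ) ∧
    SpaceAtMost ustconProgram (ustconInput G port s t p)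
      ((32 + 3 * (p + 2)) * (2 * bits W) : ℕ) ∧
    ∀ b, outputProb ustconProgram (ustconInput G port s t p) b = landmarkAlgorithm G s t p b := by
  have : NeZero n := ⟨s.pos.ne'⟩
  set I := ustconInput G port s t p with hI
  have h3 := hF.size_le
  have h5 := hF.param_le
  have hcode : CodeAt ustconProgram 0 (mainCmd.compile 0) := ⟨_, rfl⟩
  have hend : CodeAt ustconProgram mainCmd.size [.jumpLt 0 26 (mainCmd.size + 2), .accept, .reject] :=
    ⟨[], by rw [ustconProgram, List.drop_left' (by simp)]; simp⟩
  obtain ⟨κ, hκ1, hκ2, hκ3⟩ := tri_mainCmd (s := s) (t := t) G port hF ustconProgram 0 hcode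
  set out : Set (Fin n × Fin n) × Mem → Config := fun x =>
    ⟨if decide (Relation.EqvGen (fun a b => (a, b) ∈ x.1) s t) then mainCmd.size + 1
      else mainCmd.size + 2, x.2⟩ with hout
  have hacc : ∀ σ, fetch ustconProgram ⟨mainCmd.size + 1, σ⟩ = .accept := hend.tail.fetch
  have hrej : ∀ σ, fetch ustconProgram ⟨mainCmd.size + 2, σ⟩ = .reject := hend.tail.tail.fetch
  have houtput : ∀ x, output ustconProgram (out x) =
      some (decide (Relation.EqvGen (fun a b => (a, b) ∈ x.1) s t)) := by
    intro x
    by_cases h : Relation.EqvGen (fun a b => (a, b) ∈ x.1) s t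
    · simp only [hout, h, decide_true, if_true, output, hacc]
    · simp only [hout, h, decide_false, output, hrej, Bool.false_eq_true, if_false]
  have hexec : Exec ustconProgram I (MemInv W (3 * (p + 2))) out init
      (stepBound n p (Nat.clog 2 n) (nPCeil n p G.maxDegree ^ 2) + 1) κ := by
    have := hκ3.bind (B' := 1) (out' := out) (ν := fun x => PMF.pure x) fun x hx => by
      refine exec_jumpLt (by rw [Nat.zero_add]; exact hend.fetch x.2) (hκ3.inv_out x hx) ?_
      have hx2 : x.2 0 < x.2 26 ↔ ¬ Relation.EqvGen (fun a b => (a, b) ∈ x.1) s t := hκ2 x hx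
      simp only [hout]
      by_cases h : Relation.EqvGen (fun a b => (a, b) ∈ x.1) s t
      · have : ¬ x.2 0 < x.2 26 := by rw [hx2, not_not]; exact h
        simp [h, this]
      · have : x.2 0 < x.2 26 := by rw [hx2]; exact h
        simp [h, this]
    rwa [PMF.bind_pure] at this
  have hhalt : ∀ x ∈ κ.support, output ustconProgram (out x) ≠ none := by
    intro x _; rw [houtput]; simp
  have hcost : ∀ c : Config, MemInv W (3 * (p + 2)) c.mem →
      cost ustconProgram I c ≤ 1 + 6 * bits W := fun c hc =>
    cost_le (ustconProgram_small (by omega))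
      (ustconInput_bounded G port (by omega) (by omega)) hc
  refine ⟨hexec.timeAtMost hhalt hcost, hexec.spaceAtMost hhalt hcost fun c hc =>
    hc.space_le (by omega), fun b => ?_⟩
  rw [hexec.outputProb_eq hhalt, PMF.map_comp, ← map_landmarkPairs, ← hκ1, PMF.map_comp]
  have : output ustconProgram ∘ out = some ∘ ((fun D : Set (Fin n × Fin n) =>
      decide (Relation.EqvGen (fun a b => (a, b) ∈ D) s t)) ∘ Prod.fst) := by
    funext x
    exact houtput x
  rw [this, ← PMF.map_comp, PMF.map_apply, tsum_eq_single b]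
  · simp
  · intro b' hb'
    rw [if_neg]
    simpa using hb'.symm

end RAM

/-! ### Asymptotic form of the bounds -/

namespace RAM

variable {n p Δ : ℕ}

/-- A bound on all numbers in memory. -/
def valueBound (n p : ℕ) : ℕ := (64 * (n ^ 2 + p)) ^ 2

theorem clog_two_le (n : ℕ) : Nat.clog 2 n ≤ n :=
  Nat.clog_le_of_le_pow n.lt_two_pow_self.le

/-- The largest number is the walk length, at most `(60 (n² + p))²`; the constant `64` leaves room
for everything else. -/
theorem fits_valueBound (hn : 2 ≤ n) (hp : 1 ≤ p) (hΔ : Δ ≤ n) :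
    Fits n p (nPCeil n p Δ ^ 2) (valueBound n p) := by
  have hc := clog_two_le n
  set x := n ^ 2 + p with hx
  have hn2 : 2 * n ≤ n ^ 2 := by nlinarith
  have h60 : 60 * n * Nat.clog 2 n ≤ 60 * n ^ 2 := by nlinarith
  have hW : valueBound n p = 4096 * x ^ 2 := by rw [valueBound, ← hx]; ring
  have hx5 : 5 * x ≤ x ^ 2 := by nlinarith
  have hP : nPCeil n p Δ ≤ 60 * x := by
    refine max_le ?_ (by omega)
    rw [Nat.ceilDiv_eq_add_pred_div]
    refine (Nat.div_le_of_le_mul ?_)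
    have : 1 * (60 * x) ≤ p * (60 * x) := Nat.mul_le_mul_right _ hp
    omega
  refine ⟨hp, ?_, ?_, ?_, ?_, ?_⟩
  · rw [hW]; omega
  · rw [hW]; omega
  · rw [hW]; omega
  · rw [hW]; omega
  · have : nPCeil n p Δ ^ 2 ≤ (60 * x) ^ 2 := Nat.pow_le_pow_left hP 2
    rw [hW]
    nlinarith

theorem natLog_le_logb {x : ℕ} : (Nat.log 2 x : ℝ) ≤ Real.logb 2 x := by
  have := Real.natLog_le_logb x 2
  exact_mod_cast this

theorem clog_le_logb_add_one {n : ℕ} (hn : 2 ≤ n) : (Nat.clog 2 n : ℝ) ≤ Real.logb 2 n + 1 := by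
  have h1 := Nat.pow_pred_clog_lt_self one_lt_two (x := n) (by omega)
  have hpos := Nat.clog_pos one_lt_two (n := n) (by omega)
  have h2 : (Nat.clog 2 n).pred = Nat.clog 2 n - 1 := rfl
  have h3 : ((Nat.clog 2 n - 1 : ℕ) : ℝ) ≤ Real.logb 2 n := by
    rw [Real.le_logb_iff_rpow_le one_lt_two (by positivity), Real.rpow_natCast]
    rw [h2] at h1
    exact_mod_cast h1.le
  rw [Nat.cast_sub hpos] at h3
  push_cast at h3
  linarith

theorem one_le_logb_two {x : ℝ} (hx : 2 ≤ x) : 1 ≤ Real.logb 2 x := by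
  rw [Real.le_logb_iff_rpow_le one_lt_two (by linarith)]
  simpa using hx



theorem clog_le_two_mul_logb (hn : 2 ≤ n) : (Nat.clog 2 n : ℝ) ≤ 2 * Real.logb 2 n := by
  have h1 := clog_le_logb_add_one hn
  have h2 := one_le_logb_two (x := n) (by exact_mod_cast hn)
  linarith

/-- Replacing `log n` by `⌈log n⌉` at most doubles the first term of the maximum, and rounding up
adds at most `1 ≤ Δ`. -/
theorem nPCeil_le (hn : 2 ≤ n) (hp : 1 ≤ p) (hΔ : 1 ≤ Δ) : (nPCeil n p Δ : ℝ) ≤ 3 * nP n p Δ := by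
  have h1 : (Δ : ℝ) ≤ nP n p Δ := le_max_right _ _
  have h2 : 60 * ((n : ℝ) / p) * Real.logb 2 n ≤ nP n p Δ := le_max_left _ _
  have h3 : (1 : ℝ) ≤ Δ := by exact_mod_cast hΔ
  have hp0 : (0 : ℝ) < p := by exact_mod_cast hp
  rw [nPCeil, Nat.cast_max]
  refine max_le ?_ (by linarith)
  have h4 : ((60 * n * Nat.clog 2 n) ⌈/⌉ p : ℕ) ≤ (60 * n * Nat.clog 2 n) / p + 1 := by
    rw [Nat.ceilDiv_eq_add_pred_div]
    calc (60 * n * Nat.clog 2 n + p - 1) / p ≤ (60 * n * Nat.clog 2 n + p) / p :=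
          Nat.div_le_div_right (by omega)
      _ = _ := Nat.add_div_right _ hp
  have h5 : (((60 * n * Nat.clog 2 n) ⌈/⌉ p : ℕ) : ℝ) ≤
      ((60 * n * Nat.clog 2 n) / p : ℕ) + 1 := by exact_mod_cast h4
  have h6 : (((60 * n * Nat.clog 2 n) / p : ℕ) : ℝ) ≤ (60 * n * Nat.clog 2 n : ℕ) / (p : ℝ) :=
    Nat.cast_div_le
  have h7 : ((60 * n * Nat.clog 2 n : ℕ) : ℝ) / (p : ℝ) ≤ 2 * (60 * ((n : ℝ) / p) * Real.logb 2 n) := by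
    push_cast
    have := clog_le_two_mul_logb hn
    have hnp : (0 : ℝ) ≤ 60 * (n / p) := by positivity
    calc 60 * (n : ℝ) * Nat.clog 2 n / p = 60 * (n / p) * Nat.clog 2 n := by ring
      _ ≤ 60 * (n / p) * (2 * Real.logb 2 n) := by gcongr
      _ = _ := by ring
  linarith

theorem bits_valueBound_le (hn : 2 ≤ n) (hp : 1 ≤ p) :
    (bits (valueBound n p) : ℝ) ≤ 17 * Real.logb 2 (n + p) := by
  have h2 : (2 : ℝ) ≤ n := by exact_mod_cast hn
  have h1 : (1 : ℝ) ≤ p := by exact_mod_cast hp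
  have hl := one_le_logb_two (x := n + p) (by linarith)
  have h3 : Real.logb 2 (valueBound n p : ℕ) ≤ Real.logb 2 ((64 * ((n : ℝ) + p) ^ 2) ^ 2) := by
    refine Real.logb_le_logb_of_le one_lt_two ?_ ?_
    · rw [valueBound]; positivity
    · rw [valueBound]; push_cast
      gcongr
      nlinarith
  have h4 : Real.logb 2 ((64 * ((n : ℝ) + p) ^ 2) ^ 2) = 12 + 4 * Real.logb 2 (n + p) := by
    have h64 : Real.logb 2 64 = 6 := by
      rw [show (64 : ℝ) = 2 ^ (6 : ℝ) by norm_num, Real.logb_rpow (by norm_num) (by norm_num)]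
    rw [Real.logb_pow, Real.logb_mul (by norm_num) (by positivity), Real.logb_pow, h64]
    push_cast; ring
  have h5 := natLog_le_logb (x := valueBound n p)
  rw [bits]; push_cast
  linarith

theorem space_bound (hn : 2 ≤ n) (hp : 1 ≤ p) :
    (((32 + 3 * (p + 2)) * (2 * bits (valueBound n p)) : ℕ) : ℝ) ≤
      (10 ^ 8 : ℕ) * Real.logb 2 (n + p) ^ 3 * p := by
  have h2 : (2 : ℝ) ≤ n := by exact_mod_cast hn
  have h1 : (1 : ℝ) ≤ p := by exact_mod_cast hp
  have hl := one_le_logb_two (x := n + p) (by linarith)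
  have hb := bits_valueBound_le hn hp
  set l := Real.logb 2 (n + p) with hldef
  -- One logarithm would suffice for space; the exponent `3` and the factor `10 ^ 8` are shared with
  -- the time bound.
  have hl3 : l ≤ l ^ 3 := le_self_pow₀ hl (by norm_num)
  push_cast
  calc (32 + 3 * ((p : ℝ) + 2)) * (2 * bits (valueBound n p)) ≤ (41 * p) * (2 * (17 * l ^ 3)) := by
        gcongr
        · linarith
        · linarith
    _ = 1394 * (l ^ 3 * p) := by ring
    _ ≤ 10 ^ 8 * (l ^ 3 * p) := by gcongr; norm_num
    _ = _ := by ring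

/-- Of the three logarithms one counts rounds, one the pointers followed per walk step, and one the
bit lengths. The setup scans all degrees, which takes `O(n)` steps, and `n ≤ n_p p`. -/
theorem time_bound (hn : 2 ≤ n) (hp : 1 ≤ p) (hΔ : 1 ≤ Δ) :
    (((stepBound n p (Nat.clog 2 n) (nPCeil n p Δ ^ 2) + 1) * (1 + 6 * bits (valueBound n p)) : ℕ) : ℝ)
      ≤ (10 ^ 8 : ℕ) * Real.logb 2 (n + p) ^ 3 * (nP n p Δ ^ 2 * p) := by
  have h2 : (2 : ℝ) ≤ n := by exact_mod_cast hn
  have h1 : (1 : ℝ) ≤ p := by exact_mod_cast hp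
  have hp0 : (0 : ℝ) < p := by linarith
  have hl := one_le_logb_two (x := n + p) (by linarith)
  have hln := one_le_logb_two (x := n) h2
  have hb := bits_valueBound_le hn hp
  have hτ := nPCeil_le hn hp hΔ
  have hm1 : (1 : ℝ) ≤ nP n p Δ := by
    have h3 : (1 : ℝ) ≤ Δ := by exact_mod_cast hΔ
    exact h3.trans (le_max_right _ _)
  have hmn : (n : ℝ) ≤ nP n p Δ * p := by
    have h4 : 60 * ((n : ℝ) / p) * Real.logb 2 n ≤ nP n p Δ := le_max_left _ _
    have h5 : (n : ℝ) / p ≤ nP n p Δ := by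
      refine le_trans ?_ h4
      have : (0 : ℝ) ≤ n / p := by positivity
      nlinarith
    rwa [div_le_iff₀ hp0] at h5
  have hℓ : (Nat.clog 2 n : ℝ) ≤ 2 * Real.logb 2 (n + p) := by
    refine (clog_le_two_mul_logb hn).trans ?_
    have : Real.logb 2 n ≤ Real.logb 2 (n + p) :=
      Real.logb_le_logb_of_le one_lt_two (by linarith) (by linarith)
    linarith
  set l := Real.logb 2 (n + p) with hldef
  set m := nP n p Δ with hm
  set ℓ : ℝ := ((Nat.clog 2 n : ℕ) : ℝ) with hℓdef
  set M : ℝ := ((nPCeil n p Δ : ℕ) : ℝ) with hM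
  have hℓ0 : 0 ≤ ℓ := Nat.cast_nonneg _
  have hM0 : 0 ≤ M := Nat.cast_nonneg _
  have hm0 : 0 ≤ m := by linarith
  have hl0 : 0 ≤ l := by linarith
  set Y := m ^ 2 * p with hY
  have hmm : m ≤ m ^ 2 := le_self_pow₀ hm1 (by norm_num)
  have hYn : (n : ℝ) ≤ Y := hmn.trans (by rw [hY]; gcongr)
  have hYp : (p : ℝ) ≤ Y := by rw [hY]; nlinarith
  have hY0 : 0 ≤ Y := by linarith
  have hM2 : M ^ 2 ≤ 9 * m ^ 2 := by nlinarith
  have hl2 : l ≤ l ^ 2 := le_self_pow₀ hl (by norm_num)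
  have hbr : M ^ 2 * (8 * ℓ + 43) + 13 ≤ 544 * (m ^ 2 * l) := by
    have h3 : M ^ 2 * (8 * ℓ + 43) ≤ 9 * m ^ 2 * (59 * l) := by
      gcongr; linarith
    have h4 : 1 ≤ m ^ 2 * l := by nlinarith
    nlinarith
  have hin : (p + 2) * (M ^ 2 * (8 * ℓ + 43) + 13) + 6 ≤ 1638 * (Y * l) := by
    have h3 : (p + 2) * (M ^ 2 * (8 * ℓ + 43) + 13) ≤ (3 * p) * (544 * (m ^ 2 * l)) := by
      gcongr; linarith
    have h4 : 1 ≤ Y * l := by nlinarith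
    have h5 : (3 * p) * (544 * (m ^ 2 * l)) = 1632 * (Y * l) := by rw [hY]; ring
    linarith
  have hout : 72 * ℓ * ((p + 2) * (M ^ 2 * (8 * ℓ + 43) + 13) + 6) ≤ 235872 * (Y * l ^ 2) := by
    calc 72 * ℓ * ((p + 2) * (M ^ 2 * (8 * ℓ + 43) + 13) + 6)
        ≤ 72 * (2 * l) * (1638 * (Y * l)) := by gcongr
      _ = _ := by ring
  have hYl : Y ≤ Y * l ^ 2 := by nlinarith
  have hY1 : 1 ≤ Y := by linarith
  have hlY : l ≤ Y * l ^ 2 := by nlinarith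
  have hstep : ((stepBound n p (Nat.clog 2 n) (nPCeil n p Δ ^ 2) + 1 : ℕ) : ℝ) ≤
      240000 * (Y * l ^ 2) := by
    rw [stepBound]; push_cast
    rw [← hℓdef, ← hM]
    linarith
  have hbits : ((1 + 6 * bits (valueBound n p) : ℕ) : ℝ) ≤ 103 * l := by
    push_cast; linarith
  rw [Nat.cast_mul]
  calc _ ≤ (240000 * (Y * l ^ 2)) * (103 * l) := by gcongr
    _ = 24720000 * (l ^ 3 * Y) := by ring
    _ ≤ 10 ^ 8 * (l ^ 3 * Y) := by gcongr; norm_num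
    _ = _ := by push_cast; ring

end RAM

/-- The deterministic part of the main theorem. -/
theorem ustcon_resources (n p : ℕ) (G : SimpleGraph (Fin n)) [DecidableRel G.Adj]
    (port : ∀ v : Fin n, G.neighborSet v ≃ Fin (G.degree v)) (s t : Fin n) (hp : 1 ≤ p)
    (hG : G ≠ ⊥) :
    RAM.SpaceAtMost RAM.ustconProgram (ustconInput G port s t p)
      ((10 ^ 8 : ℕ) * Real.logb 2 (n + p) ^ 3 * p) ∧
    RAM.TimeAtMost RAM.ustconProgram (ustconInput G port s t p)
      ((10 ^ 8 : ℕ) * Real.logb 2 (n + p) ^ 3 * (nP n p G.maxDegree ^ 2 * p)) ∧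
    ∀ b, RAM.outputProb RAM.ustconProgram (ustconInput G port s t p) b =
      landmarkAlgorithm G s t p b := by
  -- An edge gives `n ≥ 2` and `Δ ≥ 1`, so that the logarithms and `n_p` are at least `1` and absorb
  -- additive constants.
  obtain ⟨a, b, hab⟩ : ∃ a b, G.Adj a b := by
    by_contra! h
    exact hG (by ext a b; simp [h a b])
  have hn : 2 ≤ n := by
    have := a.2; have := b.2
    have : (a : ℕ) ≠ b := fun h => hab.ne (Fin.ext h)
    omega
  have hΔ : 1 ≤ G.maxDegree :=
    ((G.degree_pos_iff_exists_adj a).2 ⟨b, hab⟩).trans_le (G.degree_le_maxDegree a)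
  have hΔn : G.maxDegree ≤ n := by
    refine G.maxDegree_le_of_forall_degree_le _ fun v => ?_
    have := G.degree_lt_card_verts v
    rw [Fintype.card_fin] at this; omega
  obtain ⟨h1, h2, h3⟩ := RAM.ustconProgram_spec (s := s) (t := t) G port
    (RAM.fits_valueBound hn hp hΔn)
  exact ⟨fun c T h => (h2 c T h).trans (RAM.space_bound hn hp),
    fun c T h => (h1 c T h).trans (RAM.time_bound hn hp hΔ), h3⟩

/-! ### Soundness of the landmark algorithm -/

section Soundness

variable {V : Type} [Fintype V] [DecidableEq V] {G : SimpleGraph V} [DecidableRel G.Adj]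

theorem reachable_of_mem_support_unitStep {v u : V} (h : u ∈ (unitStep G v).support) :
    G.Reachable v u := by
  by_contra hn
  rw [PMF.mem_support_iff, unitStep, mhStep, PMF.normalize_apply] at h
  have h1 : u ≠ v := by rintro rfl; exact hn (.refl _)
  have h2 : ¬ G.Adj v u := fun h => hn h.reachable
  simp [mhWeight, h1, h2] at h

theorem reachable_of_mem_support_mhWalk {k : ℕ} {v : V} {X : List V}
    (h : X ∈ (mhWalk G k v).support) : ∀ x ∈ X, G.Reachable v x := by
  induction k generalizing v X with
  | zero =>
    rw [mhWalk, PMF.mem_support_pure_iff] at h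
    simp [h]
  | succ k ih =>
    rw [mhWalk, PMF.mem_support_bind_iff] at h
    obtain ⟨u, hu, hX⟩ := h
    obtain ⟨Y, hY, rfl⟩ := (PMF.mem_support_map_iff _ _ _).1 hX
    have hvu := reachable_of_mem_support_unitStep hu
    intro x hx
    rcases List.mem_cons.1 hx with rfl | hx
    · exact hvu
    · exact hvu.trans (ih hY x hx)

theorem reachable_of_mem_support_discover {L ls : List V} {τ : ℕ} {D : Set (V × V)}
    (h : D ∈ (discover G L τ ls).support) : ∀ q ∈ D, G.Reachable q.1 q.2 := by
  induction ls generalizing D with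
  | nil =>
    rw [discover, PMF.mem_support_pure_iff] at h
    simp [h]
  | cons l ls ih =>
    rw [discover, PMF.mem_support_bind_iff] at h
    obtain ⟨X, hX, hD⟩ := h
    obtain ⟨D', hD', rfl⟩ := (PMF.mem_support_map_iff _ _ _).1 hD
    rintro q (⟨h1, h2, -⟩ | hq)
    · rw [h1]; exact reachable_of_mem_support_mhWalk hX _ h2
    · exact ih hD' q hq

theorem reachable_of_eqvGen {V : Type} {G : SimpleGraph V} {D : Set (V × V)} (hD : ∀ q ∈ D, G.Reachable q.1 q.2) {a b : V}
    (h : Relation.EqvGen (fun a b => (a, b) ∈ D) a b) : G.Reachable a b := by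
  induction h with
  | rel a b h => exact hD _ h
  | refl a => exact .refl a
  | symm a b _ ih => exact ih.symm
  | trans a b c _ _ ih1 ih2 => exact ih1.trans ih2

theorem landmarkAlgorithm_true_eq_zero {s t : V} {p : ℕ} (h : ¬ G.Reachable s t) :
    landmarkAlgorithm G s t p true = 0 := by
  by_contra hne
  have hmem : true ∈ (landmarkAlgorithm G s t p).support := hne
  rw [landmarkAlgorithm, PMF.mem_support_bind_iff] at hmem
  obtain ⟨g, -, hg⟩ := hmem
  obtain ⟨D, hD, hdec⟩ := (PMF.mem_support_map_iff _ _ _).1 hg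
  exact h (reachable_of_eqvGen (reachable_of_mem_support_discover hD) (by simpa using hdec))

end Soundness

/-! ### The transition matrix and its Green function -/

namespace Landmark

variable {V : Type} [Fintype V] [DecidableEq V] (G : SimpleGraph V) [DecidableRel G.Adj]

/-- Transition matrix of the walk `RW(G_1)`. -/
def trans : Matrix V V ℝ := fun v u => mhWeight G (fun _ => 1) v u

theorem trans_nonneg (v u : V) : 0 ≤ trans G v u := NNReal.coe_nonneg _

theorem sum_trans (v : V) : ∑ u, trans G v u = 1 := by
  have := sum_mhWeight_one G v
  rw [← NNReal.coe_inj] at this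
  simpa [trans] using this

theorem trans_adj {v u : V} (h : G.Adj v u) :
    trans G v u = min (1 / (G.degree v : ℝ)) (1 / (G.degree u : ℝ)) := by
  simp [trans, mhWeight, h, h.ne']

theorem trans_eq_zero {v u : V} (h : ¬ G.Adj v u) (hne : u ≠ v) : trans G v u = 0 := by
  simp [trans, mhWeight, h, hne]

theorem trans_comm (v u : V) : trans G v u = trans G u v := by
  by_cases h : G.Adj v u
  · rw [trans_adj G h, trans_adj G h.symm, min_comm]
  · by_cases hne : u = v
    · rw [hne]
    · rw [trans_eq_zero G h hne, trans_eq_zero G (fun h' => h h'.symm) (Ne.symm hne)]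

theorem trans_transpose : (trans G).transpose = trans G := by
  ext v u; exact trans_comm G u v

theorem unitStep_apply_eq (v u : V) : unitStep G v u = ENNReal.ofReal (trans G v u) := by
  rw [unitStep_apply, trans, ENNReal.ofReal_coe_nnreal]

theorem reachable_of_trans_ne_zero {v u : V} (h : trans G v u ≠ 0) : G.Reachable v u := by
  by_cases hne : u = v
  · rw [hne]
  · by_contra hn
    exact h (trans_eq_zero G (fun h => hn h.reachable) hne)

/-- `1 / P(v, u) = max (deg v) (deg u)`. -/
theorem trans_mul_max {v u : V} (h : G.Adj v u) :
    trans G v u * max (G.degree v : ℝ) (G.degree u) = 1 := by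
  have hv : (0 : ℝ) < G.degree v := by exact_mod_cast (G.degree_pos_iff_exists_adj v).2 ⟨u, h⟩
  have hu : (0 : ℝ) < G.degree u := by exact_mod_cast (G.degree_pos_iff_exists_adj u).2 ⟨v, h.symm⟩
  rw [trans_adj G h]
  rcases le_total (G.degree v : ℝ) (G.degree u) with hle | hle
  · rw [max_eq_right hle, min_eq_right (one_div_le_one_div_of_le hv hle)]
    field_simp
  · rw [max_eq_left hle, min_eq_left (one_div_le_one_div_of_le hu hle)]
    field_simp

/-- Green function: expected number of visits to `w` at the times `0, …, j - 1`. -/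
def green (j : ℕ) : Matrix V V ℝ := ∑ k ∈ Finset.range j, trans G ^ k

theorem green_zero (v w : V) : green G 0 v w = 0 := by simp [green]

theorem green_succ (j : ℕ) (v w : V) :
    green G (j + 1) v w = (if v = w then 1 else 0) + ∑ u, trans G v u * green G j u w := by
  have : green G (j + 1) = 1 + trans G * green G j := by
    rw [green, geom_sum_succ, add_comm]; rfl
  rw [this, Matrix.add_apply, Matrix.mul_apply, Matrix.one_apply]

/-- The uniform distribution is reversible for the walk. This allows the visits to `u` from random
landmarks to be treated as visits to landmarks from `u`. -/
theorem green_comm (j : ℕ) (v w : V) : green G j v w = green G j w v := by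
  have : (green G j).transpose = green G j := by
    simp [green, Matrix.transpose_sum, Matrix.transpose_pow, trans_transpose]
  conv_lhs => rw [← this]
  rfl

theorem green_nonneg (j : ℕ) (v w : V) : 0 ≤ green G j v w := by
  induction j generalizing v with
  | zero => rw [green_zero]
  | succ j ih =>
    rw [green_succ]
    refine add_nonneg (by split_ifs <;> norm_num)
      (Finset.sum_nonneg fun u _ => mul_nonneg (trans_nonneg G v u) (ih u))

theorem green_le_succ (j : ℕ) (v w : V) : green G j v w ≤ green G (j + 1) v w := by
  induction j generalizing v with
  | zero => rw [green_zero]; exact green_nonneg G _ _ _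
  | succ j ih =>
    rw [green_succ G j, green_succ G (j + 1)]
    gcongr with u
    · exact trans_nonneg G v u
    · exact ih u

theorem green_mono {j k : ℕ} (h : j ≤ k) (v w : V) : green G j v w ≤ green G k v w :=
  monotone_nat_of_le_succ (f := fun j => green G j v w) (fun j => green_le_succ G j v w) h

theorem sum_green (j : ℕ) (v : V) : ∑ w, green G j v w = j := by
  induction j generalizing v with
  | zero => simp [green_zero]
  | succ j ih =>
    simp only [green_succ, Finset.sum_add_distrib, Finset.sum_ite_eq, Finset.mem_univ, if_true]
    rw [Finset.sum_comm]
    simp only [← Finset.mul_sum, ih, ← Finset.sum_mul, sum_trans]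
    push_cast; ring

/-- The maximum principle. -/
theorem green_le_diag {j k : ℕ} (h : j ≤ k) (v w : V) : green G j v w ≤ green G k w w := by
  induction j generalizing v with
  | zero => rw [green_zero]; exact green_nonneg G _ _ _
  | succ j ih =>
    -- At `w` itself monotonicity in time suffices; elsewhere the value is an average of values with
    -- one step less.
    by_cases hvw : v = w
    · rw [hvw]; exact green_mono G h w w
    · rw [green_succ, if_neg hvw, zero_add]
      calc ∑ u, trans G v u * green G j u w ≤ ∑ u, trans G v u * green G k w w := by
            gcongr with u
            · exact trans_nonneg G v u
            · exact ih (by omega) u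
        _ = green G k w w := by rw [← Finset.sum_mul, sum_trans, one_mul]

theorem green_eq_zero {v w : V} (h : ¬ G.Reachable v w) (j : ℕ) : green G j v w = 0 := by
  induction j generalizing v with
  | zero => exact green_zero G v w
  | succ j ih =>
    rw [green_succ, if_neg (by rintro rfl; exact h (.refl _)), zero_add]
    refine Finset.sum_eq_zero fun u _ => ?_
    by_cases hu : trans G v u = 0
    · rw [hu, zero_mul]
    · rw [ih fun h' => h ((reachable_of_trans_ne_zero G hu).trans h'), mul_zero]

/-- The walk spends one unit of time at its start. -/
theorem one_le_green {k : ℕ} (hk : 1 ≤ k) (w : V) : 1 ≤ green G k w w := by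
  obtain ⟨j, rfl⟩ := Nat.exists_eq_add_of_le' hk
  rw [green_succ, if_pos rfl]
  exact le_add_of_nonneg_right (Finset.sum_nonneg fun u _ =>
    mul_nonneg (trans_nonneg G w u) (green_nonneg G _ _ _))

/-! ### Energy -/

/-- Dirichlet energy. -/
def energy (f : V → ℝ) : ℝ := (∑ v, ∑ u, trans G v u * (f v - f u) ^ 2) / 2

theorem energy_eq (f : V → ℝ) : energy G f = ∑ v, f v * (f v - ∑ u, trans G v u * f u) := by
  have h1 : ∑ v, ∑ u, trans G v u * f v ^ 2 = ∑ v, f v ^ 2 := by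
    simp only [← Finset.sum_mul, sum_trans, one_mul]
  have h2 : ∑ v, ∑ u, trans G v u * f u ^ 2 = ∑ v, f v ^ 2 := by
    rw [Finset.sum_comm]
    simp only [trans_comm G _ _, ← Finset.sum_mul]
    refine Finset.sum_congr rfl fun v _ => ?_
    simp only [sum_trans, one_mul]
  have h3 : ∑ v, ∑ u, trans G v u * (f v - f u) ^ 2 =
      ∑ v, ∑ u, trans G v u * f v ^ 2 + ∑ v, ∑ u, trans G v u * f u ^ 2 -
        2 * ∑ v, f v * ∑ u, trans G v u * f u := by
    simp only [Finset.mul_sum, ← Finset.sum_add_distrib, ← Finset.sum_sub_distrib]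
    refine Finset.sum_congr rfl fun v _ => Finset.sum_congr rfl fun u _ => by ring
  rw [energy, h3, h1, h2]
  simp only [mul_sub, Finset.sum_sub_distrib]
  have : ∑ v, f v * f v = ∑ v, f v ^ 2 := Finset.sum_congr rfl fun v _ => by ring
  rw [this]; ring

/-- The geometric sum satisfies `(1 - P) ∑_{k<j} P^k = 1 - P^j`. Hence summation by parts gives the
value at `w` minus a nonnegative term. -/
theorem energy_green_le (j : ℕ) (w : V) : energy G (fun v => green G j v w) ≤ green G j w w := by
  rw [energy_eq]
  have h1 : ∀ v, green G j v w - ∑ u, trans G v u * green G j u w =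
      (if v = w then 1 else 0) - (trans G ^ j) v w := by
    intro v
    have := congrFun (congrFun (mul_neg_geom_sum (trans G) j) v) w
    rw [Matrix.sub_mul, Matrix.one_mul, Matrix.sub_apply, Matrix.sub_apply, Matrix.one_apply,
      Matrix.mul_apply] at this
    exact this
  have h2 : ∀ k v, 0 ≤ (trans G ^ k) v w := by
    intro k
    induction k with
    | zero => intro v; rw [pow_zero, Matrix.one_apply]; split_ifs <;> norm_num
    | succ k ih =>
      intro v
      rw [pow_succ', Matrix.mul_apply]
      exact Finset.sum_nonneg fun u _ => mul_nonneg (trans_nonneg G v u) (ih u)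
  calc _ = ∑ v, (if v = w then green G j v w else 0) - ∑ v, green G j v w * (trans G ^ j) v w := by
        rw [← Finset.sum_sub_distrib]
        refine Finset.sum_congr rfl fun v _ => ?_
        rw [h1]; split_ifs <;> ring
    _ ≤ ∑ v, (if v = w then green G j v w else 0) := by
        refine sub_le_self _ (Finset.sum_nonneg fun v _ => mul_nonneg (green_nonneg G j v w) (h2 j v))
    _ = green G j w w := by simp

end Landmark

/-! ### Geodesics and bounds on the Green function -/

namespace Landmark

variable {V : Type} [Fintype V] [DecidableEq V] (G : SimpleGraph V) [DecidableRel G.Adj]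

/-- `x 0, …, x m` is a shortest path. -/
structure Geodesic {V : Type} (G : SimpleGraph V) (x : ℕ → V) (m : ℕ) : Prop where
  adj : ∀ k < m, G.Adj (x k) (x (k + 1))
  dist : ∀ k ≤ m, G.dist (x 0) (x k) = k

theorem exists_geodesic {V : Type} {G : SimpleGraph V} {a b : V} (h : G.Reachable a b) :
    ∃ x : ℕ → V, x 0 = a ∧ x (G.dist a b) = b ∧ Geodesic G x (G.dist a b) := by
  obtain ⟨p, hp⟩ := h.exists_walk_length_eq_dist
  have hadj : ∀ k < G.dist a b, G.Adj (p.getVert k) (p.getVert (k + 1)) := fun k hk =>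
    p.adj_getVert_succ (by omega)
  have hlast : p.getVert (G.dist a b) = b := by rw [← hp, p.getVert_length]
  refine ⟨p.getVert, p.getVert_zero, hlast, hadj, fun k hk => ?_⟩
  rw [p.getVert_zero]
  have h1 : ∀ k ≤ G.dist a b, G.dist a (p.getVert k) ≤ k := by
    intro k hk
    induction k with
    | zero => simp
    | succ k ih =>
      have h2 := ih (by omega)
      have h3 := (hadj k (by omega)).diff_dist_adj (u := a)
      omega
  -- Counting back from the end point gives the lower bound on the distance from `a`.
  have h2 : ∀ j k, k + j = G.dist a b → G.dist a b ≤ G.dist a (p.getVert k) + j := by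
    intro j
    induction j with
    | zero => intro k hk; rw [show k = G.dist a b by omega, hlast]; omega
    | succ j ih =>
      intro k hk
      have h2 := ih (k + 1) (by omega)
      have h3 := (hadj k (by omega)).diff_dist_adj (u := a)
      omega
  have h3 := h1 k hk
  have h4 := h2 (G.dist a b - k) k (by omega)
  omega

/-- Resistance of a path. -/
def resistance (x : ℕ → V) (m : ℕ) : ℝ :=
  ∑ k ∈ Finset.range m, max (G.degree (x k) : ℝ) (G.degree (x (k + 1)))

/-- Cauchy–Schwarz along the path, with the conductances `trans` and their inverses, the maxima of
the two degrees. -/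
theorem sq_sub_le_resistance {x : ℕ → V} {m : ℕ} (hx : Geodesic G x m) (f : V → ℝ) :
    (f (x 0) - f (x m)) ^ 2 ≤ resistance G x m * energy G f := by
  set g : V × V → ℝ := fun q => trans G q.1 q.2 * (f q.1 - f q.2) ^ 2 with hg
  have hg0 : ∀ q, 0 ≤ g q := fun q => mul_nonneg (trans_nonneg G _ _) (sq_nonneg _)
  have h1 : (∑ k ∈ Finset.range m, (f (x k) - f (x (k + 1)))) ^ 2 ≤
      resistance G x m * ∑ k ∈ Finset.range m, g (x k, x (k + 1)) := by
    refine Finset.sum_sq_le_sum_mul_sum_of_sq_le_mul _ (fun k _ => by positivity)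
      (fun k _ => hg0 _) fun k hk => ?_
    have := trans_mul_max G (hx.adj k (Finset.mem_range.1 hk))
    simp only [hg]
    refine le_of_eq ?_
    linear_combination (-(f (x k) - f (x (k + 1))) ^ 2) * this
  rw [Finset.sum_range_sub'] at h1
  refine h1.trans (mul_le_mul_of_nonneg_left ?_ (Finset.sum_nonneg fun k _ => by positivity))
  have hinj : ∀ k < m, ∀ l < m, (x k = x l → k = l) ∧ (x k = x (l + 1) → k = l + 1) ∧
      (x (k + 1) = x (l + 1) → k = l) := by
    intro k hk l hl
    have d1 := hx.dist k (by omega)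
    have d2 := hx.dist (k + 1) (by omega)
    have d3 := hx.dist l (by omega)
    have d4 := hx.dist (l + 1) (by omega)
    refine ⟨fun h => ?_, fun h => ?_, fun h => ?_⟩
    · rw [h] at d1; omega
    · rw [h] at d1; omega
    · rw [h] at d2; omega
  -- A geodesic uses no edge twice. Both orientations of each of its edges occur in the double sum,
  -- which absorbs the factor `1 / 2` in the energy.
  set A := (Finset.range m).image fun k => (x k, x (k + 1))
  set B := (Finset.range m).image fun k => (x (k + 1), x k)
  have hA : ∑ q ∈ A, g q = ∑ k ∈ Finset.range m, g (x k, x (k + 1)) := by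
    refine Finset.sum_image fun k hk l hl h => ?_
    simp only [Finset.coe_range, Set.mem_Iio] at hk hl
    exact (hinj k hk l hl).1 (Prod.ext_iff.1 h).1
  have hB : ∑ q ∈ B, g q = ∑ k ∈ Finset.range m, g (x k, x (k + 1)) := by
    rw [Finset.sum_image fun k hk l hl h => ?_]
    · refine Finset.sum_congr rfl fun k _ => ?_
      simp only [hg]
      rw [trans_comm]; ring
    · simp only [Finset.coe_range, Set.mem_Iio] at hk hl
      exact (hinj k hk l hl).1 (Prod.ext_iff.1 h).2
  have hAB : Disjoint A B := by
    rw [Finset.disjoint_left]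
    intro q hqA hqB
    obtain ⟨k, hk, rfl⟩ := Finset.mem_image.1 hqA
    obtain ⟨l, hl, h⟩ := Finset.mem_image.1 hqB
    rw [Finset.mem_range] at hk hl
    rw [Prod.ext_iff] at h
    have h1 := (hinj k hk l hl).2.1 h.1.symm
    have h2 := (hinj l hl k hk).2.1 h.2
    omega
  have h2 : ∑ q ∈ A ∪ B, g q ≤ ∑ q, g q :=
    Finset.sum_le_sum_of_subset_of_nonneg (Finset.subset_univ _) fun q _ _ => hg0 q
  rw [Finset.sum_union hAB, hA, hB, Fintype.sum_prod_type] at h2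
  rw [energy]
  simp only [hg] at h2 ⊢
  linarith

/-- The resistance of an edge is the degree of one of its ends, so the sum counts adjacencies
between the path and `S`. A node sees only a bounded stretch of a geodesic. -/
theorem resistance_le {x : ℕ → V} {m : ℕ} (hx : Geodesic G x m) {S : Finset V}
    (hS : ∀ k ≤ m, ∀ y, G.Adj (x k) y → y ∈ S) : resistance G x m ≤ 4 * S.card := by
  have hch : ∀ k, ∃ y, (y = x k ∨ y = x (k + 1)) ∧
      max (G.degree (x k) : ℝ) (G.degree (x (k + 1))) = G.degree y := by
    intro k
    rcases max_choice (G.degree (x k) : ℝ) (G.degree (x (k + 1))) with h | h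
    · exact ⟨_, .inl rfl, h⟩
    · exact ⟨_, .inr rfl, h⟩
  choose y hy hd using hch
  have h1 : ∀ k < m, G.degree (y k) = ∑ v ∈ S, if G.Adj (y k) v then 1 else 0 := by
    intro k hk
    rw [← Finset.card_filter, ← G.card_neighborFinset_eq_degree]
    congr 1
    ext v
    rw [SimpleGraph.mem_neighborFinset, Finset.mem_filter]
    refine ⟨fun h => ⟨?_, h⟩, fun h => h.2⟩
    rcases hy k with h' | h' <;> rw [h'] at h
    · exact hS k (by omega) v h
    · exact hS (k + 1) (by omega) v h
  have h2 : ∑ k ∈ Finset.range m, G.degree (y k) ≤ 4 * S.card := by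
    rw [Finset.sum_congr rfl fun k hk => h1 k (Finset.mem_range.1 hk), Finset.sum_comm]
    rw [mul_comm]
    refine Finset.sum_le_card_nsmul S _ 4 fun v _ => ?_
    rw [← Finset.card_filter]
    set δ := G.dist (x 0) v
    -- `y k` lies at distance `k` or `k + 1` from the start, and within `1` of `δ`; this leaves four
    -- values of `k`.
    have hsub : (Finset.range m).filter (fun k => G.Adj (y k) v) ⊆ Finset.Icc (δ - 2) (δ + 1) := by
      intro k hk
      rw [Finset.mem_filter, Finset.mem_range] at hk
      have h3 := hk.2.diff_dist_adj (u := x 0)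
      have h4 := hx.dist k (by omega)
      have h5 := hx.dist (k + 1) (by omega)
      rw [Finset.mem_Icc]
      rcases hy k with h' | h' <;> rw [h'] at h3 <;> omega
    refine (Finset.card_le_card hsub).trans ?_
    rw [Nat.card_Icc]; omega
  rw [resistance]
  simp only [hd]
  exact_mod_cast h2

open Classical in
/-- Either the walk from `s` is likely to visit `t`, or the component is large. -/
theorem sq_le_card_sq {s t : V} (h : G.Reachable s t) {T : ℕ} (hT : 1 ≤ T)
    (hsmall : green G T s t < 0.01 * green G T t t) :
    0.9801 * (T : ℝ) ≤ 4 * ((Finset.univ.filter fun v => G.Reachable s v).card : ℝ) ^ 2 := by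
  set U := Finset.univ.filter fun v => G.Reachable s v with hU
  set F := green G T t t with hF
  have hF1 : 1 ≤ F := one_le_green G hT t
  obtain ⟨x, hx0, hxm, hx⟩ := exists_geodesic h.symm
  have hreach : ∀ k ≤ G.dist t s, G.Reachable s (x k) := by
    intro k hk
    induction k with
    | zero => rw [hx0]; exact h
    | succ k ih => exact (ih (by omega)).trans (hx.adj k (by omega)).reachable
  have hR := resistance_le G hx (S := U) fun k hk y hy => by
    rw [hU, Finset.mem_filter]
    exact ⟨Finset.mem_univ _, (hreach k hk).trans hy.reachable⟩
  have h1 := sq_sub_le_resistance G hx fun v => green G T v t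
  simp only [hx0, hxm] at h1
  have h2 := energy_green_le G T t
  have h3 : resistance G x (G.dist t s) * energy G (fun v => green G T v t) ≤ 4 * U.card * F := by
    exact (mul_le_mul_of_nonneg_left h2 (Finset.sum_nonneg fun k _ => by positivity)).trans
      (mul_le_mul_of_nonneg_right hR (by linarith))
  have h4 : (0.99 * F) ^ 2 ≤ (F - green G T s t) ^ 2 := by
    refine pow_le_pow_left₀ (by linarith) (by linarith) 2
  -- `0.9801 = 0.99²`. The potential drop bounds `F` by the size of the component; total visits, `T
  -- ≤ |U| F`, then give the claim.
  have h5 : 0.9801 * F ≤ 4 * U.card := by nlinarith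
  have h6 : (T : ℝ) ≤ U.card * F := by
    rw [← sum_green G T t, ← nsmul_eq_mul]
    have hsub : ∑ w, green G T t w = ∑ w ∈ U, green G T t w := by
      symm
      refine Finset.sum_subset (Finset.subset_univ _) fun w _ hw => ?_
      refine green_eq_zero G (fun h' => hw ?_) T
      rw [hU, Finset.mem_filter]
      exact ⟨Finset.mem_univ _, h.trans h'⟩
    rw [hsub]
    refine Finset.sum_le_card_nsmul U _ F fun w _ => ?_
    rw [green_comm]
    exact green_le_diag G le_rfl w t
  have h7 : (0 : ℝ) ≤ U.card := Nat.cast_nonneg _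
  nlinarith

open Classical in
/-- In a large component there are few visits to each node. -/
theorem green_diag_le {w : V} {T : ℕ} {M : ℝ} (hT : 1 ≤ T) (hM : 0 < M) (hMT : M ^ 2 = T)
    (hΔ : (G.maxDegree : ℝ) ≤ 1.4143 * M)
    (hN : 0.9801 * (T : ℝ) ≤ 4 * ((Finset.univ.filter fun v => G.Reachable w v).card : ℝ) ^ 2) :
    green G T w w ≤ 8.4 * M := by
  set U := Finset.univ.filter fun v => G.Reachable w v with hU
  set F := green G T w w with hF
  have hF1 : 1 ≤ F := one_le_green G hT w
  -- The nodes of high potential. As the potential sums to `T = M²`, an assumed `F > 8.4 M` makes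
  -- this set smaller than `M / 2.0412`, where `2.0412 = 0.243 * 8.4`. The component has at least
  -- `0.495 M` nodes, `0.495² = 0.9801 / 4`, and cannot fit into it.
  set S := Finset.univ.filter fun v => 0.243 * F ≤ green G T v w with hS
  have hSF : 0.243 * F * S.card ≤ M ^ 2 := by
    have h1 : (S.card : ℝ) * (0.243 * F) ≤ ∑ v ∈ S, green G T v w := by
      rw [← nsmul_eq_mul]
      refine Finset.card_nsmul_le_sum S _ _ fun v hv => ?_
      rw [hS, Finset.mem_filter] at hv
      exact hv.2
    have h2 : ∑ v ∈ S, green G T v w ≤ ∑ v, green G T v w :=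
      Finset.sum_le_sum_of_subset_of_nonneg (Finset.subset_univ _) fun v _ _ =>
        green_nonneg G T v w
    have h3 : ∑ v, green G T v w = T := by
      rw [← sum_green G T w]
      exact Finset.sum_congr rfl fun v _ => green_comm G T v w
    rw [hMT]; linarith
  have hNM : 0.495 * M ≤ U.card := by
    refine abs_le_of_sq_le_sq' ?_ (Nat.cast_nonneg _) |>.2
    rw [← hMT] at hN
    linarith
  by_contra! hbig
  by_cases hUS : U ⊆ S
  · have h1 : (U.card : ℝ) ≤ S.card := by exact_mod_cast Finset.card_le_card hUS
    have h2 : 0.243 * (8.4 * M) * (0.495 * M) < M ^ 2 := by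
      refine lt_of_lt_of_le ?_ hSF
      have h3 : 0 < 0.495 * M := by linarith
      calc 0.243 * (8.4 * M) * (0.495 * M) < 0.243 * F * (0.495 * M) := by gcongr
        _ ≤ 0.243 * F * S.card := by gcongr; linarith
    nlinarith
  -- A nearest node `z` outside `S`: everything closer to `w` has high potential, which confines the
  -- geodesic to `z` and the neighborhoods of all but its last two nodes.
  · have hex : ∃ d z, G.Reachable w z ∧ z ∉ S ∧ G.dist w z = d := by
      obtain ⟨z, hz, hz'⟩ := Finset.not_subset.1 hUS
      rw [hU, Finset.mem_filter] at hz
      exact ⟨_, z, hz.2, hz', rfl⟩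
    obtain ⟨z, hwz, hzS, hdz⟩ := Nat.find_spec hex
    have hmin : ∀ y, G.Reachable w y → G.dist w y < G.dist w z → y ∈ S := by
      intro y hy hlt
      by_contra hyS
      exact Nat.find_min hex (hdz ▸ hlt) ⟨y, hy, hyS, rfl⟩
    obtain ⟨x, hx0, hxm, hx⟩ := exists_geodesic hwz
    set m := G.dist w z with hm
    have hreach : ∀ k ≤ m, G.Reachable w (x k) := by
      intro k hk
      induction k with
      | zero => rw [hx0]
      | succ k ih => exact (ih (by omega)).trans (hx.adj k (by omega)).reachable
    -- Neighbors of the last two nodes may leave `S`, so the last two edges are bounded by the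
    -- maximum degree instead.
    have hR : resistance G x m ≤ 4 * S.card + 2 * G.maxDegree := by
      have hmaxd : ∀ k, max (G.degree (x k) : ℝ) (G.degree (x (k + 1))) ≤ G.maxDegree := fun k =>
        max_le (by exact_mod_cast G.degree_le_maxDegree _) (by exact_mod_cast G.degree_le_maxDegree _)
      have hsplit : resistance G x m ≤ resistance G x (m - 2) + 2 * G.maxDegree := by
        have hstep : ∀ k, resistance G x k ≤ resistance G x (k - 1) + G.maxDegree := by
          intro k
          cases k with
          | zero => simp
          | succ k =>
            rw [Nat.add_sub_cancel, resistance, Finset.sum_range_succ]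
            exact add_le_add_right (hmaxd k) _
        have h1 := hstep m
        have h2 := hstep (m - 1)
        rw [Nat.sub_sub] at h2
        linarith
      rcases Nat.lt_or_ge m 2 with h2 | h2
      · have h0 : resistance G x (m - 2) = 0 := by
          rw [Nat.sub_eq_zero_of_le h2.le]; simp [resistance]
        have : (0 : ℝ) ≤ S.card := Nat.cast_nonneg _
        linarith
      · have := resistance_le G (m := m - 2) (S := S)
          ⟨fun k hk => hx.adj k (by omega), fun k hk => hx.dist k (by omega)⟩ fun k hk y hy => by
            refine hmin y ((hreach k (by omega)).trans hy.reachable) ?_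
            have h3 := hy.diff_dist_adj (u := w)
            have h4 := hx.dist k (by omega)
            rw [hx0] at h4
            omega
        linarith
    have h1 := sq_sub_le_resistance G hx fun v => green G T v w
    simp only [hx0, hxm] at h1
    have h2 := energy_green_le G T w
    have h3 : resistance G x m * energy G (fun v => green G T v w) ≤
        (4 * S.card + 2 * G.maxDegree) * F := by
      have hR0 : 0 ≤ resistance G x m := Finset.sum_nonneg fun k _ => by positivity
      calc _ ≤ resistance G x m * F := by gcongr
        _ ≤ _ := by gcongr
    have hz : green G T z w < 0.243 * F := by
      rw [hS, Finset.mem_filter] at hzS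
      push Not at hzS
      exact hzS (Finset.mem_univ _)
    have h4 : (0.757 * F) ^ 2 ≤ (F - green G T z w) ^ 2 := by
      refine pow_le_pow_left₀ (by linarith) (by linarith) 2
    -- `0.573049 = 0.757²` with `0.757 = 1 - 0.243`. The right side is at most `(4 / 2.0412 + 2 *
    -- 1.4143) M < 4.79 M`, while `0.573049 * 8.4 > 4.81`.
    have h5 : 0.573049 * F ≤ 4 * S.card + 2 * G.maxDegree := by nlinarith
    have h6 : (S.card : ℝ) * 2.0412 ≤ M := by
      have : (S.card : ℝ) * (0.243 * (8.4 * M)) ≤ M ^ 2 := by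
        refine le_trans ?_ hSF
        rw [mul_comm]
        gcongr
      nlinarith
    linarith

end Landmark

/-! ### Path expectations, avoidance and hitting probabilities -/

namespace Landmark

variable {V : Type} [Fintype V] [DecidableEq V] (G : SimpleGraph V) [DecidableRel G.Adj]

/-- Expectation of a function of the positions of the walk from `v` at the times `0, …, k`. -/
def pathExp : ℕ → V → (List V → ℝ) → ℝ
  | 0, v, Φ => Φ [v]
  | k + 1, v, Φ => ∑ u, trans G v u * pathExp k u fun l => Φ (v :: l)

/-- Probability that the walk from `v` avoids `S` at the times `0, …, k`. -/
def avoid (S : Finset V) : ℕ → V → ℝ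
  | 0, v => if v ∈ S then 0 else 1
  | k + 1, v => if v ∈ S then 0 else ∑ u, trans G v u * avoid S k u

/-- Probability that the walk from `v` hits `S` at one of the times `0, …, k`. -/
def hit (S : Finset V) (k : ℕ) (v : V) : ℝ := 1 - avoid G S k v

/-- Indicator of the lists that avoid `S`. -/
def avoidInd (S : Finset V) (l : List V) : ℝ := if ∀ x ∈ l, x ∉ S then 1 else 0

variable {G}

theorem pathExp_mono {k : ℕ} {v : V} {Φ Ψ : List V → ℝ}
    (h : ∀ l, l.length = k + 1 → Φ l ≤ Ψ l) : pathExp G k v Φ ≤ pathExp G k v Ψ := by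
  induction k generalizing v Φ Ψ with
  | zero => exact h _ rfl
  | succ k ih =>
    exact Finset.sum_le_sum fun u _ => mul_le_mul_of_nonneg_left
      (ih fun l hl => h _ (by simp [hl])) (trans_nonneg G v u)

theorem pathExp_add (k : ℕ) (v : V) (Φ Ψ : List V → ℝ) :
    pathExp G k v (fun l => Φ l + Ψ l) = pathExp G k v Φ + pathExp G k v Ψ := by
  induction k generalizing v Φ Ψ with
  | zero => rfl
  | succ k ih => simp only [pathExp, ih, mul_add, Finset.sum_add_distrib]

theorem pathExp_const_mul (k : ℕ) (v : V) (a : ℝ) (Φ : List V → ℝ) :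
    pathExp G k v (fun l => a * Φ l) = a * pathExp G k v Φ := by
  induction k generalizing v Φ with
  | zero => rfl
  | succ k ih =>
    simp only [pathExp, ih, Finset.mul_sum]
    exact Finset.sum_congr rfl fun u _ => by ring

theorem pathExp_const (k : ℕ) (v : V) (a : ℝ) : pathExp G k v (fun _ => a) = a := by
  induction k generalizing v with
  | zero => rfl
  | succ k ih => rw [pathExp]; simp only [ih, ← Finset.sum_mul, sum_trans, one_mul]

theorem pathExp_sum {ι : Type} (s : Finset ι) (k : ℕ) (v : V) (Φ : ι → List V → ℝ) :
    pathExp G k v (fun l => ∑ i ∈ s, Φ i l) = ∑ i ∈ s, pathExp G k v (Φ i) := by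
  classical
  induction s using Finset.induction_on with
  | empty => simp only [Finset.sum_empty]; exact pathExp_const k v 0
  | insert i s hi ih => simp only [Finset.sum_insert hi, pathExp_add, ih]

theorem pathExp_avoidInd (S : Finset V) (k : ℕ) (v : V) :
    pathExp G k v (avoidInd S) = avoid G S k v := by
  induction k generalizing v with
  | zero => by_cases h : v ∈ S <;> simp [pathExp, avoid, avoidInd, h]
  | succ k ih =>
    rw [pathExp, avoid]
    by_cases h : v ∈ S
    · simp only [avoidInd, List.mem_cons, forall_eq_or_imp, h, not_true_eq_false, false_and,
        if_false, if_true]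
      exact Finset.sum_eq_zero fun u _ => by rw [pathExp_const, mul_zero]
    · rw [if_neg h]
      refine Finset.sum_congr rfl fun u _ => ?_
      rw [← ih u]
      congr 2
      funext l
      simp [avoidInd, h]

theorem pathExp_count (k : ℕ) (v w : V) :
    pathExp G k v (fun l => (l.count w : ℝ)) = green G (k + 1) v w := by
  induction k generalizing v with
  | zero =>
    rw [green_succ]
    simp [pathExp, green_zero, List.count_singleton]
  | succ k ih =>
    rw [green_succ, pathExp]
    have : ∀ u, pathExp G k u (fun l => ((v :: l).count w : ℝ)) =
        green G (k + 1) u w + if v = w then 1 else 0 := by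
      intro u
      rw [← ih u]
      rw [← pathExp_const (G := G) k u (if v = w then (1 : ℝ) else 0), ← pathExp_add]
      congr 1
      funext l
      rw [List.count_cons]
      push_cast
      simp
    simp only [this, mul_add, Finset.sum_add_distrib, ← Finset.sum_mul, sum_trans, one_mul]
    ring

/-- The expected sum of the squares of the numbers of visits. -/
theorem pathExp_sum_sq_count_le {T : ℕ} {F : ℝ} {k : ℕ} {v : V} (hk : k + 1 ≤ T)
    (hF : ∀ w, G.Reachable v w → green G T w w ≤ F) :
    pathExp G k v (fun l => ∑ w, (l.count w : ℝ) ^ 2) ≤ 2 * F * (k + 1) := by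
  have hF1 : 1 ≤ F := (one_le_green G (by omega) v).trans (hF v (.refl v))
  induction k generalizing v with
  | zero =>
    have : ∑ w, (([v] : List V).count w : ℝ) ^ 2 = 1 := by
      simp [List.count_singleton]
    rw [pathExp, this]
    push_cast; linarith
  | succ k ih =>
    -- Prepending the start raises the sum of squares by twice the later visits to it, plus one.
    have hQ : ∀ l : List V, ∑ w, ((v :: l).count w : ℝ) ^ 2 =
        ∑ w, (l.count w : ℝ) ^ 2 + (2 * (l.count v : ℝ) + 1) := by
      intro l
      have : ∀ w, ((v :: l).count w : ℝ) ^ 2 = (l.count w : ℝ) ^ 2 +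
          if v = w then 2 * (l.count w : ℝ) + 1 else 0 := by
        intro w
        rw [List.count_cons]
        by_cases h : v = w
        · simp [h]; ring
        · simp [h]
      simp only [this, Finset.sum_add_distrib, Finset.sum_ite_eq, Finset.mem_univ, if_true]
    rw [pathExp]
    simp only [hQ, pathExp_add, pathExp_const_mul, pathExp_const, pathExp_count]
    have h1 : ∀ u, trans G v u * (pathExp G k u (fun l => ∑ w, (l.count w : ℝ) ^ 2) +
        (2 * green G (k + 1) u v + 1)) ≤
        trans G v u * (2 * F * (k + 1) + 1) + 2 * (trans G v u * green G (k + 1) u v) := by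
      intro u
      by_cases hu : trans G v u = 0
      · simp [hu]
      · have hr := reachable_of_trans_ne_zero G hu
        have := ih (v := u) (by omega) (fun w hw => hF w (hr.trans hw))
        have := mul_le_mul_of_nonneg_left this (trans_nonneg G v u)
        linarith
    refine (Finset.sum_le_sum fun u _ => h1 u).trans ?_
    rw [Finset.sum_add_distrib, ← Finset.sum_mul, sum_trans, ← Finset.mul_sum]
    -- The expected number of later visits to `v` is a diagonal Green value minus `1`, so the
    -- increment is at most `2 (F - 1) + 1 ≤ 2 F`.
    have h2 := green_succ G (k + 1) v v
    rw [if_pos rfl] at h2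
    have h3 := (green_mono G hk v v).trans (hF v (.refl v))
    push_cast
    linarith

theorem avoid_nonneg (S : Finset V) (k : ℕ) (v : V) : 0 ≤ avoid G S k v := by
  induction k generalizing v with
  | zero => rw [avoid]; split_ifs <;> norm_num
  | succ k ih =>
    rw [avoid]
    split_ifs
    · exact le_rfl
    · exact Finset.sum_nonneg fun u _ => mul_nonneg (trans_nonneg G v u) (ih u)

theorem avoid_le_one (S : Finset V) (k : ℕ) (v : V) : avoid G S k v ≤ 1 := by
  rw [← pathExp_avoidInd, ← pathExp_const (G := G) k v 1]
  refine pathExp_mono fun l _ => ?_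
  rw [avoidInd]; split_ifs <;> norm_num

theorem avoid_anti {S S' : Finset V} (h : S ⊆ S') (k : ℕ) (v : V) :
    avoid G S' k v ≤ avoid G S k v := by
  rw [← pathExp_avoidInd, ← pathExp_avoidInd]
  refine pathExp_mono fun l _ => ?_
  by_cases hl : ∀ x ∈ l, x ∉ S'
  · rw [avoidInd, avoidInd, if_pos hl, if_pos fun x hx hxS => hl x hx (h hxS)]
  · rw [avoidInd, if_neg hl, avoidInd]; split_ifs <;> norm_num

/-- This is the union bound for hitting `A ∪ B`, written for the complements. -/
theorem avoid_add_avoid_le (A B : Finset V) (k : ℕ) (v : V) :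
    avoid G A k v + avoid G B k v ≤ 1 + avoid G (A ∪ B) k v := by
  suffices H : pathExp G k v (fun l => avoidInd A l + avoidInd B l) ≤
      pathExp G k v fun l => 1 + avoidInd (A ∪ B) l by
    have e : ∀ S, pathExp G k v (fun l => avoidInd S l) = avoid G S k v := fun S =>
      pathExp_avoidInd S k v
    simpa only [pathExp_add, pathExp_const, e] using H
  refine pathExp_mono fun l _ => ?_
  have h : (∀ x ∈ l, x ∉ A ∪ B) ↔ (∀ x ∈ l, x ∉ A) ∧ ∀ x ∈ l, x ∉ B := by
    simp only [Finset.mem_union, not_or, forall_and]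
  simp only [avoidInd, h]
  split_ifs <;> first | (exfalso; tauto) | norm_num

/-- The sum over `w` describes one more random landmark. Its gain is the expected number of distinct
nodes seen by walks that avoid `S`, and by Cauchy–Schwarz this is at least `(T Z)²` over the
expected sum of squared visit counts, which is at most `2 F T`. Here `Z` is the probability of
avoiding `S`. -/
theorem sq_le_sum_avoid_insert {T : ℕ} {F : ℝ} {v : V} (hT : 1 ≤ T)
    (hF : ∀ w, G.Reachable v w → green G T w w ≤ F) (S : Finset V) :
    ∑ w, avoid G (insert w S) (T - 1) v ≤
      Fintype.card V * avoid G S (T - 1) v - T * avoid G S (T - 1) v ^ 2 / (2 * F) := by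
  have hF1 : 1 ≤ F := (one_le_green G hT v).trans (hF v (.refl v))
  set k := T - 1 with hk
  have hkT : k + 1 = T := by omega
  have hkT' : (k : ℝ) + 1 = T := by exact_mod_cast hkT
  set Z := avoid G S k v with hZ
  set E := pathExp G k v fun l => avoidInd S l * l.toFinset.card with hE
  have h1 : ∑ w, avoid G (insert w S) k v = Fintype.card V * Z + (-1) * E := by
    rw [hZ, hE, ← pathExp_avoidInd]
    simp only [← pathExp_avoidInd]
    rw [← pathExp_sum, ← pathExp_const_mul, ← pathExp_const_mul, ← pathExp_add]
    congr 1
    funext l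
    have : ∀ w, avoidInd (insert w S) l = avoidInd S l - if w ∈ l.toFinset then avoidInd S l else 0 := by
      intro w
      have hiff : (∀ x ∈ l, x ∉ insert w S) ↔ (∀ x ∈ l, x ∉ S) ∧ w ∉ l.toFinset := by
        simp only [Finset.mem_insert, not_or, forall_and, List.mem_toFinset]
        rw [and_comm]
        refine and_congr_right fun _ => ⟨fun h hw => h w hw rfl, fun h x hx hxw => h (hxw ▸ hx)⟩
      simp only [avoidInd, hiff]
      split_ifs <;> first | (exfalso; tauto) | norm_num
    simp only [this, Finset.sum_sub_distrib, Finset.sum_const, Finset.card_univ, nsmul_eq_mul,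
      Finset.sum_ite_mem, Finset.univ_inter]
    ring
  have hE0 : 0 ≤ E := by
    rw [hE, ← pathExp_const (G := G) k v 0]
    refine pathExp_mono fun l _ => mul_nonneg ?_ (Nat.cast_nonneg _)
    rw [avoidInd]; split_ifs <;> norm_num
  have hZ0 : 0 ≤ Z := avoid_nonneg S k v
  suffices h2 : T * Z ^ 2 / (2 * F) ≤ E by rw [h1]; linarith
  rcases hZ0.eq_or_lt with hZ0 | hZ0
  · rw [← hZ0]; simpa using hE0
  -- Cauchy–Schwarz is used as `x ≤ κ x² / 2 + 1 / (2 κ)` for each visit count; with this `κ` the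
  -- quadratic term is exactly `T Z / 2`.
  set κ := Z / (2 * F) with hκ
  have hκ0 : 0 < κ := by positivity
  have h2 : T * Z ≤ κ / 2 * (2 * F * T) + 1 / (2 * κ) * E := by
    have h3 := pathExp_sum_sq_count_le (k := k) hkT.le hF
    rw [hkT'] at h3
    have h4 : (T : ℝ) * Z ≤ κ / 2 * pathExp G k v (fun l => ∑ w, (l.count w : ℝ) ^ 2) +
        1 / (2 * κ) * E := by
      rw [hZ, hE, ← pathExp_avoidInd, ← pathExp_const_mul, ← pathExp_const_mul,
        ← pathExp_const_mul, ← pathExp_add]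
      refine pathExp_mono fun l hl => ?_
      rw [avoidInd]
      split_ifs with ha
      · have h5 : (T : ℝ) = ∑ w ∈ l.toFinset, (l.count w : ℝ) := by
          rw [← hkT, ← hl, ← List.sum_toFinset_count_eq_length]
          push_cast; rfl
        have h6 : ∑ w ∈ l.toFinset, (l.count w : ℝ) ^ 2 ≤ ∑ w, (l.count w : ℝ) ^ 2 :=
          Finset.sum_le_sum_of_subset_of_nonneg (Finset.subset_univ _) fun w _ _ => sq_nonneg _
        have h7 : ∀ w ∈ l.toFinset, (l.count w : ℝ) ≤ κ / 2 * (l.count w : ℝ) ^ 2 + 1 / (2 * κ) := by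
          intro w _
          have h8 : 0 ≤ (κ * (l.count w : ℝ) - 1) ^ 2 / (2 * κ) := by positivity
          have h9 : (κ * (l.count w : ℝ) - 1) ^ 2 / (2 * κ) =
              κ / 2 * (l.count w : ℝ) ^ 2 + 1 / (2 * κ) - (l.count w : ℝ) := by
            field_simp; ring
          linarith
        have h10 := Finset.sum_le_sum h7
        rw [Finset.sum_add_distrib, ← Finset.mul_sum, Finset.sum_const, nsmul_eq_mul, ← h5] at h10
        have h11 : κ / 2 * ∑ w ∈ l.toFinset, (l.count w : ℝ) ^ 2 ≤
          κ / 2 * ∑ w, (l.count w : ℝ) ^ 2 := by gcongr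
        linarith
      · have : 0 ≤ κ / 2 * ∑ w, (l.count w : ℝ) ^ 2 := by positivity
        linarith
    refine h4.trans ?_
    gcongr
  have h3 : κ / 2 * (2 * F * T) = T * Z / 2 := by rw [hκ]; field_simp
  have h4 : 1 / (2 * κ) * E = F * E / Z := by rw [hκ]; field_simp
  rw [h3, h4] at h2
  have h5 : T * Z / 2 ≤ F * E / Z := by linarith
  rw [le_div_iff₀ hZ0] at h5
  rw [div_le_iff₀ (by positivity)]
  nlinarith

/-! ### Hitting and crossing -/

theorem hit_nonneg (S : Finset V) (k : ℕ) (v : V) : 0 ≤ hit G S k v := by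
  have := avoid_le_one (G := G) S k v
  rw [hit]; linarith

theorem hit_le_one (S : Finset V) (k : ℕ) (v : V) : hit G S k v ≤ 1 := by
  have := avoid_nonneg (G := G) S k v
  rw [hit]; linarith

theorem hit_of_mem {S : Finset V} {v : V} (h : v ∈ S) (k : ℕ) : hit G S k v = 1 := by
  cases k <;> simp [hit, avoid, h]

theorem hit_succ {S : Finset V} {v : V} (h : v ∉ S) (k : ℕ) :
    hit G S (k + 1) v = ∑ u, trans G v u * hit G S k u := by
  simp only [hit, mul_sub, Finset.sum_sub_distrib, mul_one, sum_trans, avoid, if_neg h]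

theorem hit_le_succ (S : Finset V) (k : ℕ) (v : V) : hit G S k v ≤ hit G S (k + 1) v := by
  induction k generalizing v with
  | zero =>
    by_cases h : v ∈ S
    · rw [hit_of_mem h, hit_of_mem h]
    · have : hit G S 0 v = 0 := by simp [hit, avoid, h]
      rw [this]; exact hit_nonneg S _ v
  | succ k ih =>
    by_cases h : v ∈ S
    · rw [hit_of_mem h, hit_of_mem h]
    · rw [hit_succ h, hit_succ h]
      exact Finset.sum_le_sum fun u _ => mul_le_mul_of_nonneg_left (ih u) (trans_nonneg G v u)

theorem hit_mono (S : Finset V) {j k : ℕ} (h : j ≤ k) (v : V) : hit G S j v ≤ hit G S k v :=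
  monotone_nat_of_le_succ (f := fun j => hit G S j v) (fun j => hit_le_succ S j v) h

/-- Comparison principle in time: off `w` and `B` both sides obey the same averaging rule, at `w`
the hypothesis applies, and on `B` hitting is certain. The walk first reaches `w` and then has `r`
steps left for `B`. -/
theorem mul_green_le_hit_self {B : Finset V} {T r : ℕ} {w : V} {κ : ℝ} (hκ0 : 0 ≤ κ)
    (hκ : κ * green G T w w ≤ hit G B r w) {j : ℕ} (hj : j ≤ T) (v : V) :
    κ * green G j v w ≤ hit G B (j + r) v := by
  have h1 : ∀ j ≤ T, ∀ v, κ * green G j v w ≤ κ * green G T w w := fun j hj v =>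
    mul_le_mul_of_nonneg_left (green_le_diag G hj v w) hκ0
  induction j generalizing v with
  | zero => rw [green_zero, mul_zero]; exact hit_nonneg B _ v
  | succ j ih =>
    by_cases hv : v ∈ B
    · rw [hit_of_mem hv]
      exact (h1 _ hj v).trans (hκ.trans (hit_le_one B r w))
    by_cases hvw : v = w
    · rw [hvw]
      exact (h1 _ hj w).trans (hκ.trans (hit_mono B (by omega) w))
    · rw [green_succ, if_neg hvw, zero_add, Nat.add_right_comm, hit_succ hv, Finset.mul_sum]
      refine Finset.sum_le_sum fun u _ => ?_
      have := mul_le_mul_of_nonneg_left (ih (by omega) u) (trans_nonneg G v u)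
      linarith

/-- The same comparison with the source at `u`. The extra unit that the Green function gains there
is paid for at the neighbor `w`, from which `B` is hit with a probability well above `κ * green G T
u u`. -/
theorem mul_green_le_hit_adj {B : Finset V} {T r : ℕ} {u w : V} {κ : ℝ} (hκ0 : 0 ≤ κ)
    (hκ1 : κ * green G T u u ≤ 1)
    (hκ : κ ≤ trans G u w * (hit G B r w - κ * green G T u u)) {j : ℕ} (hj : j ≤ T) (v : V) :
    κ * green G j v u ≤ hit G B (j + r) v := by
  have h1 : ∀ j ≤ T, ∀ v, κ * green G j v u ≤ κ * green G T u u := fun j hj v =>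
    mul_le_mul_of_nonneg_left (green_le_diag G hj v u) hκ0
  induction j generalizing v with
  | zero => rw [green_zero, mul_zero]; exact hit_nonneg B _ v
  | succ j ih =>
    by_cases hv : v ∈ B
    · rw [hit_of_mem hv]
      exact (h1 _ hj v).trans hκ1
    have h2 : ∀ x, κ * (trans G v x * green G j x u) ≤ trans G v x * hit G B (j + r) x := by
      intro x
      have := mul_le_mul_of_nonneg_left (ih (by omega) x) (trans_nonneg G v x)
      linarith
    rw [green_succ, Nat.add_right_comm, hit_succ hv, mul_add, Finset.mul_sum]
    by_cases hvu : v = u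
    · subst hvu
      rw [if_pos rfl, mul_one]
      have h3 : κ + κ * (trans G v w * green G j w v) ≤ trans G v w * hit G B (j + r) w := by
        have h4 := hit_mono (G := G) B (Nat.le_add_left r j) w
        have h5 := h1 j (by omega) w
        have h6 := mul_le_mul_of_nonneg_left (sub_le_sub h4 h5) (trans_nonneg G v w)
        linarith
      rw [← Finset.add_sum_erase _ _ (Finset.mem_univ w),
        ← Finset.add_sum_erase _ (fun x => trans G v x * _) (Finset.mem_univ w), ← add_assoc]
      exact add_le_add h3 (Finset.sum_le_sum fun x _ => h2 x)
    · rw [if_neg hvu, mul_zero, zero_add]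
      exact Finset.sum_le_sum fun x _ => h2 x

/-- Green function with respect to the landmarks in `A`. -/
def greenSum (G : SimpleGraph V) [DecidableRel G.Adj] (T : ℕ) (L : List V) (A : Finset V) (u : V) :
    ℝ := (L.map fun l => if l ∈ A then green G T u l else 0).sum

/-- Expected number of walks from landmarks in `A` that hit `B`. -/
def crossSum (G : SimpleGraph V) [DecidableRel G.Adj] (k : ℕ) (L : List V) (A B : Finset V) : ℝ :=
  (L.map fun l => if l ∈ A then hit G B k l else 0).sum

/-- Visits to `u` by walks from `A` turn into hits of `B` at the rate `α / F`. In the adjacent case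
`F` pays twice: for the returns to `u`, and for the expected wait `1 / P(u, w) ≤ Δ` to use the edge.
-/
theorem le_crossSum {A B : Finset V} {L : List V} {T : ℕ} {u w : V} {F α y : ℝ} (hT : 1 ≤ T)
    (hF : green G T u u + G.maxDegree ≤ F) (huw : u = w ∨ G.Adj u w) (hα0 : 0 ≤ α)
    (hα : α ≤ hit G B (T - 1) w) (hy : y ≤ greenSum G T L A u) :
    α / F * y ≤ crossSum G (T + (T - 1)) L A B := by
  have hF1 : 1 ≤ green G T u u := one_le_green G hT u
  have hΔ0 : (0 : ℝ) ≤ G.maxDegree := Nat.cast_nonneg _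
  have hF0 : 0 < F := by linarith
  have hκ0 : 0 ≤ α / F := by positivity
  have hle : α / F * green G T u u ≤ α := by
    rw [div_mul_eq_mul_div, div_le_iff₀ hF0]
    gcongr; linarith
  have hα1 : α ≤ 1 := hα.trans (hit_le_one _ _ _)
  have key : ∀ v, α / F * green G T u v ≤ hit G B (T + (T - 1)) v := by
    intro v
    rw [green_comm]
    rcases huw with rfl | huw
    · exact mul_green_le_hit_self hκ0 (hle.trans hα) le_rfl v
    · refine mul_green_le_hit_adj (w := w) hκ0 (hle.trans hα1) ?_ le_rfl v
      have h1 := trans_mul_max G huw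
      have h2 : max (G.degree u : ℝ) (G.degree w) ≤ F - green G T u u := by
        have : max (G.degree u : ℝ) (G.degree w) ≤ G.maxDegree :=
          max_le (by exact_mod_cast G.degree_le_maxDegree _)
            (by exact_mod_cast G.degree_le_maxDegree _)
        linarith
      have h3 : 1 ≤ trans G u w * (F - green G T u u) := by
        rw [← h1]; exact mul_le_mul_of_nonneg_left h2 (trans_nonneg G u w)
      calc α / F ≤ α / F * (trans G u w * (F - green G T u u)) := le_mul_of_one_le_right hκ0 h3
        _ = trans G u w * (α - α / F * green G T u u) := by field_simp
        _ ≤ _ := by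
          gcongr
          exact trans_nonneg G u w
  refine (mul_le_mul_of_nonneg_left hy hκ0).trans ?_
  rw [greenSum, crossSum, ← List.sum_map_mul_left]
  refine List.sum_le_sum fun l _ => ?_
  split_ifs
  · exact key l
  · rw [mul_zero]

/-- Between the two parts of a partition of the landmarks of a component, there are likely walks
in one of the two directions. -/
theorem crossing {A B : Finset V} {L : List V} {T : ℕ} {a b : V} {F c y : ℝ} (hT : 1 ≤ T)
    (hab : G.Reachable a b) (ha : a ∈ A) (hb : b ∈ B)
    (hF : ∀ u, G.Reachable a u → green G T u u + G.maxDegree ≤ F) (hc0 : 0 ≤ c) (hc1 : c ≤ 1)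
    (hc : ∀ u, G.Reachable a u → avoid G (A ∪ B) (T - 1) u ≤ 1 - c)
    (hy : ∀ u, G.Reachable a u → 2 * y ≤ greenSum G T L A u + greenSum G T L B u) :
    c / 2 / F * y ≤ crossSum G (T + (T - 1)) L A B ∨
      c / 2 / F * y ≤ crossSum G (T + (T - 1)) L B A := by
  -- If walks from one side often visit an endpoint on the other side, that visit is itself the hit.
  by_cases h1 : y ≤ greenSum G T L B a
  · right
    exact le_crossSum hT (hF a (.refl a)) (.inl rfl) (by linarith) (by rw [hit_of_mem ha]; linarith) h1
  have h1' : y ≤ greenSum G T L A a := by have := hy a (.refl a); linarith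
  by_cases h2 : y ≤ greenSum G T L A b
  · left
    exact le_crossSum hT (hF b hab) (.inl rfl) (by linarith) (by rw [hit_of_mem hb]; linarith) h2
  obtain ⟨p⟩ := hab
  -- An edge of the path where visits from `A` fall below `y`. Visits from `B` are then above `y` at
  -- its second end, as the total is at least `2 y`.
  obtain ⟨d, hd, hd1, hd2⟩ := p.exists_boundary_dart {u | y ≤ greenSum G T L A u} h1' h2
  have hru : G.Reachable a d.fst := (p.takeUntil d.fst (p.dart_fst_mem_support_of_mem_darts hd)).reachable
  have hrw : G.Reachable a d.snd := hru.trans d.adj.reachable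
  rw [Set.mem_ofPred_eq] at hd1 hd2
  have h3 := hc d.snd hrw
  have h4 := avoid_add_avoid_le (G := G) A B (T - 1) d.snd
  have h5 := hy d.snd hrw
  -- A walk from the second end hits one of the two sets with probability at least `c / 2`. If it is
  -- `B`, walks from `A` get there across the edge; if it is `A`, walks from `B` do so without it.
  by_cases h6 : c / 2 ≤ hit G B (T - 1) d.snd
  · left
    exact le_crossSum hT (hF d.fst hru) (.inr d.adj) (by linarith) h6 hd1
  · right
    refine le_crossSum hT (hF d.snd hrw) (.inl rfl) (by linarith) ?_ (y := y) (by linarith)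
    simp only [hit] at h6 ⊢
    linarith

end Landmark

/-! ### Random landmarks -/

namespace Landmark

variable {V : Type} [Fintype V] [DecidableEq V] {G : SimpleGraph V} [DecidableRel G.Adj]

theorem sum_fin_succ_fun {V : Type} [Fintype V] (k : ℕ) (f : (Fin (k + 1) → V) → ℝ) :
    ∑ g, f g = ∑ v, ∑ g : Fin k → V, f (Fin.cons v g) := by
  rw [← (Fin.consEquiv fun _ => V).sum_comp, Fintype.sum_prod_type]
  rfl

/-- The chord of the convex exponential over `[-θ, 0]`; this is the one-variable step of the
Chernoff bound. -/
theorem exp_neg_mul_le {θ x : ℝ} (hx0 : 0 ≤ x) (hx1 : x ≤ 1) :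
    Real.exp (-θ * x) ≤ 1 - x * (1 - Real.exp (-θ)) := by
  have := convexOn_exp.2 (Set.mem_univ (-θ)) (Set.mem_univ 0) hx0 (sub_nonneg.2 hx1) (by ring)
  simp only [smul_eq_mul, mul_zero, add_zero, Real.exp_zero, mul_one] at this
  rw [mul_comm]
  linarith

open Classical in
/-- It is unlikely that the landmarks are rarely visited from `u`. -/
theorem card_greenSum_lt_le {T p : ℕ} {u : V} {F θ y : ℝ} (hF0 : 0 < F)
    (hF : green G T u u ≤ F) (hθ : 0 ≤ θ) :
    ((Finset.univ.filter fun g : Fin p → V => ∑ i, green G T u (g i) < y).card : ℝ) ≤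
      (Fintype.card V : ℝ) ^ p *
        Real.exp (θ * (y / F) - p * (T / (Fintype.card V * F)) * (1 - Real.exp (-θ))) := by
  have hn : (0 : ℝ) < Fintype.card V := by exact_mod_cast Fintype.card_pos_iff.2 ⟨u⟩
  set n : ℝ := (Fintype.card V : ℝ) with hnd
  -- Chernoff: the exponential Markov inequality for independent terms `green / F`, which lie in
  -- `[0, 1]` by the maximum principle and have mean `T / (n F)`. Probabilities are written as
  -- counts out of `n ^ p`.
  have h1 : ((Finset.univ.filter fun g : Fin p → V => ∑ i, green G T u (g i) < y).card : ℝ) ≤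
      ∑ g : Fin p → V, Real.exp (θ * (y / F)) * ∏ i, Real.exp (-θ * (green G T u (g i) / F)) := by
    rw [Finset.card_filter]
    push_cast
    refine Finset.sum_le_sum fun g _ => ?_
    rw [← Real.exp_sum, ← Real.exp_add]
    split_ifs with h
    · refine Real.one_le_exp ?_
      rw [← Finset.mul_sum, ← Finset.sum_div]
      have : (∑ i, green G T u (g i)) / F ≤ y / F := by gcongr
      nlinarith
    · exact (Real.exp_pos _).le
  have h2 : ∑ v, Real.exp (-θ * (green G T u v / F)) ≤
      n * Real.exp (-(T / (n * F) * (1 - Real.exp (-θ)))) := by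
    have h3 : ∀ v, Real.exp (-θ * (green G T u v / F)) ≤
        1 - green G T u v / F * (1 - Real.exp (-θ)) := fun v => by
      refine exp_neg_mul_le (div_nonneg (green_nonneg G T u v) hF0.le) ?_
      rw [div_le_one hF0, green_comm]
      exact (green_le_diag G le_rfl v u).trans hF
    refine (Finset.sum_le_sum fun v _ => h3 v).trans ?_
    rw [Finset.sum_sub_distrib, ← Finset.sum_mul, ← Finset.sum_div, sum_green, Finset.sum_const,
      Finset.card_univ, nsmul_eq_mul, mul_one, ← hnd]
    have h4 := Real.add_one_le_exp (-(T / (n * F) * (1 - Real.exp (-θ))))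
    have h5 := mul_le_mul_of_nonneg_left h4 hn.le
    refine le_trans (le_of_eq ?_) h5
    field_simp
    ring
  refine h1.trans ?_
  rw [← Finset.mul_sum, ← Fintype.sum_pow (fun v => Real.exp (-θ * (green G T u v / F))) p]
  have h3 := pow_le_pow_left₀ (Finset.sum_nonneg fun v _ => (Real.exp_pos _).le) h2 p
  refine (mul_le_mul_of_nonneg_left h3 (Real.exp_pos _).le).trans (le_of_eq ?_)
  rw [mul_pow, ← Real.exp_nat_mul, mul_left_comm, ← Real.exp_add]
  congr 2
  ring

-- While the avoidance probability exceeds `z`, the next random landmark reduces its mean by the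
-- factor `1 - z T / (2 F n)` or better. Once it is at most `z` it stays there, since more landmarks
-- only lower it, and the truncated sum is zero.
open Classical in
theorem sum_avoid_le {T : ℕ} {u : V} {F z : ℝ} (hT : 1 ≤ T)
    (hF : ∀ w, G.Reachable u w → green G T w w ≤ F) (k : ℕ) (S : Finset V) :
    ∑ g : Fin k → V, (if z < avoid G (S ∪ (List.ofFn g).toFinset) (T - 1) u then
        avoid G (S ∪ (List.ofFn g).toFinset) (T - 1) u else 0) ≤
      (Fintype.card V * Real.exp (-(z * T / (2 * F * Fintype.card V)))) ^ k *
        avoid G S (T - 1) u := by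
  have hn : (0 : ℝ) < Fintype.card V := by exact_mod_cast Fintype.card_pos_iff.2 ⟨u⟩
  have hF1 : 1 ≤ F := (one_le_green G hT u).trans (hF u (.refl u))
  induction k generalizing S with
  | zero =>
    simp only [List.ofFn_zero, List.toFinset_nil, Finset.union_empty, Finset.univ_unique,
      Finset.sum_singleton, pow_zero, one_mul]
    split_ifs
    · exact le_rfl
    · exact avoid_nonneg _ _ _
  | succ k ih =>
    rw [sum_fin_succ_fun]
    have hcons : ∀ (v : V) (g : Fin k → V), S ∪ (List.ofFn (Fin.cons v g : Fin (k + 1) → V)).toFinset =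
        insert v S ∪ (List.ofFn g).toFinset := by
      intro v g
      rw [List.ofFn_succ, List.toFinset_cons]
      simp only [Fin.cons_zero, Fin.cons_succ]
      rw [Finset.union_insert, Finset.insert_union]
    simp only [hcons]
    set Z := avoid G S (T - 1) u with hZ
    set n : ℝ := (Fintype.card V : ℝ) with hnd
    set e := Real.exp (-(z * T / (2 * F * n))) with he
    have he0 : 0 < e := Real.exp_pos _
    have hZ0 : 0 ≤ Z := avoid_nonneg _ _ _
    by_cases hzZ : z < Z
    · refine (Finset.sum_le_sum fun v _ => ih (insert v S)).trans ?_
      rw [← Finset.mul_sum, pow_succ, mul_assoc]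
      refine mul_le_mul_of_nonneg_left ?_ (by positivity)
      refine (sq_le_sum_avoid_insert hT hF S).trans ?_
      rw [← hZ, ← hnd]
      have h1 := Real.add_one_le_exp (-(z * T / (2 * F * n)))
      rw [← he] at h1
      have h2 : z * T / (2 * F) * Z ≤ T * Z ^ 2 / (2 * F) := by
        rw [div_mul_eq_mul_div]
        have hT0 : (0 : ℝ) ≤ T := Nat.cast_nonneg _
        refine div_le_div_of_nonneg_right ?_ (by positivity)
        calc z * T * Z = T * Z * z := by ring
          _ ≤ T * Z * Z := mul_le_mul_of_nonneg_left hzZ.le (mul_nonneg hT0 hZ0)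
          _ = T * Z ^ 2 := by ring
      have h3 : n * (-(z * T / (2 * F * n)) + 1) * Z = n * Z - z * T / (2 * F) * Z := by
        field_simp; ring
      have h4 : n * (-(z * T / (2 * F * n)) + 1) * Z ≤ n * e * Z := by gcongr
      linarith
    · have h0 : ∀ (v : V) (g : Fin k → V),
          ¬ z < avoid G (insert v S ∪ (List.ofFn g).toFinset) (T - 1) u := by
        intro v g h
        refine hzZ (h.trans_le (avoid_anti ?_ _ _))
        exact (Finset.subset_insert v S).trans Finset.subset_union_left
      simp only [h0, if_false, Finset.sum_const_zero]
      positivity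

open Classical in
/-- It is unlikely that the walk from `u` avoids all landmarks. -/
theorem card_lt_avoid_le {T p : ℕ} {u : V} {F z : ℝ} (hT : 1 ≤ T)
    (hF : ∀ w, G.Reachable u w → green G T w w ≤ F) (hz : 0 < z) :
    ((Finset.univ.filter fun g : Fin p → V =>
        z < avoid G (List.ofFn g).toFinset (T - 1) u).card : ℝ) ≤
      (Fintype.card V : ℝ) ^ p *
        (Real.exp (-(p * (T / (Fintype.card V * F)) * (z / 2))) / z) := by
  have hn : (0 : ℝ) < Fintype.card V := by exact_mod_cast Fintype.card_pos_iff.2 ⟨u⟩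
  have hF1 : 1 ≤ F := (one_le_green G hT u).trans (hF u (.refl u))
  have h1 := sum_avoid_le (z := z) hT hF p ∅
  simp only [Finset.empty_union] at h1
  rw [mul_div_assoc', le_div_iff₀ hz]
  -- Markov's inequality for the truncated avoidance probability.
  calc _ = ∑ g : Fin p → V, if z < avoid G (List.ofFn g).toFinset (T - 1) u then z else 0 := by
        rw [Finset.card_filter]; push_cast; rw [Finset.sum_mul]
        refine Finset.sum_congr rfl fun g _ => ?_
        split_ifs <;> simp
    _ ≤ _ := Finset.sum_le_sum fun g _ => by
        split_ifs with h
        · exact h.le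
        · exact le_rfl
    _ ≤ _ := h1
    _ ≤ (Fintype.card V * Real.exp (-(z * T / (2 * F * Fintype.card V)))) ^ p * 1 := by
        gcongr
        exact avoid_le_one _ _ _
    _ = _ := by
        rw [mul_one, mul_pow, ← Real.exp_nat_mul]
        congr 2
        field_simp

/-- Landmarks for which the algorithm is likely to succeed. -/
def GoodLandmarks (G : SimpleGraph V) [DecidableRel G.Adj] (s : V) (T p : ℕ) (y z : ℝ)
    (g : Fin p → V) : Prop :=
  ∀ u, G.Reachable s u → y ≤ ∑ i, green G T u (g i) ∧ avoid G (List.ofFn g).toFinset (T - 1) u ≤ z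

open Classical in
theorem card_not_good_le {T p : ℕ} {s : V} {F θ y z : ℝ} (hT : 1 ≤ T)
    (hF : ∀ w, G.Reachable s w → green G T w w ≤ F) (hθ : 0 ≤ θ) (hz : 0 < z) :
    ((Finset.univ.filter fun g : Fin p → V => ¬ GoodLandmarks G s T p y z g).card : ℝ) ≤
      (Fintype.card V : ℝ) ^ p * (Fintype.card V *
        (Real.exp (θ * (y / F) - p * (T / (Fintype.card V * F)) * (1 - Real.exp (-θ))) +
          Real.exp (-(p * (T / (Fintype.card V * F)) * (z / 2))) / z)) := by
  have hF0 : 0 < F := zero_lt_one.trans_le ((one_le_green G hT s).trans (hF s (.refl s)))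
  set a := Real.exp (θ * (y / F) - p * (T / (Fintype.card V * F)) * (1 - Real.exp (-θ))) with ha
  set b := Real.exp (-(p * (T / (Fintype.card V * F)) * (z / 2))) / z with hb
  have hsub : (Finset.univ.filter fun g : Fin p → V => ¬ GoodLandmarks G s T p y z g) ⊆
      (Finset.univ.filter fun u => G.Reachable s u).biUnion fun u =>
        (Finset.univ.filter fun g : Fin p → V => ∑ i, green G T u (g i) < y) ∪
        (Finset.univ.filter fun g : Fin p → V =>
          z < avoid G (List.ofFn g).toFinset (T - 1) u) := by
    intro g hg
    rw [Finset.mem_filter, GoodLandmarks] at hg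
    have h2 := hg.2
    push Not at h2
    obtain ⟨u, hu, h⟩ := h2
    simp only [Finset.mem_biUnion, Finset.mem_filter, Finset.mem_univ, true_and, Finset.mem_union]
    refine ⟨u, hu, ?_⟩
    by_cases hy : ∑ i, green G T u (g i) < y
    · exact .inl hy
    · exact .inr (h (not_lt.1 hy))
  have h1 : ((Finset.univ.filter fun g : Fin p → V => ¬ GoodLandmarks G s T p y z g).card : ℝ) ≤
      ∑ u ∈ Finset.univ.filter fun u => G.Reachable s u, (Fintype.card V : ℝ) ^ p * (a + b) := by
    refine (Nat.cast_le.2 ((Finset.card_le_card hsub).trans Finset.card_biUnion_le)).trans ?_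
    push_cast
    refine Finset.sum_le_sum fun u hu => ?_
    rw [Finset.mem_filter] at hu
    have h2 := card_greenSum_lt_le (p := p) (y := y) hF0 (hF u hu.2) hθ
    have h3 := card_lt_avoid_le (p := p) hT (fun w hw => hF w (hu.2.trans hw)) hz
    refine (Nat.cast_le.2 (Finset.card_union_le _ _)).trans ?_
    push_cast
    rw [mul_add]
    exact add_le_add h2 h3
  refine h1.trans ?_
  rw [Finset.sum_const, nsmul_eq_mul, mul_left_comm]
  have hab : 0 ≤ a + b := by positivity
  have hcard : ((Finset.univ.filter fun u => G.Reachable s u).card : ℝ) ≤ Fintype.card V := by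
    exact_mod_cast Finset.card_le_univ _
  gcongr

end Landmark

/-! ### Discovered pairs -/

namespace Landmark

section Expectation

variable {α β : Type}

/-- Expectation. -/
def pexp (μ : PMF α) (f : α → ℝ≥0∞) : ℝ≥0∞ := ∑' a, μ a * f a

theorem pexp_pure (a : α) (f : α → ℝ≥0∞) : pexp (PMF.pure a) f = f a := by
  rw [pexp, tsum_eq_single a]
  · simp
  · intro b hb; simp [hb]

theorem pexp_bind (μ : PMF α) (ν : α → PMF β) (f : β → ℝ≥0∞) :
    pexp (μ.bind ν) f = pexp μ fun a => pexp (ν a) f := by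
  simp only [pexp, PMF.bind_apply, ← ENNReal.tsum_mul_right, ← ENNReal.tsum_mul_left]
  rw [ENNReal.tsum_comm]
  simp only [mul_assoc]

theorem pexp_map (μ : PMF α) (g : α → β) (f : β → ℝ≥0∞) :
    pexp (μ.map g) f = pexp μ (f ∘ g) := by
  rw [PMF.map, pexp_bind]
  simp only [Function.comp_apply, pexp_pure]
  rfl

theorem pexp_mono {μ : PMF α} {f g : α → ℝ≥0∞} (h : ∀ a, f a ≤ g a) : pexp μ f ≤ pexp μ g :=
  ENNReal.tsum_le_tsum fun a => mul_le_mul_right (h a) _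

theorem pexp_add (μ : PMF α) (f g : α → ℝ≥0∞) :
    pexp μ (fun a => f a + g a) = pexp μ f + pexp μ g := by
  simp only [pexp, mul_add, ENNReal.tsum_add]

theorem pexp_const_mul (μ : PMF α) (c : ℝ≥0∞) (f : α → ℝ≥0∞) :
    pexp μ (fun a => c * f a) = c * pexp μ f := by
  simp only [pexp, ← ENNReal.tsum_mul_left, mul_left_comm]

theorem pexp_const (μ : PMF α) (c : ℝ≥0∞) : pexp μ (fun _ => c) = c := by
  rw [pexp, ENNReal.tsum_mul_right, μ.tsum_coe, one_mul]

theorem pexp_sum {ι : Type} (s : Finset ι) (μ : PMF α) (f : ι → α → ℝ≥0∞) :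
    pexp μ (fun a => ∑ i ∈ s, f i a) = ∑ i ∈ s, pexp μ (f i) := by
  classical
  induction s using Finset.induction_on with
  | empty => simp only [Finset.sum_empty]; exact pexp_const μ 0
  | insert i s hi ih => simp only [Finset.sum_insert hi, pexp_add, ih]

theorem apply_eq_pexp [DecidableEq α] (μ : PMF α) (b : α) :
    μ b = pexp μ fun a => if a = b then 1 else 0 := by
  simp [pexp]

end Expectation

variable {V : Type} [Fintype V] [DecidableEq V] {G : SimpleGraph V} [DecidableRel G.Adj]

theorem pexp_unitStep (v : V) (f : V → ℝ≥0∞) :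
    pexp (unitStep G v) f = ∑ u, ENNReal.ofReal (trans G v u) * f u := by
  rw [pexp, tsum_fintype]
  simp only [unitStep_apply_eq]

/-- `mhWalk` omits the start and `avoid` includes it, which `hv` reconciles. -/
theorem pexp_mhWalk_avoid {B : Finset V} (k : ℕ) {v : V} (hv : v ∉ B) :
    pexp (mhWalk G k v) (fun X => if ∀ x ∈ X, x ∉ B then 1 else 0) =
      ENNReal.ofReal (avoid G B k v) := by
  induction k generalizing v with
  | zero => simp [mhWalk, pexp_pure, avoid, hv]
  | succ k ih =>
    rw [mhWalk, pexp_bind, pexp_unitStep, avoid, if_neg hv,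
      ENNReal.ofReal_sum_of_nonneg fun u _ => mul_nonneg (trans_nonneg G v u) (avoid_nonneg B k u)]
    refine Finset.sum_congr rfl fun u _ => ?_
    rw [ENNReal.ofReal_mul (trans_nonneg G v u), pexp_map]
    congr 1
    by_cases hu : u ∈ B
    · have h0 : avoid G B k u = 0 := by cases k <;> simp [avoid, hu]
      rw [h0, ENNReal.ofReal_zero]
      refine (congrArg (pexp _) (funext fun X => ?_)).trans (pexp_const (mhWalk G k u) 0)
      simp [hu]
    · rw [← ih hu]
      congr 1
      funext X
      simp [hu]

/-- No walk from `A` has discovered an element of `B`. -/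
def NoCross (A B : Finset V) (D : Set (V × V)) : Prop := ∀ a ∈ A, ∀ b ∈ B, (a, b) ∉ D

-- The walks are independent, and each factor `1 - hit` is at most `exp (-hit)`.
open Classical in
theorem pexp_discover_noCross_le {A B : Finset V} (hAB : Disjoint A B) {L : List V} (hB : ∀ b ∈ B, b ∈ L)
    (τ : ℕ) (ls : List V) :
    pexp (discover G L τ ls) (fun D => if NoCross A B D then 1 else 0) ≤
      ENNReal.ofReal (Real.exp (-crossSum G τ ls A B)) := by
  induction ls with
  | nil => simp [discover, pexp_pure, NoCross, crossSum]
  | cons l ls ih =>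
    rw [discover, pexp_bind]
    simp only [pexp_map]
    have h1 : crossSum G τ (l :: ls) A B = (if l ∈ A then hit G B τ l else 0) +
        crossSum G τ ls A B := by simp [crossSum]
    rw [h1, neg_add, Real.exp_add, ENNReal.ofReal_mul (Real.exp_pos _).le]
    have h2 : ∀ (X : List V) (D : Set (V × V)),
        NoCross A B ({q | q.1 = l ∧ q.2 ∈ X ∧ q.2 ∈ L} ∪ D) ↔
          (l ∈ A → ∀ x ∈ X, x ∉ B) ∧ NoCross A B D := by
      intro X D
      simp only [NoCross, Set.mem_union, Set.mem_ofPred_eq, not_or]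
      constructor
      · intro h
        exact ⟨fun hl x hx hxB => (h l hl x hxB).1 ⟨rfl, hx, hB x hxB⟩,
          fun a ha b hb => (h a ha b hb).2⟩
      · rintro ⟨h, h'⟩ a ha b hb
        refine ⟨?_, h' a ha b hb⟩
        rintro ⟨rfl, hbX, -⟩
        exact h ha b hbX hb
    have h3 : ∀ X : List V, pexp (discover G L τ ls) ((fun D => if NoCross A B D then (1 : ℝ≥0∞) else 0) ∘
        fun D => {q | q.1 = l ∧ q.2 ∈ X ∧ q.2 ∈ L} ∪ D) =
        pexp (discover G L τ ls) (fun D => if NoCross A B D then 1 else 0) *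
          (if l ∈ A → ∀ x ∈ X, x ∉ B then 1 else 0) := by
      intro X
      rw [mul_comm, ← pexp_const_mul]
      congr 1
      funext D
      refine (if_congr (h2 X D) rfl rfl).trans ?_
      by_cases h4 : l ∈ A → ∀ x ∈ X, x ∉ B
      · rw [if_pos h4, one_mul]
        exact if_congr (and_iff_right h4) rfl rfl
      · rw [if_neg h4, zero_mul, if_neg fun h => h4 h.1]
    refine (le_of_eq (congrArg (pexp (mhWalk G τ l)) (funext h3))).trans ?_
    rw [pexp_const_mul, mul_comm]
    refine mul_le_mul' ?_ ih
    by_cases hl : l ∈ A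
    · simp only [hl, true_implies, if_true]
      rw [pexp_mhWalk_avoid τ (Finset.disjoint_left.1 hAB hl)]
      refine ENNReal.ofReal_le_ofReal ?_
      have := Real.add_one_le_exp (-hit G B τ l)
      rw [hit] at this ⊢
      linarith
    · simp only [hl, false_implies, if_true, if_false, neg_zero, Real.exp_zero, ENNReal.ofReal_one]
      rw [pexp_const]

theorem crossSum_mono {j k : ℕ} (h : j ≤ k) (L : List V) (A B : Finset V) :
    crossSum G j L A B ≤ crossSum G k L A B := by
  refine List.sum_le_sum fun l _ => ?_
  split_ifs
  · exact hit_mono B h l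
  · exact le_rfl

theorem crossSum_flatten_replicate (k m : ℕ) (L : List V) (A B : Finset V) :
    crossSum G k (List.replicate m L).flatten A B = m * crossSum G k L A B := by
  induction m with
  | zero => simp [crossSum]
  | succ m ih =>
    rw [List.replicate_succ, List.flatten_cons, crossSum, List.map_append, List.sum_append]
    change crossSum G k L A B + crossSum G k _ A B = _
    rw [ih]; push_cast; ring

theorem hit_le_crossSum {k : ℕ} {L : List V} {A B : Finset V} {a : V} (ha : a ∈ A) (haL : a ∈ L) :
    hit G B k a ≤ crossSum G k L A B := by
  have h1 : (if a ∈ A then hit G B k a else 0) ∈ L.map fun l => if l ∈ A then hit G B k l else 0 :=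
    List.mem_map.2 ⟨a, haL, rfl⟩
  rw [if_pos ha] at h1
  refine List.single_le_sum ?_ _ h1
  intro x hx
  obtain ⟨l, -, rfl⟩ := List.mem_map.1 hx
  split_ifs
  · exact hit_nonneg _ _ _
  · exact le_rfl

/-! ### Contraction of the classes in one round -/

open Classical in
/-- If every class that is linked to another one is merged, the number of classes drops by at
least half the number of linked classes. -/
theorem two_mul_card_quot_add_le {W : Type} {r r' : W → W → Prop} [Fintype (Quot r)]
    [Fintype (Quot r')]
    (h : ∀ a b, r a b → r' a b) :
    2 * Fintype.card (Quot r') + (Finset.univ.filter fun C : Quot r => ∃ a b, r' a b ∧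
      (Quot.mk r a = C ∧ Quot.mk r b ≠ C ∨ Quot.mk r b = C ∧ Quot.mk r a ≠ C)).card ≤
      2 * Fintype.card (Quot r) := by
  set linked := Finset.univ.filter fun C : Quot r => ∃ a b, r' a b ∧
      (Quot.mk r a = C ∧ Quot.mk r b ≠ C ∨ Quot.mk r b = C ∧ Quot.mk r a ≠ C) with hl
  set π : Quot r → Quot r' := Quot.map id h with hπ
  -- A new class that contains a linked old class contains at least two old classes, so per fiber
  -- the linked classes number at most twice the fiber minus `2`.
  have hfib : ∀ y : Quot r', 2 + (linked.filter fun C => π C = y).card ≤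
      2 * (Finset.univ.filter fun C => π C = y).card := by
    intro y
    have hsub : (linked.filter fun C => π C = y) ⊆ Finset.univ.filter fun C => π C = y :=
      Finset.filter_subset_filter _ (Finset.subset_univ _)
    have hle := Finset.card_le_card hsub
    obtain ⟨a, rfl⟩ := Quot.exists_rep y
    have hpos : Quot.mk r a ∈ Finset.univ.filter fun C => π C = Quot.mk r' a := by
      rw [Finset.mem_filter]; exact ⟨Finset.mem_univ _, rfl⟩
    have h1 : 1 ≤ (Finset.univ.filter fun C => π C = Quot.mk r' a).card :=
      Finset.card_pos.2 ⟨_, hpos⟩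
    rcases h1.eq_or_lt with h1 | h1
    · have h2 : (linked.filter fun C => π C = Quot.mk r' a) = ∅ := by
        rw [Finset.filter_eq_empty_iff]
        intro C hC hCa
        obtain ⟨b, c, hbc, hC⟩ := (Finset.mem_filter.1 hC).2
        obtain ⟨D, hD⟩ := Finset.card_eq_one.1 h1.symm
        have huniq : ∀ C', π C' = Quot.mk r' a → C' = D := by
          intro C' hC'
          have : C' ∈ Finset.univ.filter fun C => π C = Quot.mk r' a :=
            Finset.mem_filter.2 ⟨Finset.mem_univ _, hC'⟩
          rwa [hD, Finset.mem_singleton] at this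
        have hbc' : π (Quot.mk r b) = π (Quot.mk r c) := Quot.sound hbc
        rcases hC with ⟨rfl, hne⟩ | ⟨rfl, hne⟩
        · exact hne ((huniq _ (hbc' ▸ hCa)).trans (huniq _ hCa).symm)
        · exact hne ((huniq _ (hbc'.symm ▸ hCa)).trans (huniq _ hCa).symm)
      rw [h2, Finset.card_empty]; omega
    · omega
  have hs := Finset.sum_le_sum fun (y : Quot r') (_ : y ∈ Finset.univ) => hfib y
  have hf : ∀ X : Finset (Quot r), ∑ y, (X.filter fun C => π C = y).card = X.card := fun X =>
    (Finset.card_eq_sum_card_fiberwise (fun C _ => Finset.mem_coe.2 (Finset.mem_univ _))).symm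
  rw [Finset.sum_add_distrib, ← Finset.mul_sum, hf, hf, Finset.sum_const, smul_eq_mul,
    Finset.card_univ, Finset.card_univ] at hs
  omega

end Landmark

/-! ### The probability of failure -/

namespace Landmark

variable {V : Type} [Fintype V] [DecidableEq V] {G : SimpleGraph V} [DecidableRel G.Adj]

/-- A walk sees only its own component, so landmarks elsewhere are irrelevant. -/
theorem avoid_anti_reachable {S S' : Finset V} (k : ℕ) {u : V}
    (h : ∀ x, G.Reachable u x → x ∈ S → x ∈ S') : avoid G S' k u ≤ avoid G S k u := by
  induction k generalizing u with
  | zero =>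
    by_cases hu : u ∈ S
    · simp [avoid, hu, h u (.refl u) hu]
    · rw [avoid, avoid, if_neg hu]; split_ifs <;> norm_num
  | succ k ih =>
    rw [avoid, avoid]
    by_cases hu : u ∈ S
    · simp [hu, h u (.refl u) hu]
    · rw [if_neg hu]
      have h0 : ∀ x, trans G u x * avoid G S' k x ≤ trans G u x * avoid G S k x := by
        intro x
        by_cases hx : trans G u x = 0
        · simp [hx]
        · have hr := reachable_of_trans_ne_zero G hx
          exact mul_le_mul_of_nonneg_left (ih fun y hy => h y (hr.trans hy)) (trans_nonneg G u x)
      split_ifs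
      · exact Finset.sum_nonneg fun x _ => mul_nonneg (trans_nonneg G u x) (avoid_nonneg _ _ _)
      · exact Finset.sum_le_sum fun x _ => h0 x

open Classical in
/-- With good landmarks, two complementary sets of landmarks of a component are likely to be
linked in one round. -/
theorem pexp_noCross_le {A B : Finset V} {s t a b : V} {T p τ : ℕ} {F y z : ℝ} {g : Fin p → V}
    (hT : 1 ≤ T) (hτ : T + (T - 1) ≤ τ) (hz0 : 0 ≤ z) (hz1 : z ≤ 1)
    (hF : ∀ u, G.Reachable s u → green G T u u + G.maxDegree ≤ F)
    (hg : GoodLandmarks G s T p y z g) (hAB : Disjoint A B) (ha : a ∈ A) (hb : b ∈ B)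
    (hA : ∀ x ∈ A, x ∈ s :: t :: List.ofFn g ∧ G.Reachable s x)
    (hB : ∀ x ∈ B, x ∈ s :: t :: List.ofFn g ∧ G.Reachable s x)
    (hABL : ∀ x ∈ s :: t :: List.ofFn g, G.Reachable s x → x ∈ A ∨ x ∈ B) :
    pexp (discover G (s :: t :: List.ofFn g) τ (s :: t :: List.ofFn g))
      (fun D => if NoCross A B D ∧ NoCross B A D then 1 else 0) ≤
      ENNReal.ofReal (Real.exp (-((1 - z) / 2 / F * (y / 2)))) := by
  set L := s :: t :: List.ofFn g with hL
  have hsa := (hA a ha).2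
  -- Good landmarks guarantee a total of `y` visits, hence `y / 2` for each half of the cut; `s` and
  -- `t` only add to this.
  have hcr := crossing (L := L) (F := F) (c := 1 - z) (y := y / 2) hT
    (hsa.symm.trans (hB b hb).2) ha hb (fun u hu => hF u (hsa.trans hu)) (by linarith) (by linarith)
    (fun u hu => by
      refine (avoid_anti_reachable _ fun x hx hxg => ?_).trans
        (((hg u (hsa.trans hu)).2).trans (by linarith))
      rw [List.mem_toFinset] at hxg
      rw [Finset.mem_union]
      exact hABL x (by simp [hL, hxg]) ((hsa.trans hu).trans hx))
    (fun u hu => by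
      have hsu := hsa.trans hu
      have h1 := (hg u hsu).1
      have h2 : ∑ i, green G T u (g i) ≤ (L.map fun l => green G T u l).sum := by
        rw [hL]
        simp only [List.map_cons, List.sum_cons, List.map_ofFn, List.sum_ofFn]
        have := green_nonneg G T u s
        have := green_nonneg G T u t
        simp only [Function.comp_apply]
        linarith
      -- A landmark in the component is in `A` or in `B`; the others contribute zero.
      have h3 : (L.map fun l => green G T u l).sum ≤ greenSum G T L A u + greenSum G T L B u := by
        rw [greenSum, greenSum, ← List.sum_map_add]
        refine List.sum_le_sum fun l hl => ?_
        by_cases hul : G.Reachable u l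
        · have h0 := green_nonneg G T u l
          rcases hABL l hl (hsu.trans hul) with h | h
          · rw [if_pos h]; split_ifs <;> linarith
          · rw [if_pos h]; split_ifs <;> linarith
        · rw [green_eq_zero G hul]; simp
      linarith)
  have hmono : ∀ (P Q : Set (V × V) → Prop) [DecidablePred P] [DecidablePred Q],
      (∀ D, P D → Q D) → pexp (discover G L τ L) (fun D => if P D then 1 else 0) ≤
        pexp (discover G L τ L) (fun D => if Q D then 1 else 0) := by
    intro P Q _ _ h
    refine pexp_mono fun D => ?_
    by_cases hP : P D
    · rw [if_pos hP, if_pos (h D hP)]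
    · rw [if_neg hP]; exact zero_le
  rcases hcr with hcr | hcr
  · refine ((hmono (fun D => NoCross A B D ∧ NoCross B A D) (NoCross A B) fun D h => h.1).trans
      (pexp_discover_noCross_le hAB (fun b hb => (hB b hb).1) τ L)).trans ?_
    gcongr
    exact hcr.trans (crossSum_mono hτ L A B)
  · refine ((hmono (fun D => NoCross A B D ∧ NoCross B A D) (NoCross B A) fun D h => h.2).trans
      (pexp_discover_noCross_le hAB.symm (fun b hb => (hA b hb).1) τ L)).trans ?_
    gcongr
    exact hcr.trans (crossSum_mono hτ L B A)

/-- The landmarks in the component of `s`. -/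
abbrev Local {V : Type} (G : SimpleGraph V) (s : V) (L : List V) : Type :=
  {v : V // v ∈ L ∧ G.Reachable s v}

/-- Discovered pairs as a relation on the landmarks in the component of `s`. -/
def Local.rel {V : Type} (G : SimpleGraph V) (s : V) (L : List V) (D : Set (V × V))
    (a b : Local G s L) : Prop := (a.1, b.1) ∈ D

/-- Number of classes in the component of `s`. -/
def numClasses {V : Type} (G : SimpleGraph V) (s : V) (L : List V) (D : Set (V × V)) : ℕ :=
  Nat.card (Quot (Local.rel G s L D))

-- As in Borůvka's algorithm: each class against all other landmarks of the component is a cut,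
-- crossed with probability at least `q`, and every two linked classes cost at least one class.
-- Subtracting `1` makes the quantity vanish when all classes have been merged.
open Classical in
theorem pexp_round_le {s : V} {L : List V} {τ : ℕ} {q : ℝ} (hs : s ∈ L) (hq0 : 0 ≤ q) (hq1 : q ≤ 1)
    (hcross : ∀ A B : Finset V, Disjoint A B → A.Nonempty → B.Nonempty →
      (∀ x ∈ A, x ∈ L ∧ G.Reachable s x) → (∀ x ∈ B, x ∈ L ∧ G.Reachable s x) →
      (∀ x ∈ L, G.Reachable s x → x ∈ A ∨ x ∈ B) →
      pexp (discover G L τ L) (fun D => if NoCross A B D ∧ NoCross B A D then 1 else 0) ≤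
        ENNReal.ofReal (1 - q)) (D₀ : Set (V × V)) :
    pexp (discover G L τ L) (fun D => ((numClasses G s L (D₀ ∪ D) - 1 : ℕ) : ℝ≥0∞)) ≤
      ENNReal.ofReal (1 - q / 2) * ((numClasses G s L D₀ - 1 : ℕ) : ℝ≥0∞) := by
  set r := Local.rel G s L D₀ with hr
  let _ : ∀ D, Fintype (Quot (Local.rel G s L D)) := fun D => Fintype.ofFinite _
  have hnum : ∀ D, numClasses G s L D = Fintype.card (Quot (Local.rel G s L D)) := fun D =>
    Nat.card_eq_fintype_card
  have hpos : ∀ D, 1 ≤ numClasses G s L D := fun D => by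
    rw [hnum]
    exact Fintype.card_pos_iff.2 ⟨Quot.mk _ ⟨s, hs, .refl s⟩⟩
  set A : Quot r → Finset V := fun C =>
    Finset.univ.filter fun v => ∃ h : v ∈ L ∧ G.Reachable s v, Quot.mk r ⟨v, h⟩ = C with hA
  set B : Quot r → Finset V := fun C =>
    Finset.univ.filter fun v => ∃ h : v ∈ L ∧ G.Reachable s v, Quot.mk r ⟨v, h⟩ ≠ C with hB
  set E := pexp (discover G L τ L) (fun D => ((numClasses G s L (D₀ ∪ D) - 1 : ℕ) : ℝ≥0∞)) with hE
  set ind : Quot r → Set (V × V) → ℝ≥0∞ := fun C D =>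
    if NoCross (A C) (B C) D ∧ NoCross (B C) (A C) D then 0 else 1 with hind
  -- The deterministic count, for each outcome of the round: every cut that is crossed marks a
  -- linked class.
  have hpt : ∀ D, 2 * ((numClasses G s L (D₀ ∪ D) - 1 : ℕ) : ℝ≥0∞) + ∑ C, ind C D ≤
      2 * ((numClasses G s L D₀ - 1 : ℕ) : ℝ≥0∞) := by
    intro D
    have h1 := two_mul_card_quot_add_le (r := r) (r' := Local.rel G s L (D₀ ∪ D))
      fun a b hab => Or.inl hab
    rw [← hnum, ← hnum] at h1
    set linked := Finset.univ.filter fun C : Quot r => ∃ a b, Local.rel G s L (D₀ ∪ D) a b ∧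
      (Quot.mk r a = C ∧ Quot.mk r b ≠ C ∨ Quot.mk r b = C ∧ Quot.mk r a ≠ C) with hlinked
    have h2 : ∑ C, ind C D ≤ (linked.card : ℝ≥0∞) := by
      rw [hlinked, Finset.card_filter]
      push_cast
      refine Finset.sum_le_sum fun C _ => ?_
      simp only [hind]
      by_cases hC : NoCross (A C) (B C) D ∧ NoCross (B C) (A C) D
      · rw [if_pos hC]; exact zero_le
      · rw [if_neg hC, if_pos]
        simp only [NoCross] at hC
        rw [not_and_or] at hC
        push Not at hC
        rcases hC with ⟨a, ha, b, hb, hab⟩ | ⟨b, hb, a, ha, hab⟩ <;>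
        · simp only [hA, hB, Finset.mem_filter, Finset.mem_univ, true_and] at ha hb
          obtain ⟨ha, ha'⟩ := ha
          obtain ⟨hb, hb'⟩ := hb
          first
          | exact ⟨⟨a, ha⟩, ⟨b, hb⟩, .inr hab, .inl ⟨ha', hb'⟩⟩
          | exact ⟨⟨b, hb⟩, ⟨a, ha⟩, .inr hab, .inr ⟨ha', hb'⟩⟩
    have h3 : 2 * (numClasses G s L (D₀ ∪ D) - 1) + linked.card ≤ 2 * (numClasses G s L D₀ - 1) := by
      have h4 : 2 * numClasses G s L (D₀ ∪ D) + linked.card ≤ 2 * numClasses G s L D₀ := by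
        convert h1
      have := hpos (D₀ ∪ D)
      omega
    calc _ ≤ 2 * ((numClasses G s L (D₀ ∪ D) - 1 : ℕ) : ℝ≥0∞) + (linked.card : ℝ≥0∞) := by gcongr
      _ ≤ _ := by exact_mod_cast h3
  have hE2 : 2 * E + ∑ C, pexp (discover G L τ L) (ind C) ≤
      2 * ((numClasses G s L D₀ - 1 : ℕ) : ℝ≥0∞) := by
    rw [hE, ← pexp_const_mul, ← pexp_sum, ← pexp_add,
      ← pexp_const (discover G L τ L) (2 * ((numClasses G s L D₀ - 1 : ℕ) : ℝ≥0∞))]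
    exact pexp_mono hpt
  -- With a single class there is no cut, but then the left side is zero.
  have hsum : ((numClasses G s L D₀ - 1 : ℕ) : ℝ≥0∞) * ENNReal.ofReal q ≤
      ∑ C, pexp (discover G L τ L) (ind C) := by
    rcases (hpos D₀).eq_or_lt with h1 | h1
    · rw [← h1]; simp
    have h2 : ∀ C, ENNReal.ofReal q ≤ pexp (discover G L τ L) (ind C) := by
      intro C
      have hne : (B C).Nonempty := by
        rw [hnum, Fintype.one_lt_card_iff_nontrivial] at h1
        obtain ⟨C', hC'⟩ := exists_ne C
        obtain ⟨⟨b, hb⟩, rfl⟩ := Quot.exists_rep C'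
        exact ⟨b, by simp only [hB, Finset.mem_filter, Finset.mem_univ, true_and]; exact ⟨hb, hC'⟩⟩
      have hne' : (A C).Nonempty := by
        obtain ⟨⟨a, ha⟩, rfl⟩ := Quot.exists_rep C
        exact ⟨a, by simp only [hA, Finset.mem_filter, Finset.mem_univ, true_and]; exact ⟨ha, trivial⟩⟩
      have hdis : Disjoint (A C) (B C) := by
        rw [Finset.disjoint_left]
        intro x hx hx'
        simp only [hA, hB, Finset.mem_filter, Finset.mem_univ, true_and] at hx hx'
        exact hx'.2 hx.2
      have h3 := hcross (A C) (B C) hdis hne' hne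
        (fun x hx => by simp only [hA, Finset.mem_filter] at hx; exact hx.2.1)
        (fun x hx => by simp only [hB, Finset.mem_filter] at hx; exact hx.2.1)
        (fun x hx hsx => by
          simp only [hA, hB, Finset.mem_filter, Finset.mem_univ, true_and]
          by_cases h : Quot.mk r ⟨x, hx, hsx⟩ = C
          · exact .inl ⟨⟨hx, hsx⟩, h⟩
          · exact .inr ⟨⟨hx, hsx⟩, h⟩)
      have h4 : pexp (discover G L τ L) (ind C) + pexp (discover G L τ L)
          (fun D => if NoCross (A C) (B C) D ∧ NoCross (B C) (A C) D then 1 else 0) = 1 := by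
        rw [← pexp_add]
        refine (congrArg (pexp _) (funext fun D => ?_)).trans (pexp_const _ 1)
        simp only [hind]
        split_ifs <;> simp
      have h5 : ENNReal.ofReal q + ENNReal.ofReal (1 - q) = 1 := by
        rw [← ENNReal.ofReal_add hq0 (by linarith)]; simp
      refine ENNReal.le_of_add_le_add_right (a := ENNReal.ofReal (1 - q)) ENNReal.ofReal_ne_top ?_
      rw [h5, ← h4]
      gcongr
    calc _ ≤ (numClasses G s L D₀ : ℝ≥0∞) * ENNReal.ofReal q := by gcongr; omega
      _ = ∑ C : Quot r, ENNReal.ofReal q := by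
        rw [Finset.sum_const, Finset.card_univ, hnum, nsmul_eq_mul]
      _ ≤ _ := Finset.sum_le_sum fun C _ => h2 C
  set φ := numClasses G s L D₀ - 1 with hφ
  have hfin : 2 * E + (φ : ℝ≥0∞) * ENNReal.ofReal q ≤ 2 * (φ : ℝ≥0∞) :=
    (add_le_add_right hsum _).trans hE2
  have hEtop : E ≠ ⊤ := by
    intro htop
    rw [htop] at hfin
    simp at hfin
    exact absurd hfin (by finiteness)
  lift E to ℝ≥0 using hEtop with e
  rw [ENNReal.ofReal_eq_coe_nnreal hq0] at hfin
  have hreal : 2 * (e : ℝ) + φ * q ≤ 2 * φ := by exact_mod_cast hfin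
  rw [ENNReal.ofReal_eq_coe_nnreal (show 0 ≤ 1 - q / 2 by linarith)]
  have : (e : ℝ) ≤ (1 - q / 2) * φ := by linarith
  exact_mod_cast this

/-- The contraction holds from any previously discovered `D₀`, and the rounds are independent, so it
can be iterated. -/
theorem pexp_rounds_le {s : V} {L : List V} {τ : ℕ} {ρ : ℝ≥0∞}
    (hround : ∀ D₀, pexp (discover G L τ L) (fun D => ((numClasses G s L (D₀ ∪ D) - 1 : ℕ) : ℝ≥0∞)) ≤
      ρ * ((numClasses G s L D₀ - 1 : ℕ) : ℝ≥0∞)) (k : ℕ) (D₀ : Set (V × V)) :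
    pexp (discover G L τ (List.replicate k L).flatten)
      (fun D => ((numClasses G s L (D₀ ∪ D) - 1 : ℕ) : ℝ≥0∞)) ≤
      ρ ^ k * ((numClasses G s L D₀ - 1 : ℕ) : ℝ≥0∞) := by
  induction k generalizing D₀ with
  | zero => simp [discover, pexp_pure]
  | succ k ih =>
    rw [List.replicate_succ, List.flatten_cons, discover_append, pexp_bind]
    simp only [pexp_map, Function.comp_def, ← Set.union_assoc]
    refine (pexp_mono fun D => ih (D₀ ∪ D)).trans ?_
    rw [pexp_const_mul, pow_succ, mul_assoc]
    gcongr
    exact hround D₀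

-- Markov's inequality in pointwise form: if `s` and `t` are separated there are at least two
-- classes.
open Classical in
theorem indicator_not_eqvGen_le {V : Type} [Finite V] {G : SimpleGraph V} {s t : V} {L : List V} (hs : s ∈ L) (ht : t ∈ L)
    (hst : G.Reachable s t) (D : Set (V × V)) :
    (if Relation.EqvGen (fun a b => (a, b) ∈ D) s t then 0 else 1 : ℝ≥0∞) ≤
      ((numClasses G s L D - 1 : ℕ) : ℝ≥0∞) := by
  by_cases h : Relation.EqvGen (fun a b => (a, b) ∈ D) s t
  · rw [if_pos h]; exact zero_le
  · rw [if_neg h]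
    have h2 : 2 ≤ numClasses G s L D := by
      have : Nontrivial (Quot (Local.rel G s L D)) := by
        refine ⟨Quot.mk _ ⟨s, hs, .refl s⟩, Quot.mk _ ⟨t, ht, hst⟩, fun heq => h ?_⟩
        have h3 := Quot.eqvGen_exact heq
        have h4 : ∀ {a b : Local G s L}, Relation.EqvGen (Local.rel G s L D) a b →
            Relation.EqvGen (fun a b => (a, b) ∈ D) a.1 b.1 := by
          intro a b hab
          induction hab with
          | rel a b h => exact .rel _ _ h
          | refl a => exact .refl _
          | symm a b _ ih => exact .symm _ _ ih
          | trans a b c _ _ h1 h2 => exact .trans _ _ _ h1 h2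
        exact h4 h3
      exact Finite.one_lt_card_iff_nontrivial.2 this
    have : 1 ≤ numClasses G s L D - 1 := by omega
    exact_mod_cast this

theorem numClasses_le {V : Type} [Fintype V] {G : SimpleGraph V} (s : V) (L : List V) (D : Set (V × V)) :
    numClasses G s L D ≤ Fintype.card V := by
  rw [← Nat.card_eq_fintype_card]
  exact (Nat.card_le_card_of_surjective _ (Quot.mk_surjective (r := Local.rel G s L D))).trans
    (Nat.card_le_card_of_injective _ Subtype.val_injective)

open Classical in
theorem landmarkAlgorithm_false_eq (s t : V) (p : ℕ) [Nonempty V] :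
    landmarkAlgorithm G s t p false = pexp (PMF.uniformOfFintype (Fin p → V)) fun g =>
      pexp (discover G (s :: t :: List.ofFn g) (nPCeil (Fintype.card V) p G.maxDegree ^ 2)
        (List.replicate (72 * Nat.clog 2 (Fintype.card V)) (s :: t :: List.ofFn g)).flatten)
        fun D => if Relation.EqvGen (fun a b => (a, b) ∈ D) s t then 0 else 1 := by
  rw [apply_eq_pexp, landmarkAlgorithm, pexp_bind]
  congr 1
  funext g
  rw [pexp_map]
  congr 1
  funext D
  by_cases h : Relation.EqvGen (fun a b => (a, b) ∈ D) s t <;> simp [h]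

open Classical in
/-- If the walks from `s` are likely to hit `t`, the algorithm is likely to succeed. -/
theorem landmarkAlgorithm_false_le_of_hit {s t : V} {p : ℕ} {δ : ℝ} (hst : s ≠ t)
    (hδ : δ ≤ hit G {t} (nPCeil (Fintype.card V) p G.maxDegree ^ 2) s) :
    landmarkAlgorithm G s t p false ≤
      ENNReal.ofReal (Real.exp (-(72 * Nat.clog 2 (Fintype.card V) * δ))) := by
  have : Nonempty V := ⟨s⟩
  rw [landmarkAlgorithm_false_eq, ← pexp_const (PMF.uniformOfFintype (Fin p → V))
    (ENNReal.ofReal _)]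
  refine pexp_mono fun g => ?_
  set τ := nPCeil (Fintype.card V) p G.maxDegree ^ 2
  set L := s :: t :: List.ofFn g with hL
  set m := 72 * Nat.clog 2 (Fintype.card V) with hm
  -- Failure implies in particular that no walk from `s` itself hits `t`.
  have h1 := pexp_discover_noCross_le (G := G) (A := {s}) (B := {t}) (by simpa using hst) (L := L)
    (by simp [hL]) τ (List.replicate m L).flatten
  refine (pexp_mono fun D => ?_).trans (h1.trans ?_)
  · by_cases h : Relation.EqvGen (fun a b => (a, b) ∈ D) s t
    · rw [if_pos h]; exact zero_le
    · rw [if_neg h, if_pos]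
      intro a ha b hb hab
      rw [Finset.mem_singleton] at ha hb
      subst ha hb
      exact h (.rel _ _ hab)
  · refine ENNReal.ofReal_le_ofReal (Real.exp_le_exp.2 (neg_le_neg ?_))
    rw [crossSum_flatten_replicate]
    have h2 := hδ.trans (hit_le_crossSum (G := G) (k := τ) (L := L) (A := {s}) (B := {t}) (a := s)
      (by simp) (by simp [hL]))
    have h3 : (72 * (Nat.clog 2 (Fintype.card V) : ℝ)) = (m : ℝ) := by rw [hm]; push_cast; ring
    rw [h3]
    exact mul_le_mul_of_nonneg_left h2 (Nat.cast_nonneg m)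

-- The three summands are the ways to fail: some node sees landmarks too rarely, some walk is too
-- likely to avoid them, or classes survive all rounds. The factor `n` is the union bound over nodes
-- in the first two, and the initial number of classes in the third.
open Classical in
theorem landmarkAlgorithm_false_le {s t : V} {p T : ℕ} {F θ y z q : ℝ} (hst : G.Reachable s t)
    (hT : 1 ≤ T) (hτ : T + (T - 1) ≤ nPCeil (Fintype.card V) p G.maxDegree ^ 2)
    (hF : ∀ u, G.Reachable s u → green G T u u + G.maxDegree ≤ F) (hθ : 0 ≤ θ)
    (hz0 : 0 < z) (hz1 : z ≤ 1) (hq0 : 0 ≤ q)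
    (hq : Real.exp (-((1 - z) / 2 / F * (y / 2))) ≤ 1 - q) :
    landmarkAlgorithm G s t p false ≤ ENNReal.ofReal (Fintype.card V *
      (Real.exp (θ * (y / F) - p * (T / (Fintype.card V * F)) * (1 - Real.exp (-θ))) +
        Real.exp (-(p * (T / (Fintype.card V * F)) * (z / 2))) / z +
        (1 - q / 2) ^ (72 * Nat.clog 2 (Fintype.card V)))) := by
  have : Nonempty V := ⟨s⟩
  have hq1 : q ≤ 1 := by have := Real.exp_pos (-((1 - z) / 2 / F * (y / 2))); linarith
  have hF' : ∀ w, G.Reachable s w → green G T w w ≤ F := fun w hw => by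
    have := hF w hw
    have : (0 : ℝ) ≤ G.maxDegree := Nat.cast_nonneg _
    linarith
  set m := 72 * Nat.clog 2 (Fintype.card V) with hm
  set n := Fintype.card V with hn
  have hn0 : (0 : ℝ) < n := by exact_mod_cast Fintype.card_pos_iff.2 ⟨s⟩
  set ab := Real.exp (θ * (y / F) - p * (T / (n * F)) * (1 - Real.exp (-θ))) +
    Real.exp (-(p * (T / (n * F)) * (z / 2))) / z with hab
  have hbad := card_not_good_le (p := p) (y := y) hT hF' hθ hz0
  rw [← hn, ← hab] at hbad
  have hab0 : 0 ≤ ab := by positivity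
  have hρ0 : 0 ≤ 1 - q / 2 := by linarith
  rw [landmarkAlgorithm_false_eq]
  -- Bad landmarks are charged with certain failure.
  have hg : ∀ g : Fin p → V, pexp (discover G (s :: t :: List.ofFn g) (nPCeil n p G.maxDegree ^ 2)
        (List.replicate m (s :: t :: List.ofFn g)).flatten)
        (fun D => if Relation.EqvGen (fun a b => (a, b) ∈ D) s t then 0 else 1) ≤
      (if GoodLandmarks G s T p y z g then 0 else 1) +
        ENNReal.ofReal ((1 - q / 2) ^ m * n) := by
    intro g
    by_cases hgood : GoodLandmarks G s T p y z g
    · rw [if_pos hgood, zero_add]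
      set L := s :: t :: List.ofFn g with hL
      have h1 := pexp_rounds_le (fun D₀ => pexp_round_le (G := G) (s := s) (L := L)
        (τ := nPCeil n p G.maxDegree ^ 2) (by simp [hL]) hq0 hq1
        (fun A B hd hA hB hA' hB' hAB => by
          obtain ⟨a, ha⟩ := hA
          obtain ⟨b, hb⟩ := hB
          exact (pexp_noCross_le hT hτ hz0.le hz1 hF hgood hd ha hb hA' hB' hAB).trans
            (ENNReal.ofReal_le_ofReal hq)) D₀) m ∅
      simp only [Set.empty_union] at h1
      refine ((pexp_mono fun D => indicator_not_eqvGen_le (by simp [hL]) (by simp [hL]) hst D).trans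
        h1).trans ?_
      rw [ENNReal.ofReal_mul (by positivity), ENNReal.ofReal_pow hρ0, ENNReal.ofReal_natCast]
      gcongr
      exact (Nat.sub_le _ _).trans (numClasses_le s L ∅)
    · rw [if_neg hgood]
      refine le_trans ?_ le_self_add
      refine (pexp_mono fun D => ?_).trans (pexp_const _ 1).le
      by_cases h : Relation.EqvGen (fun a b => (a, b) ∈ D) s t
      · rw [if_pos h]; exact zero_le
      · rw [if_neg h]
  refine (pexp_mono hg).trans ?_
  rw [pexp_add, pexp_const, mul_add, ENNReal.ofReal_add (by positivity) (by positivity),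
    mul_comm (n : ℝ) ((1 - q / 2) ^ m)]
  gcongr
  have h2 : pexp (PMF.uniformOfFintype (Fin p → V))
      (fun g => if GoodLandmarks G s T p y z g then 0 else 1) =
      ((Finset.univ.filter fun g : Fin p → V => ¬ GoodLandmarks G s T p y z g).card : ℝ≥0∞) *
        ((n : ℝ≥0∞) ^ p)⁻¹ := by
    rw [pexp, tsum_fintype, Finset.card_filter]
    push_cast
    rw [Finset.sum_mul]
    refine Finset.sum_congr rfl fun g _ => ?_
    rw [PMF.uniformOfFintype_apply, Fintype.card_pi, Finset.prod_const, Finset.card_univ,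
      Fintype.card_fin, ← hn]
    push_cast
    split_ifs <;> simp
  rw [h2, ← div_eq_mul_inv]
  refine ENNReal.div_le_of_le_mul ?_
  rw [← ENNReal.ofReal_natCast, ← ENNReal.ofReal_natCast n, ← ENNReal.ofReal_pow hn0.le,
    ← ENNReal.ofReal_mul (by positivity)]
  refine ENNReal.ofReal_le_ofReal (hbad.trans (le_of_eq ?_))
  ring

end Landmark

/-! ### The failure probability is at most `1 / n` -/

namespace Landmark

/-- Certifies a numerical bound by a partial sum of the series of `exp x`. -/
theorem exp_neg_le_of_sum {x c : ℝ} (hx : 0 ≤ x) (hc : 0 < c) (k : ℕ)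
    (h : 1 ≤ c * ∑ i ∈ Finset.range k, x ^ i / (Nat.factorial i : ℝ)) : Real.exp (-x) ≤ c := by
  have h1 := Real.sum_le_exp_of_nonneg hx k
  rw [Real.exp_neg, inv_le_comm₀ (Real.exp_pos x) hc, inv_le_iff_one_le_mul₀ hc, mul_comm]
  exact h.trans (mul_le_mul_of_nonneg_left h1 hc.le)

/-- Geometric terms, weighted by `n ^ 2`. -/
theorem sq_mul_exp_le {n ℓ : ℕ} {c x : ℝ} (hℓ : 2 ≤ ℓ) (hn : n ≤ 2 ^ ℓ) (hx0 : 0 ≤ x)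
    (hc0 : 0 ≤ c) (hx : 4 * x ≤ c) (hc1 : c ≤ 1) : (n : ℝ) ^ 2 * x ^ ℓ ≤ c ^ 2 := by
  have h1 : (n : ℝ) ≤ 2 ^ ℓ := by exact_mod_cast hn
  calc (n : ℝ) ^ 2 * x ^ ℓ ≤ (2 ^ ℓ) ^ 2 * x ^ ℓ := by gcongr
    _ = (4 * x) ^ ℓ := by rw [mul_pow, ← pow_mul, mul_comm ℓ 2, pow_mul]; norm_num
    _ ≤ c ^ ℓ := by gcongr
    _ ≤ c ^ 2 := pow_le_pow_of_le_one hc0 hc1 hℓ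

/-- One factor `n` comes from the union bound and one from the target `1 / n`; together they are at
most `4 ^ ℓ`. Each term decays faster than `4 ^ (-ℓ)`, with exponents `4.32 * 0.826 ≥ 3.568` and
`4.32 * 0.4 = 1.728`, and `ℓ ≥ 2` absorbs the prefactors. -/
theorem failure_bound_le {n ℓ : ℕ} {lam : ℝ} (hℓ : 2 ≤ ℓ) (hn : n ≤ 2 ^ ℓ) (hlam : 4.32 * ℓ ≤ lam) :
    (n : ℝ) ^ 2 * (Real.exp (1.75 * 1.5 - lam * (1 - Real.exp (-1.75))) +
      Real.exp (-(lam * (0.8 / 2))) / 0.8 + (1 - 0.0722 / 2) ^ (72 * ℓ)) ≤ 1 := by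
  have e1 : Real.exp (-1.75) ≤ 0.174 := exp_neg_le_of_sum (by norm_num) (by norm_num) 10
    (by norm_num [Finset.sum_range_succ, Nat.factorial])
  have e2 : Real.exp (-3.568) ≤ 0.0285 := exp_neg_le_of_sum (by norm_num) (by norm_num) 14
    (by norm_num [Finset.sum_range_succ, Nat.factorial])
  have e3 : Real.exp (-1.728) ≤ 0.17775 := exp_neg_le_of_sum (by norm_num) (by norm_num) 10
    (by norm_num [Finset.sum_range_succ, Nat.factorial])
  have e4 : Real.exp (1.75 * 1.5) ≤ 14 := by
    -- The eighth power makes the exponent the integer `21`.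
    refine le_of_pow_le_pow_left₀ (n := 8) (by norm_num) (by norm_num) ?_
    rw [← Real.exp_nat_mul, show ((8 : ℕ) : ℝ) * (1.75 * 1.5) = (21 : ℕ) * 1 by norm_num,
      Real.exp_nat_mul]
    refine (pow_le_pow_left₀ (Real.exp_pos 1).le Real.exp_one_lt_d9.le 21).trans (by norm_num)
  have hl0 : (0 : ℝ) ≤ ℓ := Nat.cast_nonneg ℓ
  have t1 : Real.exp (1.75 * 1.5 - lam * (1 - Real.exp (-1.75))) ≤ 14 * Real.exp (-3.568) ^ ℓ := by
    rw [← Real.exp_nat_mul, sub_eq_add_neg, Real.exp_add]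
    have : Real.exp (-(lam * (1 - Real.exp (-1.75)))) ≤ Real.exp (ℓ * -3.568) := by
      refine Real.exp_le_exp.2 ?_
      have : 4.32 * ℓ * 0.826 ≤ lam * (1 - Real.exp (-1.75)) :=
        mul_le_mul hlam (by linarith) (by norm_num) (by linarith)
      linarith
    gcongr
  have t2 : Real.exp (-(lam * (0.8 / 2))) ≤ Real.exp (-1.728) ^ ℓ := by
    rw [← Real.exp_nat_mul]
    exact Real.exp_le_exp.2 (by linarith)
  have t3 : ((1 - 0.0722 / 2 : ℝ)) ^ (72 * ℓ) ≤ 0.0725 ^ ℓ := by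
    rw [pow_mul]
    exact pow_le_pow_left₀ (by norm_num) (by norm_num) ℓ
  have s1 := sq_mul_exp_le (c := 0.114) hℓ hn (Real.exp_pos (-3.568)).le (by norm_num)
    (by linarith) (by norm_num)
  have s2 := sq_mul_exp_le (c := 0.711) hℓ hn (Real.exp_pos (-1.728)).le (by norm_num)
    (by linarith) (by norm_num)
  have s3 := sq_mul_exp_le (c := 0.29) (x := 0.0725) hℓ hn (by norm_num) (by norm_num)
    (by norm_num) (by norm_num)
  have hn0 : (0 : ℝ) ≤ (n : ℝ) ^ 2 := by positivity
  calc _ ≤ (n : ℝ) ^ 2 * (14 * Real.exp (-3.568) ^ ℓ + Real.exp (-1.728) ^ ℓ / 0.8 + 0.0725 ^ ℓ) := by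
        gcongr
    _ = 14 * ((n : ℝ) ^ 2 * Real.exp (-3.568) ^ ℓ) + ((n : ℝ) ^ 2 * Real.exp (-1.728) ^ ℓ) / 0.8 +
        (n : ℝ) ^ 2 * 0.0725 ^ ℓ := by ring
    _ ≤ 14 * 0.114 ^ 2 + 0.711 ^ 2 / 0.8 + 0.29 ^ 2 := by gcongr
    _ ≤ 1 := by norm_num

/-- `72 * 0.01 = 0.72` exceeds the natural logarithm of `2`. -/
theorem exp_neg_clog_le {n : ℕ} (hn : 1 ≤ n) :
    Real.exp (-(72 * Nat.clog 2 n * 0.01)) ≤ 1 / (n : ℝ) := by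
  have e1 : Real.exp (-0.72) ≤ 1 / 2 := exp_neg_le_of_sum (by norm_num) (by norm_num) 4
    (by norm_num [Finset.sum_range_succ, Nat.factorial])
  have h1 : (n : ℝ) ≤ 2 ^ Nat.clog 2 n := by exact_mod_cast Nat.le_pow_clog (by norm_num) n
  have hn0 : (0 : ℝ) < n := by exact_mod_cast hn
  calc _ = Real.exp (-0.72) ^ Nat.clog 2 n := by rw [← Real.exp_nat_mul]; congr 1; ring
    _ ≤ (1 / 2) ^ Nat.clog 2 n := by gcongr
    _ = 1 / 2 ^ Nat.clog 2 n := by rw [one_div_pow]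
    _ ≤ _ := by gcongr

variable {V : Type} [Fintype V] [DecidableEq V] {G : SimpleGraph V} [DecidableRel G.Adj]

/-- On a single edge both degrees are `1`, so the walk crosses at once. -/
theorem hit_eq_one_of_card_eq_two {s t : V} (hV : Fintype.card V = 2) (hst : G.Reachable s t)
    (hne : s ≠ t) {k : ℕ} (hk : 1 ≤ k) : 1 ≤ hit G {t} k s := by
  obtain ⟨u, hu⟩ : ∃ u, G.Adj s u := by
    obtain ⟨w⟩ := hst
    cases w with
    | nil => exact absurd rfl hne
    | cons h _ => exact ⟨_, h⟩
  have hcard : (({s, t} : Finset V)) = Finset.univ :=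
    (Finset.card_eq_iff_eq_univ _).1 (by rw [hV, Finset.card_pair hne])
  have hut : u = t := by
    have : u ∈ ({s, t} : Finset V) := hcard ▸ Finset.mem_univ u
    simp only [Finset.mem_insert, Finset.mem_singleton] at this
    exact this.resolve_left hu.ne'
  subst hut
  have hdeg : ∀ v w, G.Adj v w → G.degree v = 1 := fun v w h => by
    have h1 := G.degree_lt_card_verts v
    have h2 : 0 < G.degree v := (G.degree_pos_iff_exists_adj v).2 ⟨w, h⟩
    omega
  refine le_trans ?_ (hit_mono {u} hk s)
  rw [hit_succ (by simpa using hne)]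
  refine le_trans ?_ (Finset.single_le_sum
    (fun x _ => mul_nonneg (trans_nonneg G s x) (hit_nonneg _ _ _)) (Finset.mem_univ u))
  rw [hit_of_mem (by simp), trans_adj G hu, hdeg s u hu, hdeg u s hu.symm]
  norm_num

open Classical in
/-- The landmark algorithm errs with probability at most `1 / n` on connected pairs. -/
theorem landmarkAlgorithm_false_le_inv {s t : V} {p : ℕ} (hp : 1 ≤ p) (hst : G.Reachable s t) :
    landmarkAlgorithm G s t p false ≤ 1 / (Fintype.card V : ℝ≥0∞) := by
  have : Nonempty V := ⟨s⟩
  rcases eq_or_ne s t with rfl | hne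
  · have h0 : landmarkAlgorithm G s s p false = 0 := by
      rw [landmarkAlgorithm_false_eq]
      simp only [if_pos (Relation.EqvGen.refl s), pexp_const]
    rw [h0]
    exact zero_le
  set n := Fintype.card V with hn
  set ℓ := Nat.clog 2 n with hℓ
  set m := nPCeil n p G.maxDegree with hm
  have hn2 : 2 ≤ n := Fintype.one_lt_card_iff.2 ⟨s, t, hne⟩
  have hn0 : (0 : ℝ) < n := by exact_mod_cast (show 0 < n by omega)
  have hℓ1 : 1 ≤ ℓ := Nat.clog_pos (by norm_num) hn2
  have hp0 : (0 : ℝ) < p := by exact_mod_cast hp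
  have hmnat : 60 * n * ℓ ≤ p * m := by
    have h1 : 60 * n * ℓ ≤ p • ((60 * n * ℓ) ⌈/⌉ p) := le_smul_ceilDiv hp
    exact h1.trans (Nat.mul_le_mul_left p (le_max_left _ _))
  have hmΔ : G.maxDegree ≤ m := le_max_right _ _
  have hm1 : 1 ≤ m := by
    by_contra h
    have h0 : m = 0 := by omega
    rw [h0, mul_zero] at hmnat
    have : 0 < 60 * n * ℓ := by positivity
    omega
  have hdone : ∀ {x : ℝ}, landmarkAlgorithm G s t p false ≤ ENNReal.ofReal x → x ≤ 1 / n →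
      landmarkAlgorithm G s t p false ≤ 1 / (n : ℝ≥0∞) := fun h hx => by
    refine h.trans ((ENNReal.ofReal_le_ofReal hx).trans (le_of_eq ?_))
    rw [ENNReal.ofReal_div_of_pos hn0, ENNReal.ofReal_one, ENNReal.ofReal_natCast]
  have hdirect : 0.01 ≤ hit G {t} (m ^ 2) s →
      landmarkAlgorithm G s t p false ≤ 1 / (n : ℝ≥0∞) := fun h =>
    hdone (landmarkAlgorithm_false_le_of_hit hne h) (exp_neg_clog_le (by omega))
  -- `failure_bound_le` needs `⌈log n⌉ ≥ 2`, that is `n ≥ 3`; two nodes are treated directly.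
  rcases hn2.eq_or_lt with h2 | h3
  · exact hdirect (le_trans (by norm_num)
      (hit_eq_one_of_card_eq_two h2.symm hst hne (Nat.one_le_pow _ _ hm1)))
  have hℓ2 : 2 ≤ ℓ := by
    have : 1 < ℓ := (Nat.lt_clog_iff_pow_lt (by norm_num)).2 (by simpa using h3)
    exact this
  set τ := m ^ 2 with hτ
  have hτ1 : 1 ≤ τ := Nat.one_le_pow _ _ hm1
  -- Half the walk length, rounded up: one half of a walk to reach the crossing edge, the other half
  -- to hit a landmark from there.
  obtain ⟨T, hT1, hTτ, hTτ'⟩ : ∃ T, 1 ≤ T ∧ T + (T - 1) ≤ τ ∧ τ ≤ 2 * T :=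
    ⟨(τ + 1) / 2, by omega, by omega, by omega⟩
  -- If the ratio is at least `0.01`, it bounds the probability of hitting `t` from `s` from below.
  by_cases hsmall : green G T s t < 0.01 * green G T t t
  swap
  · refine hdirect ?_
    have hg : 0 < green G T t t := lt_of_lt_of_le one_pos (one_le_green G hT1 t)
    have h1 := mul_green_le_hit_self (G := G) (B := {t}) (T := T) (r := 0) (w := t)
      (κ := 1 / green G T t t) (by positivity)
      (by rw [hit_of_mem (by simp), one_div_mul_cancel hg.ne']) le_rfl s
    rw [add_zero] at h1
    refine le_trans ?_ (h1.trans (hit_mono {t} (show T ≤ τ by omega) s))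
    rw [one_div_mul_eq_div, le_div_iff₀ hg]
    exact not_lt.1 hsmall
  set M := Real.sqrt T with hM
  have hT0 : (0 : ℝ) < T := by exact_mod_cast hT1
  have hM0 : 0 < M := Real.sqrt_pos.2 hT0
  have hMT : M ^ 2 = T := Real.sq_sqrt hT0.le
  have hmM : (m : ℝ) ≤ 1.41422 * M := by
    have h1 : (m : ℝ) ^ 2 ≤ 2 * T := by exact_mod_cast hTτ'
    refine le_of_sq_le_sq ?_ (by positivity)
    nlinarith
  have hΔM : (G.maxDegree : ℝ) ≤ 1.4143 * M := by
    have : (G.maxDegree : ℝ) ≤ m := by exact_mod_cast hmΔ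
    linarith
  have hcard := sq_le_card_sq G hst hT1 hsmall
  have hF : ∀ u, G.Reachable s u → green G T u u + G.maxDegree ≤ 9.82 * M := by
    intro u hu
    have heq : (Finset.univ.filter fun v => G.Reachable u v) =
        Finset.univ.filter fun v => G.Reachable s v :=
      Finset.filter_congr fun v _ => ⟨hu.trans, hu.symm.trans⟩
    have := green_diag_le G (w := u) hT1 hM0 hMT hΔM (by rw [heq]; exact hcard)
    linarith
  -- Covers the `8.4 M` visits and the maximum degree, at most `1.4143 M` since `Δ ≤ m ≤ √2 M` up to
  -- rounding of constants.
  set F := 9.82 * M with hFdef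
  have hF0 : 0 < F := by positivity
  have e1 : Real.exp (-0.075) ≤ 1 - 0.0722 := exp_neg_le_of_sum (by norm_num) (by norm_num) 4
    (by norm_num [Finset.sum_range_succ, Nat.factorial])
  -- With `z = 0.8` and `y = 1.5 F` the crossing exponent is `(0.2 / 2) * 0.75 = 0.075`, whence `q`;
  -- `θ = 1.75` is the Chernoff parameter.
  have hfail := landmarkAlgorithm_false_le (p := p) (y := 1.5 * F) (z := 0.8) (θ := 1.75)
    (q := 0.0722) hst hT1 hTτ hF (by norm_num) (by norm_num) (by norm_num) (by norm_num)
    (le_of_eq_of_le (by congr 1; field_simp; norm_num) e1)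
  refine hdone hfail ?_
  rw [mul_div_assoc, div_self hF0.ne', mul_one]
  -- This is where `γ = 60` enters: `4.32 * 9.82 * 1.41422 < 60`.
  have hlam : 4.32 * (ℓ : ℝ) ≤ p * (T / (n * F)) := by
    have h1 : 60 * (n : ℝ) * ℓ ≤ p * m := by exact_mod_cast hmnat
    rw [← hMT, hFdef, mul_div_assoc', le_div_iff₀ (by positivity)]
    have h2 : 60 * (n : ℝ) * ℓ ≤ p * (1.41422 * M) := h1.trans (by gcongr)
    have h3 : (0 : ℝ) ≤ n * ℓ := by positivity
    have h4 : 4.32 * 9.82 * ((n : ℝ) * ℓ) ≤ p * M := by linarith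
    nlinarith
  rw [le_div_iff₀ hn0]
  refine le_of_eq_of_le ?_ (failure_bound_le hℓ2 (Nat.le_pow_clog (by norm_num) n) hlam)
  ring

end Landmark

end

theorem mainTheorem2 :
    ∃ (P : RAM.Program) (C k : ℕ),
      ∀ (n p : ℕ) (G : SimpleGraph (Fin n)) [DecidableRel G.Adj]
        (port : ∀ v : Fin n, G.neighborSet v ≃ Fin (G.degree v)) (s t : Fin n),
        1 ≤ p → G ≠ ⊥ →
        RAM.SpaceAtMost P (ustconInput G port s t p)
          (C * Real.logb 2 (n + p) ^ k * p) ∧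
        RAM.TimeAtMost P (ustconInput G port s t p)
          (C * Real.logb 2 (n + p) ^ k * (nP n p G.maxDegree ^ 2 * p)) ∧
        (∀ b, RAM.outputProb P (ustconInput G port s t p) b = landmarkAlgorithm G s t p b) ∧
        (¬ G.Reachable s t → RAM.outputProb P (ustconInput G port s t p) true = 0) ∧
        (G.Reachable s t → RAM.outputProb P (ustconInput G port s t p) false ≤ 1 / (n : ENNReal)) := by
  refine ⟨RAM.ustconProgram, 10 ^ 8, 3, ?_⟩
  intro n p G _ port s t hp hG
  obtain ⟨h1, h2, h3⟩ := ustcon_resources n p G port s t hp hG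
  refine ⟨h1, h2, h3, fun h => ?_, fun h => ?_⟩
  · rw [h3]
    exact landmarkAlgorithm_true_eq_zero h
  · rw [h3]
    simpa only [Fintype.card_fin] using Landmark.landmarkAlgorithm_false_le_inv hp h
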